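/- **Setting.** Let $d\ge 1$, let $(\Omega,\mathcal F,\mathbb P)$ be a probability space and consider $$u_t=F(D^2u,\nabla u,u,x,\omega)\qquad\text{on }(0,\infty)\times\mathbb R^d.\tag{1}$$ "Solution" means solution in a fixed one of the usual senses (classical, viscosity, or distributional for $F$ in divergence form), belonging to a fixed class $\mathcal A\subseteq L^1_{\rm loc}((0,\infty)\times\mathbb R^d)$ of functions that is invariant under translations in $x$; initial values are attained in $L^1_{\rm loc}$. **Hypothesis H.** Assume the following. (i) For each $\omega\in\Omega$ and each locally BV initial value $0\le u_0\le 1$, (1) has a unique solution in $\mathcal A$; it is $\equiv 0$ (resp. $\equiv 1$) if $u_0\equiv 0$ (resp. $u_0\equiv1$). If $u$ is a solution and $s>0$, then $u(s+\cdot,\cdot)$ is a solution from $\mathcal A$ (with initial value $u(s,\cdot)$). The comparison principle holds: if $u,v\in\mathcal A$ are solutions for the same $\omega$ and $u(0,\cdot)\le v(0,\cdot)$, then $u\le v$. For each such $u_0$ the solution is jointly measurable in $(\omega,t,x)$. (ii) There are $m',c'>0$ such that if $\omega\in\Omega$, $r>0$, $y\in\mathbb R^d$, and $u,u'\in\mathcal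 A$ are $[0,1]$-valued solutions with $u(0,x)\le u'(0,x)$ for all $x\in B_r(y)$, then $u(t,y)\le u'(t,y)+c'e^{-m'(r-c't)}$ for all $t>0$. There are $\theta_0\in(0,1)$ and $R_0\in(0,\infty)$ such that the solutions $u_\omega$ with $u_\omega(0,\cdot)=\theta_0\chi_{B_{R_0}(0)}$ satisfy $\lim_{t\to\infty}\inf_{\omega\in\Omega}u_\omega(t,x)=1$ locally uniformly in $x\in\mathbb R^d$. (iii) There is a group of measure-preserving transformations $\{T_y\}_{y\in\mathbb R^d}$ of $\Omega$ with $T_yT_z=T_{y+z}$ and $(y,\omega)\mapsto T_y\omega$ measurable, such that $F(X,p,u,x+y,\omega)=F(X,p,u,x,T_y\omega)$, and such that $\mathbb P[B]\in\{0,1\}$ whenever $B\in\mathcal F$ satisfies $T_yB=B$ for all $y$. **Definitions.** For $e\in\mathbb S^{d-1}$ and $\alpha\in[0,1]$ let $u_{\omega,e}$ and $u_{\omega,e,\alpha}$ be the solutions of (1) with $u_{\omega,e}(0,\cdot)=\theta_0\chi_{\{x\cdot e<0\}}$ and $u_{\omega,e,\alpha}(0,\cdot)=\chi_{\{x\cdot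 e<0\}}+\alpha\chi_{\{x\cdot e\ge 0\}}$. * $c\in\mathbb R$ is a *front speed* in direction $e$ for $\omega$ if for each compact $K\subseteq\{x\cdot e>0\}$ we have $\lim_{t\to\infty}\inf_{x\in(ce-K)t}u_{\omega,e}(t,x)=1$ and $\lim_{t\to\infty}\sup_{x\in(ce+K)t}u_{\omega,e}(t,x)=0$. It is a *deterministic* front speed if this holds for almost all $\omega$ with the same $c$. * A front speed $c$ is *exclusive* for $\omega$, with functions $\beta_{K,e}$, if for each compact $K\subseteq\{x\cdot e>0\}$ we have $\beta_{K,e}:(0,1]\to(0,1]$, $\lim_{\alpha\to0}\beta_{K,e}(\alpha)=0$, and $\limsup_{t\to\infty}\sup_{x\in(ce+K)t}u_{\omega,e,\alpha}(t,x)\le\beta_{K,e}(\alpha)$ for all $\alpha\in(0,1]$. It is a *deterministic* exclusive front speed if this holds for almost all $\omega$ with the same $c$ and the same $\beta_{K,e}$. * For a continuous $w:\mathbb S^{d-1}\to(0,\infty)$, the set $\mathcal S=\{se: e\in\mathbb S^{d-1},\,0\le s<w(e)\}$ is a *deterministic Wulff shape* if for almost all $\omega$, $\lim_{t\to\infty}\inf_{x\in(1-\delta)\mathcal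 St}u_\omega(t,x)=1$ for each $\delta\in(0,1)$ and $\lim_{t\to\infty}\sup_{x\notin(1+\delta)\mathcal St}u_\omega(t,x)=0$ for each $\delta>0$. Let $\mathcal T$ (resp. $\tilde{\mathcal T}$) be the set of all $e\in\mathbb S^{d-1}$ for which (1) has a deterministic front speed (resp. deterministic exclusive front speed), and denote this speed by $c^*(e)$. Let $e_1$ be the first standard basis vector. **Theorem 1.9.** Assume Hypothesis H. (i) $\mathcal T$ and $\tilde{\mathcal T}$ are closed, $0<c^*\le c'$ on $\mathcal T$, and $c^*$ is Lipschitz on $\mathcal T$. Moreover, there are $\Omega_0\in\mathcal F$ with $\mathbb P[\Omega_0]=1$ and functions $\beta_{K,e}$, independent of $\omega$, such that for every $\omega\in\Omega_0$: $c^*(e)$ is a front speed in direction $e$ for $\omega$ for every $e\in\mathcal T$, and an exclusive front speed with the functions $\beta_{K,e}$ for every $e\in\tilde{\mathcal T}$; here $\beta_{K,e_1}:(0,1]\to(0,1]$ with $\lim_{\alpha\to0}\beta_{K,e_1}(\alpha)=0$ for each compact $K\subseteq\{x_1>0\}$, and $\beta_{RK,e}=\beta_{K,e_1}$ for each such $K$,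 each $e\in\tilde{\mathcal T}$ and each linear isometry $R$ of $\mathbb R^d$ with $Re_1=e$. Furthermore, for each $\omega\in\Omega_0$, $\Lambda>0$, compact $K\subseteq\{x_1>0\}$ and $\alpha\in(0,1]$, $$\lim_{t\to\infty}\ \inf_{e\in\mathcal T,\,|y|\le\Lambda t,\,Re_1=e}\ \inf_{x\in(c^*(e)e-RK)t}u_{T_y\omega,e}(t,x)=1,$$ $$\lim_{t\to\infty}\ \sup_{e\in\mathcal T,\,|y|\le\Lambda t,\,Re_1=e}\ \sup_{x\in(c^*(e)e+RK)t}u_{T_y\omega,e}(t,x)=0,$$ $$\limsup_{t\to\infty}\ \sup_{e\in\tilde{\mathcal T},\,|y|\le\Lambda t,\,Re_1=e}\ \sup_{x\in(c^*(e)e+RK)t}u_{T_y\omega,e,\alpha}(t,x)\le\beta_{K,e_1}(\alpha),$$ where $R$ ranges over the linear isometries of $\mathbb R^d$. (An infimum over the empty set is read as $1$ and a supremum as $0$.) (ii) If (1) has a deterministic Wulff shape, given by $w$, then for each $e\in\mathbb S^{d-1}$ $$w(e)=\inf_{e'\in\mathcal T,\ e'\cdot e>0}\frac{c^*(e')}{e'\cdot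 e}.$$ -/

import Mathlib

open MeasureTheory Filter Topology Set


noncomputable section

namespace FrontSpeeds

/-- The physical space `ℝ^d` with its Euclidean norm. -/
abbrev Space (d : ℕ) := EuclideanSpace ℝ (Fin d)

/-- Right-hand sides `G(X, p, s, x)` of evolution equations `u_t = G(D²u, ∇u, u, x)`.
Only symmetric matrices `X` are ever inserted. -/
abbrev Rhs (d : ℕ) := Matrix (Fin d) (Fin d) ℝ → Space d → ℝ → Space d → ℝ

variable {d : ℕ}

/-- The `i`-th standard basis vector. -/
def basisVec (i : Fin d) : Space d := EuclideanSpace.single i (1 : ℝ)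

/-- The matrix `D²v(x)` of second partial derivatives. -/
def hessian (v : Space d → ℝ) (x : Space d) : Matrix (Fin d) (Fin d) ℝ :=
  Matrix.of fun i j => fderiv ℝ (fderiv ℝ v) x (basisVec i) (basisVec j)

/-- The divergence of a vector field. -/
def divergence (φ : Space d → Space d) (x : Space d) : ℝ :=
  ∑ i, (fderiv ℝ φ x (basisVec i)) i

/-- Functions of locally bounded variation on `ℝ^d`: locally integrable, and the distributional
gradient has finite total variation on every ball. -/
def LocallyBV (g : Space d → ℝ) : Prop :=
  LocallyIntegrable g ∧
    ∀ R : ℝ, 0 < R → ∃ C : ℝ, ∀ φ : Space d → Space d, ContDiff ℝ 1 φ →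
      tsupport φ ⊆ Metric.ball 0 R → (∀ x, ‖φ x‖ ≤ 1) →
        |∫ x, g x * divergence φ x| ≤ C

/-! ### Solutions of `u_t = G(D²u, ∇u, u, x)` on `(0,∞) × ℝ^d`

A function on `(0,∞) × ℝ^d` is represented by `u : ℝ → Space d → ℝ`; its values at times `t ≤ 0`
play no role. -/

/-- Classical (that is, `C^{1,2}`) solutions. -/
structure IsClassicalSolution (G : Rhs d) (u : ℝ → Space d → ℝ) : Prop where
  time_diff : ∀ t, 0 < t → ∀ x, DifferentiableAt ℝ (fun s => u s x) t
  space_smooth : ∀ t, 0 < t → ContDiff ℝ 2 (u t)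
  cont_time : ContinuousOn (fun z : ℝ × Space d => deriv (fun s => u s z.2) z.1)
    (Ioi 0 ×ˢ univ)
  cont_grad : ContinuousOn (fun z : ℝ × Space d => gradient (u z.1) z.2) (Ioi 0 ×ˢ univ)
  cont_hess : ContinuousOn (fun z : ℝ × Space d => hessian (u z.1) z.2) (Ioi 0 ×ˢ univ)
  equation : ∀ t, 0 < t → ∀ x,
    deriv (fun s => u s x) t = G (hessian (u t) x) (gradient (u t) x) (u t x) x

/-- Upper semicontinuous envelope (of a locally bounded function). -/
def upperEnvelope (u : ℝ → Space d → ℝ) (z : ℝ × Space d) : ℝ :=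
  limsup (fun q : ℝ × Space d => u q.1 q.2) (𝓝 z)

/-- Lower semicontinuous envelope (of a locally bounded function). -/
def lowerEnvelope (u : ℝ → Space d → ℝ) (z : ℝ × Space d) : ℝ :=
  liminf (fun q : ℝ × Space d => u q.1 q.2) (𝓝 z)

/-- (Possibly discontinuous) viscosity solutions. -/
structure IsViscositySolution (G : Rhs d) (u : ℝ → Space d → ℝ) : Prop where
  locally_bounded : ∀ z : ℝ × Space d, 0 < z.1 → ∃ C : ℝ, ∀ᶠ q in 𝓝 z, |u q.1 q.2| ≤ C
  subsolution : ∀ φ : ℝ × Space d → ℝ, ContDiff ℝ 2 φ → ∀ t, 0 < t → ∀ x,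
    IsLocalMax (fun z => upperEnvelope u z - φ z) (t, x) →
      deriv (fun s => φ (s, x)) t ≤
        G (hessian (fun z => φ (t, z)) x) (gradient (fun z => φ (t, z)) x)
          (upperEnvelope u (t, x)) x
  supersolution : ∀ φ : ℝ × Space d → ℝ, ContDiff ℝ 2 φ → ∀ t, 0 < t → ∀ x,
    IsLocalMin (fun z => lowerEnvelope u z - φ z) (t, x) →
      G (hessian (fun z => φ (t, z)) x) (gradient (fun z => φ (t, z)) x)
          (lowerEnvelope u (t, x)) x ≤
        deriv (fun s => φ (s, x)) t

/-- `G(D²v, ∇v, v, x) = ∑ ∂ᵢ∂ⱼ [aᵢⱼ(x, v)] + div [b(x, v)] + c(x, v)` for all smooth `v` with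
values strictly between the two equilibria `0` and `1`. -/
structure HasDivergenceForm (G : Rhs d) (a : Space d → ℝ → Matrix (Fin d) (Fin d) ℝ)
    (b : Space d → ℝ → Space d) (c : Space d → ℝ → ℝ) : Prop where
  cont_a : ∀ x, ContinuousOn (a x) (Icc 0 1)
  cont_b : ∀ x, ContinuousOn (b x) (Icc 0 1)
  cont_c : ∀ x, ContinuousOn (c x) (Icc 0 1)
  smooth_a : ∀ v : Space d → ℝ, ContDiff ℝ (⊤ : ℕ∞) v → (∀ x, v x ∈ Ioo (0 : ℝ) 1) →
    ∀ i j, ContDiff ℝ 2 (fun x => a x (v x) i j)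
  smooth_b : ∀ v : Space d → ℝ, ContDiff ℝ (⊤ : ℕ∞) v → (∀ x, v x ∈ Ioo (0 : ℝ) 1) →
    ContDiff ℝ 1 (fun x => b x (v x))
  identity : ∀ v : Space d → ℝ, ContDiff ℝ (⊤ : ℕ∞) v → (∀ x, v x ∈ Ioo (0 : ℝ) 1) → ∀ x,
    G (hessian v x) (gradient v x) (v x) x =
      (∑ i, ∑ j, hessian (fun z => a z (v z) i j) x i j)
        + divergence (fun z => b z (v z)) x + c x (v x)

/-- Distributional solutions with values in `[0,1]`, for right-hand sides in divergence form
(for instance reaction-diffusion equations and porous medium equations). -/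
def IsDistributionalSolution (G : Rhs d) (u : ℝ → Space d → ℝ) : Prop :=
  (∀ t, 0 < t → ∀ x, u t x ∈ Icc (0 : ℝ) 1) ∧
  ∃ (a : Space d → ℝ → Matrix (Fin d) (Fin d) ℝ) (b : Space d → ℝ → Space d)
    (c : Space d → ℝ → ℝ), HasDivergenceForm G a b c ∧
    LocallyIntegrableOn (fun z : ℝ × Space d => u z.1 z.2) (Ioi 0 ×ˢ univ) ∧
    (∀ i j, LocallyIntegrableOn (fun z : ℝ × Space d => a z.2 (u z.1 z.2) i j)
      (Ioi 0 ×ˢ univ)) ∧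
    LocallyIntegrableOn (fun z : ℝ × Space d => b z.2 (u z.1 z.2)) (Ioi 0 ×ˢ univ) ∧
    LocallyIntegrableOn (fun z : ℝ × Space d => c z.2 (u z.1 z.2)) (Ioi 0 ×ˢ univ) ∧
    ∀ φ : ℝ × Space d → ℝ, ContDiff ℝ (⊤ : ℕ∞) φ → HasCompactSupport φ →
      tsupport φ ⊆ Ioi 0 ×ˢ univ →
      ∫ z in Ioi (0 : ℝ) ×ˢ (univ : Set (Space d)),
        (u z.1 z.2 * deriv (fun s => φ (s, z.2)) z.1
          + (∑ i, ∑ j, a z.2 (u z.1 z.2) i j * hessian (fun x => φ (z.1, x)) z.2 i j)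
          - inner ℝ (b z.2 (u z.1 z.2)) (gradient (fun x => φ (z.1, x)) z.2)
          + c z.2 (u z.1 z.2) * φ z) = 0

/-- The usual senses in which a function may solve the equation. -/
inductive SolutionSense
  | classical
  | viscosity
  | distributional

/-- `u` solves `u_t = G(D²u, ∇u, u, x)` on `(0,∞) × ℝ^d` in the given sense. -/
def SolutionSense.Solves (S : SolutionSense) (G : Rhs d) (u : ℝ → Space d → ℝ) : Prop :=
  match S with
  | .classical => IsClassicalSolution G u
  | .viscosity => IsViscositySolution G u
  | .distributional => IsDistributionalSolution G u

/-- The initial condition `u(0,·) = u₀`, in the sense of `L¹_loc`. -/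
def HasInitialValue (u : ℝ → Space d → ℝ) (u₀ : Space d → ℝ) : Prop :=
  LocallyIntegrable u₀ ∧ (∀ t, 0 < t → LocallyIntegrable (u t)) ∧
    ∀ K : Set (Space d), IsCompact K →
      Tendsto (fun t => ∫ x in K, |u t x - u₀ x|) (𝓝[>] 0) (𝓝 0)

/-! ### The random equation `u_t = F(D²u, ∇u, u, x, ω)` -/

/-- The data: the random nonlinearity `F`, the transformations `shift y` of `Ω`, the sense of
solution, and the class of functions in which solutions are sought. No property is built in. -/
structure RandomPDE (d : ℕ) (Ω : Type*) where
  F : Matrix (Fin d) (Fin d) ℝ → Space d → ℝ → Space d → Ω → ℝ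
  shift : Space d → Ω → Ω
  sense : SolutionSense
  cls : Set (ℝ → Space d → ℝ)

variable {Ω : Type*}

/-- `u` is a solution from the class, for the environment `ω`, with initial value `u₀`. -/
def RandomPDE.IsSolution (E : RandomPDE d Ω) (ω : Ω) (u₀ : Space d → ℝ)
    (u : ℝ → Space d → ℝ) : Prop :=
  u ∈ E.cls ∧ E.sense.Solves (fun X p s x => E.F X p s x ω) u ∧ HasInitialValue u u₀

/-- Initial data considered: locally BV with values in `[0,1]`. -/
def Admissible (u₀ : Space d → ℝ) : Prop :=
  LocallyBV u₀ ∧ ∀ x, 0 ≤ u₀ x ∧ u₀ x ≤ 1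

/-- The solution with initial value `u₀`. Existence, and uniqueness at times `t > 0`, for
admissible `u₀` are part of the basic hypothesis below. -/
def RandomPDE.sol (E : RandomPDE d Ω) (ω : Ω) (u₀ : Space d → ℝ) : ℝ → Space d → ℝ :=
  Classical.epsilon (E.IsSolution ω u₀)

/-- The datum `θ₀ χ_{B_{R₀}(0)}`. -/
def ballDatum (θ₀ R₀ : ℝ) : Space d → ℝ :=
  (Metric.ball (0 : Space d) R₀).indicator fun _ => θ₀

/-- The datum `θ₀ χ_{x·e < 0}`. -/
def frontDatum (θ₀ : ℝ) (e : Space d) : Space d → ℝ :=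
  {x : Space d | inner ℝ x e < 0}.indicator fun _ => θ₀

/-- The datum `χ_{x·e < 0} + α χ_{x·e ≥ 0}`. -/
def exclusiveDatum (α : ℝ) (e : Space d) : Space d → ℝ := fun x =>
  {x : Space d | inner ℝ x e < 0}.indicator (fun _ => (1 : ℝ)) x
    + {x : Space d | 0 ≤ inner ℝ x e}.indicator (fun _ => α) x

/-- The basic hypothesis on the random equation. -/
structure HypothesisH [MeasurableSpace Ω] (P : Measure Ω) (E : RandomPDE d Ω)
    (mBar cBar θ₀ R₀ : ℝ) : Prop where
  /- (i): the class of functions and well-posedness -/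
  cls_locallyIntegrable : ∀ u ∈ E.cls,
    LocallyIntegrableOn (fun z : ℝ × Space d => u z.1 z.2) (Ioi 0 ×ˢ univ)
  cls_translate : ∀ u ∈ E.cls, ∀ y : Space d, (fun t x => u t (x + y)) ∈ E.cls
  exists_solution : ∀ ω u₀, Admissible u₀ → ∃ u, E.IsSolution ω u₀ u
  unique_solution : ∀ ω u₀ u v, Admissible u₀ → E.IsSolution ω u₀ u → E.IsSolution ω u₀ v →
    ∀ t, 0 < t → ∀ x, u t x = v t x
  sol_zero : ∀ ω u, E.IsSolution ω (fun _ => 0) u → ∀ t, 0 < t → ∀ x, u t x = 0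
  sol_one : ∀ ω u, E.IsSolution ω (fun _ => 1) u → ∀ t, 0 < t → ∀ x, u t x = 1
  time_shift : ∀ ω u₀ u, E.IsSolution ω u₀ u → ∀ s, 0 < s →
    E.IsSolution ω (u s) (fun t x => u (t + s) x)
  comparison : ∀ ω u₀ v₀ u v, E.IsSolution ω u₀ u → E.IsSolution ω v₀ v →
    (∀ x, u₀ x ≤ v₀ x) → ∀ t, 0 < t → ∀ x, u t x ≤ v t x
  /- (ii): upper and lower bounds on the speed of propagation -/
  mBar_pos : 0 < mBar
  cBar_pos : 0 < cBar
  localization : ∀ ω u₀ v₀ u v, E.IsSolution ω u₀ u → E.IsSolution ω v₀ v →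
    (∀ t, 0 < t → ∀ x, u t x ∈ Icc (0 : ℝ) 1) → (∀ t, 0 < t → ∀ x, v t x ∈ Icc (0 : ℝ) 1) →
    ∀ r, 0 < r → ∀ y, (∀ x ∈ Metric.ball y r, u₀ x ≤ v₀ x) →
      ∀ t, 0 < t → u t y ≤ v t y + cBar * Real.exp (-mBar * (r - cBar * t))
  theta_pos : 0 < θ₀
  theta_lt_one : θ₀ < 1
  radius_pos : 0 < R₀
  spreading : ∀ K : Set (Space d), IsCompact K → ∀ ε : ℝ, 0 < ε →
    ∀ᶠ t in atTop, ∀ ω, ∀ x ∈ K, 1 - ε ≤ E.sol ω (ballDatum θ₀ R₀) t x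
  /- (iii): a measurable, measure-preserving, ergodic group action, and stationarity of `F` -/
  shift_zero : ∀ ω, E.shift 0 ω = ω
  shift_add : ∀ y z ω, E.shift (y + z) ω = E.shift y (E.shift z ω)
  shift_measurable : Measurable fun q : Space d × Ω => E.shift q.1 q.2
  shift_preserving : ∀ y, MeasurePreserving (E.shift y) P P
  stationary : ∀ X p s x y ω, E.F X p s (x + y) ω = E.F X p s x (E.shift y ω)
  ergodic : ∀ B : Set Ω, MeasurableSet B → (∀ y, E.shift y '' B = B) → P B = 0 ∨ P B = 1
  /- the random functions `(ω, t, x) ↦ u_ω(t, x)` are measurable -/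
  sol_measurable : ∀ u₀, Admissible u₀ →
    Measurable fun q : Ω × Ioi (0 : ℝ) × Space d => E.sol q.1 u₀ q.2.1 q.2.2

/-! ### Wulff shapes and front speeds

Solutions take values in `[0,1]`, so `inf → 1` and `sup → 0` are spelled out as eventual bounds
by `1 - ε` from below and by `ε` from above. -/

/-- The set `{s e : |e| = 1, 0 ≤ s < w(e)}`. -/
def wulffSet (w : Space d → ℝ) : Set (Space d) :=
  {x | ∃ e : Space d, ‖e‖ = 1 ∧ ∃ s : ℝ, 0 ≤ s ∧ s < w e ∧ x = s • e}

/-- The set given by `w` is a Wulff shape for the fixed environment `ω`. -/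
def RandomPDE.IsWulffShape (E : RandomPDE d Ω) (θ₀ R₀ : ℝ) (ω : Ω) (w : Space d → ℝ) : Prop :=
  (∀ δ : ℝ, 0 < δ → δ < 1 → ∀ ε : ℝ, 0 < ε → ∀ᶠ t in atTop, ∀ x ∈ wulffSet w,
    1 - ε ≤ E.sol ω (ballDatum θ₀ R₀) t (((1 - δ) * t) • x)) ∧
  (∀ δ : ℝ, 0 < δ → ∀ ε : ℝ, 0 < ε → ∀ᶠ t in atTop, ∀ x, x ∉ wulffSet w →
    E.sol ω (ballDatum θ₀ R₀) t (((1 + δ) * t) • x) ≤ ε)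

/-- The set given by the continuous `w : 𝕊^{d-1} → (0,∞)` is a deterministic Wulff shape. -/
def RandomPDE.IsDeterministicWulffShape [MeasurableSpace Ω] (E : RandomPDE d Ω) (P : Measure Ω)
    (θ₀ R₀ : ℝ) (w : Space d → ℝ) : Prop :=
  ContinuousOn w (Metric.sphere 0 1) ∧ (∀ e ∈ Metric.sphere (0 : Space d) 1, 0 < w e) ∧
    ∀ᵐ ω ∂P, E.IsWulffShape θ₀ R₀ ω w

/-- `c` is a front speed in direction `e` for the fixed environment `ω`. -/
def RandomPDE.IsFrontSpeed (E : RandomPDE d Ω) (θ₀ : ℝ) (ω : Ω) (e : Space d) (c : ℝ) : Prop :=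
  ∀ K : Set (Space d), IsCompact K → K ⊆ {x | 0 < inner ℝ x e} →
    (∀ ε : ℝ, 0 < ε → ∀ᶠ t in atTop, ∀ x ∈ K,
      1 - ε ≤ E.sol ω (frontDatum θ₀ e) t (t • (c • e - x))) ∧
    (∀ ε : ℝ, 0 < ε → ∀ᶠ t in atTop, ∀ x ∈ K,
      E.sol ω (frontDatum θ₀ e) t (t • (c • e + x)) ≤ ε)

/-- `c` is a deterministic front speed in direction `e`. -/
def RandomPDE.IsDeterministicFrontSpeed [MeasurableSpace Ω] (E : RandomPDE d Ω) (P : Measure Ω)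
    (θ₀ : ℝ) (e : Space d) (c : ℝ) : Prop :=
  ∀ᵐ ω ∂P, E.IsFrontSpeed θ₀ ω e c

/-- Functions `b : (0,1] → (0,1]` with `b(α) → 0` as `α → 0`. -/
def IsModulus (b : ℝ → ℝ) : Prop :=
  (∀ α ∈ Ioc (0 : ℝ) 1, b α ∈ Ioc (0 : ℝ) 1) ∧ Tendsto b (𝓝[>] 0) (𝓝 0)

/-- `β K` is a function `(0,1] → (0,1]` vanishing at `0+`, for each compact `K ⊆ {x·e > 0}`. -/
def IsModulusFamily (e : Space d) (β : Set (Space d) → ℝ → ℝ) : Prop :=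
  ∀ K : Set (Space d), IsCompact K → K ⊆ {x | 0 < inner ℝ x e} → IsModulus (β K)

/-- `c` is an exclusive front speed in direction `e` for the fixed environment `ω`, with the
functions `β K` as the bounds. -/
def RandomPDE.IsExclusiveFrontSpeedWith (E : RandomPDE d Ω) (θ₀ : ℝ) (ω : Ω) (e : Space d)
    (c : ℝ) (β : Set (Space d) → ℝ → ℝ) : Prop :=
  E.IsFrontSpeed θ₀ ω e c ∧ IsModulusFamily e β ∧
    ∀ K : Set (Space d), IsCompact K → K ⊆ {x | 0 < inner ℝ x e} →
      ∀ α ∈ Ioc (0 : ℝ) 1, ∀ ε : ℝ, 0 < ε → ∀ᶠ t in atTop, ∀ x ∈ K,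
        E.sol ω (exclusiveDatum α e) t (t • (c • e + x)) ≤ β K α + ε

/-- `c` is an exclusive front speed in direction `e` for the fixed environment `ω`. -/
def RandomPDE.IsExclusiveFrontSpeed (E : RandomPDE d Ω) (θ₀ : ℝ) (ω : Ω) (e : Space d)
    (c : ℝ) : Prop :=
  ∃ β : Set (Space d) → ℝ → ℝ, E.IsExclusiveFrontSpeedWith θ₀ ω e c β

/-- `c` is a deterministic exclusive front speed in direction `e`: it is an exclusive front speed
for almost all `ω`, with the same bounds `β K`. -/
def RandomPDE.IsDeterministicExclusiveFrontSpeed [MeasurableSpace Ω] (E : RandomPDE d Ω)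
    (P : Measure Ω) (θ₀ : ℝ) (e : Space d) (c : ℝ) : Prop :=
  ∃ β : Set (Space d) → ℝ → ℝ, ∀ᵐ ω ∂P, E.IsExclusiveFrontSpeedWith θ₀ ω e c β

/-- The set of directions with a deterministic front speed. -/
def RandomPDE.frontDirections [MeasurableSpace Ω] (E : RandomPDE d Ω) (P : Measure Ω)
    (θ₀ : ℝ) : Set (Space d) :=
  {e | ‖e‖ = 1 ∧ ∃ c, E.IsDeterministicFrontSpeed P θ₀ e c}

/-- The set of directions with a deterministic exclusive front speed. -/
def RandomPDE.exclusiveDirections [MeasurableSpace Ω] (E : RandomPDE d Ω) (P : Measure Ω)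
    (θ₀ : ℝ) : Set (Space d) :=
  {e | ‖e‖ = 1 ∧ ∃ c, E.IsDeterministicExclusiveFrontSpeed P θ₀ e c}

end FrontSpeeds

end

/-!
Write `u_ω` for solutions in the environment `ω`. The solution in the environment `T_y ω` is the
solution in `ω` whose datum has been moved by `y`, so all comparisons below take place in a single
environment.

*From a.e. environment to all translates of size `O(t)`.* Let `A n` be the event that a given
asymptotic property of a solution holds at all times after `n`. It is null measurable by the
measurable projection theorem (`nullMeasurableSet_image_fst`), and these events exhaust `Ω`. Wiener's
maximal inequality for the action of `ℝ^d` (`measure_iUnion_crowded_le`) shows that, for a.e. `ω` and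
large `n`, the event `A n` is visited in every ball of radius `δ t` with centre in the ball of radius
`Λ t` (`ae_exists_visits`). Since solutions from half-space data increase when the half-space is moved
forward, the front from an arbitrary translate is squeezed between two fronts from visited translates
that are `O(δ t)` away. So front speeds are automatically uniform over translations of size `O(t)`
(`HypothesisH.ae_upperBound`, `HypothesisH.ae_lowerBound`).

*From one direction to nearby directions.* Only the datum within distance `(cBar + 1) t` matters up
to time `t`. There, half-spaces with normals at distance `η` contain each other after a translation of
size `O(η t)` (`HypothesisH.upperBound_change_direction`). Hence front speeds are Lipschitz in the
direction, and bounds on a finite net of directions give bounds uniform in the closure of the set of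
front directions (`HypothesisH.ae_uniform_front`); this closure then consists of front directions.
The same argument applies to exclusive fronts. Their moduli come from finitely many directions for each
of countably many half-balls exhausting a half-space (`HypothesisH.exists_uniform_exclusive`), so they
can be taken independent of the direction and of the environment, and consistent under rotations.

*Bounds on the speeds.* Localization against the solution `0` gives the upper bound `cBar`
(`HypothesisH.frontSpeed_le`). Uniform spreading makes every front advance by a unit distance in some
fixed time, so speeds are positive (`HypothesisH.frontSpeed_pos`).

*Wulff shapes.* By dense visits, a spreading solution restarts near any point it has reached, so a Wulff
shape is convex (`HypothesisH.convex_wulffSet`). If a supporting hyperplane is also tangent to a ball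
in the shape, then its normal is a front direction, and the distance of the hyperplane from the
origin is the front speed (`HypothesisH.isDeterministicFrontSpeed_of_support`): a spreading solution
started behind the front is a lower bound, while after a long time a suitably placed spreading
solution looks like a half-space over distances of order `t` and is an upper bound. Such
hyperplanes exist near every boundary point (`exists_interior_ball_support`), and fronts dominate
spreading solutions, which gives the formula (`HypothesisH.isGLB_wulff`).
-/

noncomputable section

namespace FrontSpeeds

section

/-! ### Universal measurability of analytic sets and measurable projections -/

/-- The restriction of finitely many coordinates of `ℕ → ℕ` can be chosen one at a time so that the
image keeps measure larger than `a`. -/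
theorem exists_bounds_lt_measure_image {Z : Type*} [MeasurableSpace Z] (μ : Measure Z)
    (f : (ℕ → ℕ) → Z) {a : ENNReal} (ha : a < μ (range f)) :
    ∃ k : ℕ → ℕ, ∀ n, a < μ (f '' {σ | ∀ i < n, σ i ≤ k i}) := by
  have step : ∀ (n : ℕ) (S : Set (ℕ → ℕ)), a < μ (f '' S) →
      ∃ m : ℕ, a < μ (f '' (S ∩ {σ | σ n ≤ m})) := by
    intro n S hS
    have hU : f '' S = ⋃ m : ℕ, f '' (S ∩ {σ | σ n ≤ m}) := by
      rw [← image_iUnion, ← inter_iUnion]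
      congr 1
      ext σ
      simpa using fun _ => ⟨σ n, le_rfl⟩
    have hmono : Monotone fun m : ℕ => f '' (S ∩ {σ | σ n ≤ m}) := by
      intro m m' hm
      refine image_mono (inter_subset_inter_right _ fun σ (hσ : σ n ≤ m) => ?_)
      exact le_trans hσ hm
    rw [hU, hmono.measure_iUnion] at hS
    exact lt_iSup_iff.1 hS
  choose! m hm using step
  let S : ℕ → Set (ℕ → ℕ) := fun n =>
    Nat.rec univ (fun n S => S ∩ {σ | σ n ≤ m n S}) n
  have hS : ∀ n, a < μ (f '' S n) := by
    intro n
    induction n with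
    | zero => simpa [S] using ha
    | succ n ih => exact hm n (S n) ih
  refine ⟨fun n => m n (S n), fun n => ?_⟩
  have : {σ : ℕ → ℕ | ∀ i < n, σ i ≤ m i (S i)} = S n := by
    induction n with
    | zero => simp [S]
    | succ n ih =>
      have : S (n + 1) = S n ∩ {σ | σ n ≤ m n (S n)} := rfl
      ext σ
      rw [this, mem_inter_iff]
      have hσ : σ ∈ S n ↔ ∀ i < n, σ i ≤ m i (S i) := by rw [← ih]; rfl
      rw [hσ]
      simp only [mem_ofPred_eq, Nat.lt_succ_iff_lt_or_eq, or_imp, forall_and, forall_eq]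
  rw [this]
  exact hS n

/-- Inner regularity of finite measures on continuous images of the Baire space. -/
theorem exists_isCompact_subset_range_le_measure {Z : Type*} [TopologicalSpace Z] [PolishSpace Z]
    [MeasurableSpace Z] [BorelSpace Z] (μ : Measure Z) [IsFiniteMeasure μ]
    {f : (ℕ → ℕ) → Z} (hf : Continuous f) {a : ENNReal} (ha : a < μ (range f)) :
    ∃ K ⊆ range f, IsCompact K ∧ a ≤ μ K := by
  obtain ⟨k, hk⟩ := exists_bounds_lt_measure_image μ f ha
  let C : Set (ℕ → ℕ) := {σ | ∀ i, σ i ≤ k i}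
  have hC : IsCompact C := by
    have : C = pi univ fun i => Iic (k i) := by ext; simp [C, Pi.le_def]
    rw [this]
    exact isCompact_univ_pi fun i => (finite_Iic (k i)).isCompact
  refine ⟨f '' C, image_subset_range _ _, hC.image hf, ?_⟩
  let _ := TopologicalSpace.upgradeIsCompletelyMetrizable Z
  -- Every neighbourhood of the compact image contains the image of one of the sets cut out by
  -- finitely many of the bounds, all of which have measure larger than `a`.
  rw [(f '' C).measure_eq_iInf_isOpen μ]
  refine le_iInf fun O => le_iInf fun hO => le_iInf fun hOo => ?_
  let _ : MetricSpace (ℕ → ℕ) := PiNat.metricSpaceNatNat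
  obtain ⟨δ, hδ, hsub⟩ := hC.exists_thickening_subset_open (hOo.preimage hf)
    (image_subset_iff.1 hO)
  obtain ⟨n, hn⟩ := exists_pow_lt_of_lt_one hδ (by norm_num : (1 / 2 : ℝ) < 1)
  refine (hk n).le.trans (measure_mono (image_subset_iff.2 fun τ hτ => hsub ?_))
  rw [Metric.mem_thickening_iff]
  refine ⟨fun i => if i < n then τ i else 0, fun i => ?_, ?_⟩
  · by_cases hi : i < n
    · simpa [hi] using hτ i hi
    · simp [hi]
  · refine lt_of_le_of_lt (PiNat.mem_cylinder_iff_dist_le.1 ?_) hn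
    intro i hi
    simp [hi]

/-- Analytic sets are universally measurable. -/
theorem nullMeasurableSet_of_analyticSet {Z : Type*} [TopologicalSpace Z] [PolishSpace Z]
    [MeasurableSpace Z] [BorelSpace Z] (μ : Measure Z) [IsFiniteMeasure μ] {A : Set Z}
    (hA : AnalyticSet A) : NullMeasurableSet A μ := by
  rw [AnalyticSet] at hA
  rcases hA with rfl | ⟨f, hf, rfl⟩
  · exact nullMeasurableSet_empty
  rcases eq_or_ne (μ (range f)) 0 with h0 | h0
  · exact NullMeasurableSet.of_null h0
  obtain ⟨a, -, ha, hlim⟩ := exists_seq_strictMono_tendsto' (pos_iff_ne_zero.2 h0)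
  choose K hKsub hK hle using fun n =>
    exists_isCompact_subset_range_le_measure μ hf (ha n).2
  have hm : NullMeasurableSet (⋃ n, K n) μ :=
    (MeasurableSet.iUnion fun n => (hK n).isClosed.measurableSet).nullMeasurableSet
  refine hm.congr (ae_eq_of_subset_of_measure_ge (iUnion_subset hKsub) ?_ hm
    (measure_ne_top μ _))
  exact le_of_tendsto' hlim fun n => (hle n).trans (measure_mono (subset_iUnion K n))

/-- A measurable subset of `Ω × Y` only involves countably many measurable subsets of `Ω`. -/
theorem exists_measurable_factor {Ω Y : Type*} [MeasurableSpace Ω] [MeasurableSpace Y]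
    {S : Set (Ω × Y)} (hS : MeasurableSet S) :
    ∃ f : Ω → ℕ → Bool, Measurable f ∧ ∃ B : Set ((ℕ → Bool) × Y), MeasurableSet B ∧
      ∀ ω y, (ω, y) ∈ S ↔ (f ω, y) ∈ B := by
  classical
  rw [← generateFrom_prod] at hS
  induction S, hS using MeasurableSpace.generateFrom_induction with
  | hC S hS _ =>
    obtain ⟨s, hs, t, ht, rfl⟩ := hS
    refine ⟨fun ω _ => decide (ω ∈ s), ?_, {q | q.1 0 = true ∧ q.2 ∈ t}, ?_, by simp⟩
    · refine measurable_pi_lambda _ fun _ => ?_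
      refine measurable_to_bool ?_
      simpa [preimage] using hs
    · refine MeasurableSet.inter ?_ (measurable_snd ht)
      exact measurableSet_eq_fun ((measurable_pi_apply 0).comp measurable_fst) measurable_const
  | empty => exact ⟨fun _ _ => true, measurable_const, ∅, MeasurableSet.empty, by simp⟩
  | compl S _ ih =>
    obtain ⟨f, hf, B, hB, h⟩ := ih
    exact ⟨f, hf, Bᶜ, hB.compl, fun ω y => by simp [h]⟩
  | iUnion S _ ih =>
    choose f hf B hB h using ih
    -- Countably many sequences are encoded in one by the pairing function.
    refine ⟨fun ω n => f n.unpair.1 ω n.unpair.2, ?_,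
      ⋃ n, {q | ((fun j => q.1 (Nat.pair n j)), q.2) ∈ B n}, ?_, fun ω y => by simp [h]⟩
    · exact measurable_pi_lambda _ fun n => (measurable_pi_apply _).comp (hf _)
    · refine MeasurableSet.iUnion fun n => ?_
      refine (Measurable.prodMk ?_ measurable_snd) (hB n)
      exact measurable_pi_lambda _ fun j => (measurable_pi_apply _).comp measurable_fst

/-- Measurable projection theorem. A standard Borel structure on `Ω` is not needed, because the set
is pulled back from a product of standard Borel spaces. -/
theorem nullMeasurableSet_image_fst {Ω Y : Type*} [MeasurableSpace Ω] [MeasurableSpace Y]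
    [StandardBorelSpace Y] (P : Measure Ω) [IsFiniteMeasure P] {S : Set (Ω × Y)}
    (hS : MeasurableSet S) : NullMeasurableSet (Prod.fst '' S) P := by
  obtain ⟨f, hf, B, hB, h⟩ := exists_measurable_factor hS
  let _ := upgradeStandardBorel Y
  have : PolishSpace Bool := inferInstance
  have hpre : Prod.fst '' S = f ⁻¹' (Prod.fst '' B) := by
    ext ω
    simp [h]
  have hA : AnalyticSet (Prod.fst '' B) := hB.analyticSet.image_of_continuous continuous_fst
  rw [hpre]
  exact (nullMeasurableSet_of_analyticSet (P.map f) hA).preimage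
    ⟨hf, Measure.AbsolutelyContinuous.rfl⟩

end

section

/-! ### A maximal inequality for measure preserving actions of `ℝ^d` -/

/-- A jointly measurable action of the group `ℝ^d` by transformations preserving `P`. -/
structure IsPreservingAction {d : ℕ} {Ω : Type*} [MeasurableSpace Ω] (P : Measure Ω)
    (T : Space d → Ω → Ω) : Prop where
  zero : ∀ ω, T 0 ω = ω
  add : ∀ y z ω, T (y + z) ω = T y (T z ω)
  measurable : Measurable fun q : Space d × Ω => T q.1 q.2
  preserving : ∀ y, MeasurePreserving (T y) P P

section Action

variable {d : ℕ} {Ω : Type*} [MeasurableSpace Ω] {P : Measure Ω}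
  {T : Space d → Ω → Ω}

theorem IsPreservingAction.measurable_left (hT : IsPreservingAction P T) (ω : Ω) :
    Measurable fun z => T z ω :=
  hT.measurable.comp (measurable_id.prodMk measurable_const)

theorem IsPreservingAction.measurableSet_pairs (hT : IsPreservingAction P T) {A : Set Ω}
    (hA : MeasurableSet A) {B : Set (Space d)} (hB : MeasurableSet B) :
    MeasurableSet {q : Ω × Space d | q.2 ∈ B ∧ T q.2 q.1 ∈ A} :=
  (measurable_snd hB).inter ((hT.measurable.comp measurable_swap) hA)

/-- The mean occupation time of `A` over `B`; a consequence of Fubini's theorem. -/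
theorem IsPreservingAction.lintegral_occupation [IsProbabilityMeasure P]
    (hT : IsPreservingAction P T) {A : Set Ω}
    (hA : MeasurableSet A) {B : Set (Space d)} (hB : MeasurableSet B) :
    ∫⁻ ω, volume {z | z ∈ B ∧ T z ω ∈ A} ∂P = volume B * P A := by
  have hS := hT.measurableSet_pairs hA hB
  have h1 := Measure.prod_apply (μ := P) (ν := (volume : Measure (Space d))) hS
  have h2 := Measure.prod_apply_symm (μ := P) (ν := (volume : Measure (Space d))) hS
  have h3 : ∀ z : Space d, P ((fun ω => (ω, z)) ⁻¹' {q : Ω × Space d | q.2 ∈ B ∧ T q.2 q.1 ∈ A})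
      = B.indicator (fun _ => P A) z := by
    intro z
    by_cases hz : z ∈ B
    · simp only [preimage_ofPred_eq, hz, true_and, indicator_of_mem]
      exact (hT.preserving z).measure_preimage hA.nullMeasurableSet
    · simp [hz]
  rw [h1] at h2
  simp only [h3] at h2
  rw [lintegral_indicator hB, setLIntegral_const, mul_comm] at h2
  exact h2

/-- The environments for which the set `D` occupies at least the fraction `κ` of the orbit segment
over the ball of radius `n`. -/
def crowded (T : Space d → Ω → Ω) (D : Set Ω) (κ : ENNReal) (n : ℕ) : Set Ω :=
  {ω | κ * volume (Metric.closedBall (0 : Space d) n) ≤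
    volume {z | z ∈ Metric.closedBall (0 : Space d) n ∧ T z ω ∈ D}}

theorem measurableSet_crowded (hT : IsPreservingAction P T) {D : Set Ω} (hD : MeasurableSet D)
    (κ : ENNReal) (n : ℕ) : MeasurableSet (crowded T D κ n) := by
  have := measurable_measure_prodMk_left (ν := (volume : Measure (Space d)))
    (hT.measurableSet_pairs hD (Metric.isClosed_closedBall (x := (0 : Space d))
      (ε := (n : ℝ))).measurableSet)
  exact measurableSet_le measurable_const this

theorem volume_closedBall_eq (x : Space d) {r : ℝ} (hr : 0 ≤ r) :
    volume (Metric.closedBall x r)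
      = ENNReal.ofReal (r ^ d) * volume (Metric.closedBall (0 : Space d) 1) := by
  simpa using Measure.addHaar_closedBall' (volume : Measure (Space d)) x hr

theorem volume_closedBall_mul_eq (x y : Space d) {r c : ℝ} (hr : 0 ≤ r) (hc : 0 ≤ c) :
    volume (Metric.closedBall x (c * r))
      = ENNReal.ofReal (c ^ d) * volume (Metric.closedBall y r) := by
  rw [volume_closedBall_eq x (mul_nonneg hc hr), volume_closedBall_eq y hr, mul_pow,
    ENNReal.ofReal_mul (by positivity), mul_assoc]

/-- The pointwise covering estimate behind the maximal inequality: along one orbit, Vitali's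
covering lemma bounds the times of crowding by the occupation time of `D`. -/
theorem volume_crowded_le (hT : IsPreservingAction P T) {D : Set Ω} (hD : MeasurableSet D)
    (κ : ENNReal) (N : ℕ) (ω : Ω) :
    κ * volume {z | z ∈ Metric.closedBall (0 : Space d) N ∧
        T z ω ∈ ⋃ n ∈ Icc 1 N, crowded T D κ n}
      ≤ ENNReal.ofReal (5 ^ d) *
        volume {z | z ∈ Metric.closedBall (0 : Space d) ((2 : ℝ) * N) ∧ T z ω ∈ D} := by
  set G := {z | z ∈ Metric.closedBall (0 : Space d) N ∧
        T z ω ∈ ⋃ n ∈ Icc 1 N, crowded T D κ n} with hG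
  have hex : ∀ z ∈ G, ∃ n : ℕ, 1 ≤ n ∧ n ≤ N ∧ T z ω ∈ crowded T D κ n := by
    rintro z ⟨-, hz⟩
    simp only [mem_iUnion, mem_Icc, exists_prop] at hz
    obtain ⟨n, ⟨h1, h2⟩, h3⟩ := hz
    exact ⟨n, h1, h2, h3⟩
  choose! n hn1 hnN hncr using hex
  obtain ⟨u, huG, hdisj, hcov⟩ := Vitali.exists_disjoint_subfamily_covering_enlargement_closedBall
    G (fun z => z) (fun z => (n z : ℝ)) N (fun z hz => by exact_mod_cast hnN z hz) 5 (by norm_num)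
  have hpos : ∀ z ∈ u, (0 : ℝ) < n z := fun z hz => by exact_mod_cast hn1 z (huG hz)
  have hu : u.Countable := hdisj.countable_of_nonempty_interior fun z hz =>
    ⟨z, Metric.ball_subset_interior_closedBall (Metric.mem_ball_self (hpos z hz))⟩
  have hDm : MeasurableSet {z | T z ω ∈ D} := hT.measurable_left ω hD
  have hkey : ∀ z ∈ u, κ * volume (Metric.closedBall z (5 * (n z : ℝ))) ≤
      ENNReal.ofReal (5 ^ d) * volume (Metric.closedBall z (n z : ℝ) ∩ {w | T w ω ∈ D}) := by
    intro z hz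
    have hc := hncr z (huG hz)
    simp only [crowded, mem_ofPred_eq] at hc
    rw [volume_closedBall_mul_eq z (0 : Space d) (by positivity) (by norm_num), mul_left_comm]
    refine mul_le_mul_right (hc.trans_eq ?_) _
    rw [← measure_preimage_add_right volume (-z)]
    congr 1
    ext w
    simp only [mem_preimage, mem_ofPred_eq, mem_inter_iff, Metric.mem_closedBall, ← hT.add,
      dist_eq_norm]
    simp [sub_eq_add_neg]
  calc κ * volume G
      ≤ κ * volume (⋃ z ∈ u, Metric.closedBall z (5 * (n z : ℝ))) := by
        gcongr
        intro z hz
        obtain ⟨b, hb, hsub⟩ := hcov z hz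
        exact mem_biUnion hb (hsub (Metric.mem_closedBall_self (by positivity)))
    _ ≤ κ * ∑' z : u, volume (Metric.closedBall (z : Space d) (5 * (n z : ℝ))) := by
        gcongr
        exact measure_biUnion_le _ hu _
    _ = ∑' z : u, κ * volume (Metric.closedBall (z : Space d) (5 * (n z : ℝ))) :=
        ENNReal.tsum_mul_left.symm
    _ ≤ ∑' z : u, ENNReal.ofReal (5 ^ d) *
          volume (Metric.closedBall (z : Space d) (n z : ℝ) ∩ {w | T w ω ∈ D}) :=
        ENNReal.tsum_le_tsum fun z => hkey z z.2
    _ = ENNReal.ofReal (5 ^ d) *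
          volume (⋃ z ∈ u, Metric.closedBall (z : Space d) (n z : ℝ) ∩ {w | T w ω ∈ D}) := by
        rw [ENNReal.tsum_mul_left, measure_biUnion hu]
        · exact hdisj.mono fun z => inter_subset_left
        · exact fun z _ => Metric.isClosed_closedBall.measurableSet.inter hDm
    _ ≤ _ := by
        gcongr
        refine iUnion₂_subset fun z hz w hw => ⟨?_, hw.2⟩
        have h1 := (huG hz).1
        have h2 : (n z : ℝ) ≤ N := by exact_mod_cast hnN z (huG hz)
        have h3 := hw.1
        rw [Metric.mem_closedBall] at *
        linarith [dist_triangle w z 0]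

/-- Wiener's maximal inequality, for the indicator function of `D`. The covering estimate is
transferred from the orbits to `Ω` by integration over the environments. -/
theorem measure_iUnion_crowded_le [IsProbabilityMeasure P] (hT : IsPreservingAction P T)
    {D : Set Ω} (hD : MeasurableSet D) (κ : ENNReal) :
    κ * P (⋃ n ∈ Ici 1, crowded T D κ n) ≤ ENNReal.ofReal (10 ^ d) * P D := by
  have hmono : Monotone fun N : ℕ => ⋃ n ∈ Icc 1 N, crowded T D κ n := fun a b hab =>
    biUnion_subset_biUnion_left (Icc_subset_Icc_right hab)
  have hU : (⋃ n ∈ Ici 1, crowded T D κ n) = ⋃ N : ℕ, ⋃ n ∈ Icc 1 N, crowded T D κ n := by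
    ext ω
    simp only [mem_iUnion, mem_Ici, mem_Icc, exists_prop]
    exact ⟨fun ⟨n, h, hω⟩ => ⟨n, n, ⟨h, le_rfl⟩, hω⟩, fun ⟨_, n, h, hω⟩ => ⟨n, h.1, hω⟩⟩
  rw [hU, hmono.measure_iUnion, ENNReal.mul_iSup]
  refine iSup_le fun N => ?_
  rcases Nat.eq_zero_or_pos N with rfl | hN
  · simp
  have hMm : MeasurableSet (⋃ n ∈ Icc 1 N, crowded T D κ n) :=
    MeasurableSet.biUnion (to_countable _) fun n _ => measurableSet_crowded hT hD κ n
  set v := volume (Metric.closedBall (0 : Space d) N) with hv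
  have hv0 : v ≠ 0 := (Metric.measure_closedBall_pos _ _ (by exact_mod_cast hN)).ne'
  have hvt : v ≠ ⊤ := measure_closedBall_lt_top.ne
  have h1 := lintegral_mono (μ := P) fun ω => volume_crowded_le hT hD κ N ω
  have hm1 : Measurable fun ω => volume {z | z ∈ Metric.closedBall (0 : Space d) N ∧
      T z ω ∈ ⋃ n ∈ Icc 1 N, crowded T D κ n} :=
    measurable_measure_prodMk_left (ν := (volume : Measure (Space d)))
    (hT.measurableSet_pairs hMm (Metric.isClosed_closedBall (x := (0 : Space d))
      (ε := (N : ℝ))).measurableSet)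
  have hm2 : Measurable fun ω => volume {z | z ∈ Metric.closedBall (0 : Space d) ((2 : ℝ) * N) ∧
      T z ω ∈ D} :=
    measurable_measure_prodMk_left (ν := (volume : Measure (Space d)))
    (hT.measurableSet_pairs hD (Metric.isClosed_closedBall (x := (0 : Space d))
      (ε := ((2 : ℝ) * N))).measurableSet)
  rw [lintegral_const_mul κ hm1, lintegral_const_mul _ hm2,
    hT.lintegral_occupation hMm Metric.isClosed_closedBall.measurableSet,
    hT.lintegral_occupation hD Metric.isClosed_closedBall.measurableSet,
    volume_closedBall_mul_eq 0 (0 : Space d) (by positivity) (by norm_num), ← hv] at h1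
  refine (ENNReal.mul_le_mul_iff_right hv0 hvt).1 ?_
  calc v * (κ * P (⋃ n ∈ Icc 1 N, crowded T D κ n))
      = κ * (v * P (⋃ n ∈ Icc 1 N, crowded T D κ n)) := by ring
    _ ≤ _ := h1
    _ = v * (ENNReal.ofReal (5 ^ d) * ENNReal.ofReal (2 ^ d) * P D) := by ring
    _ = _ := by
      rw [← ENNReal.ofReal_mul (by positivity), ← mul_pow]
      norm_num

/-- For a.e. environment, some member of an increasing sequence of events exhausting the
probability space is visited, uniformly over all large balls, up to a small fraction. -/
theorem ae_exists_forall_not_crowded [IsProbabilityMeasure P] (hT : IsPreservingAction P T)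
    {A : ℕ → Set Ω} (hA : ∀ n, MeasurableSet (A n)) (hlim : Tendsto (fun n => P (A n)ᶜ) atTop (𝓝 0))
    {κ : ENNReal} (hκ : κ ≠ 0) :
    ∀ᵐ ω ∂P, ∃ n, ∀ N : ℕ, 1 ≤ N → ω ∉ crowded T (A n)ᶜ κ N := by
  have h0 : P (⋂ n, ⋃ N ∈ Ici 1, crowded T (A n)ᶜ κ N) = 0 := by
    have hle : ∀ n, κ * P (⋂ n, ⋃ N ∈ Ici 1, crowded T (A n)ᶜ κ N)
        ≤ ENNReal.ofReal (10 ^ d) * P (A n)ᶜ := fun n =>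
      (by gcongr; exact iInter_subset _ n : _ ≤ κ * P (⋃ N ∈ Ici 1, crowded T (A n)ᶜ κ N)).trans
        (measure_iUnion_crowded_le hT (hA n).compl κ)
    have hl : Tendsto (fun n => ENNReal.ofReal (10 ^ d) * P (A n)ᶜ) atTop (𝓝 0) := by
      rw [← mul_zero (ENNReal.ofReal (10 ^ d))]
      exact ENNReal.Tendsto.const_mul hlim (Or.inr ENNReal.ofReal_ne_top)
    have := ge_of_tendsto' hl hle
    simpa [hκ] using this
  rw [measure_eq_zero_iff_ae_notMem] at h0
  filter_upwards [h0] with ω hω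
  simpa using hω

/-- Visits to large events are relatively dense at every scale: for a.e. environment and all
`Λ, δ > 0`, some event `A n` meets, for all large `t`, every translate of the environment by a ball
of radius `δ t` centred in the ball of radius `Λ t`. -/
theorem ae_exists_visits [IsProbabilityMeasure P] (hT : IsPreservingAction P T)
    {A : ℕ → Set Ω} (hA : ∀ n, NullMeasurableSet (A n) P) (hmono : Monotone A)
    (hfull : ∀ᵐ ω ∂P, ∃ n, ω ∈ A n) :
    ∀ᵐ ω ∂P, ∀ Λ δ : ℝ, 0 < δ → ∃ n, ∀ᶠ t : ℝ in atTop, ∀ y : Space d, ‖y‖ ≤ Λ * t →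
      ∃ y' : Space d, ‖y' - y‖ ≤ δ * t ∧ T y' ω ∈ A n := by
  -- The maximal inequality is applied to measurable subsets of full measure.
  choose A' hA'sub hA' hA'eq using fun n => (hA n).exists_measurable_subset_ae_eq
  have hlim : Tendsto (fun n => P (A' n)ᶜ) atTop (𝓝 0) := by
    have h1 : Tendsto (fun n => P (A n)) atTop (𝓝 1) := by
      have := tendsto_measure_iUnion_atTop (μ := P) hmono
      have h2 : P (⋃ n, A n) = 1 := by
        rw [← measure_univ (μ := P)]
        refine measure_congr (eventuallyEq_univ.2 ?_)
        filter_upwards [hfull] with ω hω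
        exact mem_iUnion.2 hω
      rwa [h2] at this
    have h3 : ∀ n, P (A' n)ᶜ = 1 - P (A n) := fun n => by
      rw [prob_compl_eq_one_sub (hA' n), measure_congr (hA'eq n)]
    simp only [h3]
    simpa using ENNReal.Tendsto.sub (tendsto_const_nhds (x := (1 : ENNReal))) h1
      (Or.inl ENNReal.one_ne_top)
  -- With `η = 1 / (k + 1)`, the fraction is that of a ball of radius `η t` in one of radius
  -- `(k + 2 η) t`: an unvisited ball of this size would make its complement crowded.
  have hκ : ∀ k : ℕ, 0 < (1 / ((k : ℝ) + 1) / (k + 2 * (1 / ((k : ℝ) + 1)))) ^ d := fun k => by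
    positivity
  have hall : ∀ᵐ ω ∂P, ∀ k : ℕ, ∃ n, ∀ N : ℕ, 1 ≤ N →
      ω ∉ crowded T (A' n)ᶜ (ENNReal.ofReal
        ((1 / ((k : ℝ) + 1) / (k + 2 * (1 / ((k : ℝ) + 1)))) ^ d)) N :=
    ae_all_iff.2 fun k => ae_exists_forall_not_crowded hT hA' hlim
      (by simpa using hκ k)
  filter_upwards [hall] with ω hω Λ δ hδ
  obtain ⟨k₁, hk₁⟩ := exists_nat_ge Λ
  obtain ⟨k₂, hk₂⟩ := exists_nat_one_div_lt hδ
  set k := max k₁ k₂ with hk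
  have hkΛ : Λ ≤ k := hk₁.trans (by exact_mod_cast le_max_left _ _)
  set η : ℝ := 1 / ((k : ℝ) + 1) with hη
  have hη0 : 0 < η := by positivity
  have hηδ : η ≤ δ := by
    refine le_trans ?_ hk₂.le
    have : (k₂ : ℝ) ≤ k := by exact_mod_cast le_max_right _ _
    rw [hη]
    gcongr
  obtain ⟨n, hn⟩ := hω k
  refine ⟨n, ?_⟩
  filter_upwards [eventually_ge_atTop (1 / η), eventually_gt_atTop 0] with t ht ht0 y hy
  by_contra! hcon
  have hηt : 1 ≤ η * t := by rwa [div_le_iff₀' hη0] at ht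
  set N := ⌈((k : ℝ) + η) * t⌉₊ with hN
  have hNge : ((k : ℝ) + η) * t ≤ N := Nat.le_ceil _
  have hNle : (N : ℝ) ≤ (k + 2 * η) * t := by
    have := (Nat.ceil_lt_add_one (a := ((k : ℝ) + η) * t) (by positivity)).le
    rw [← hN] at this
    linarith
  have hN1 : 1 ≤ N := by
    have : (1 : ℝ) ≤ N := by nlinarith [(Nat.cast_nonneg k : (0 : ℝ) ≤ k)]
    exact_mod_cast this
  apply hn N hN1
  have hsub : Metric.closedBall y (η * t) ⊆
      {z | z ∈ Metric.closedBall (0 : Space d) N ∧ T z ω ∈ (A' n)ᶜ} := by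
    intro z hz
    rw [mem_closedBall_iff_norm] at hz
    constructor
    · rw [mem_closedBall_zero_iff]
      have h1 : ‖z‖ ≤ ‖z - y‖ + ‖y‖ := by simpa using norm_add_le (z - y) y
      have h2 : Λ * t ≤ k * t := by gcongr
      linarith
    · exact fun h => hcon z (hz.trans (by gcongr)) (hA'sub n h)
  refine le_trans ?_ (measure_mono hsub)
  rw [volume_closedBall_eq y (by positivity), volume_closedBall_eq (0 : Space d) (by positivity),
    ← mul_assoc, ← ENNReal.ofReal_mul (hκ k).le, ← mul_pow]
  have hle : 1 / ((k : ℝ) + 1) / (k + 2 * (1 / ((k : ℝ) + 1))) * N ≤ η * t := by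
    rw [← hη, div_mul_eq_mul_div, div_le_iff₀ (by positivity), mul_assoc]
    gcongr
    linarith
  gcongr

end Action

end

section

variable {d : ℕ}

/-! ### Indicators of convex sets have locally bounded variation -/

/-- The part of a ball lying in a convex set that leaves the set under the translation by `-v / n`
has volume `O(1 / n)`: its translates by the multiples of `-v / n` are pairwise disjoint. -/
theorem mul_volume_exit_le {S : Set (Space d)} (hS : Convex ℝ S) (hSm : MeasurableSet S)
    {v : Space d} (hv : ‖v‖ ≤ 1) (R : ℝ) {n : ℕ} (hn : 0 < n) :
    (n : ENNReal) * volume {x | x ∈ Metric.ball (0 : Space d) R ∧ x ∈ S ∧ x - (1 / n : ℝ) • v ∉ S}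
      ≤ volume (Metric.ball (0 : Space d) (R + 1)) := by
  set h : ℝ := 1 / n with hh
  have hn0 : (0 : ℝ) < n := by exact_mod_cast hn
  have hh0 : 0 < h := by positivity
  set D := {x | x ∈ Metric.ball (0 : Space d) R ∧ x ∈ S ∧ x - h • v ∉ S} with hD
  have hDm : MeasurableSet D :=
    Metric.isOpen_ball.measurableSet.inter (hSm.inter
      ((measurable_id.sub_const (h • v)) hSm).compl)
  have hline : ∀ x ∈ D, ∀ s : ℝ, h ≤ s → x - s • v ∉ S := by
    intro x hx s hs hxs
    have hs0 : 0 < s := hh0.trans_le hs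
    apply hx.2.2
    have hsub : x - h • v = (1 - h / s) • x + (h / s) • (x - s • v) := by
      rw [smul_sub, smul_smul, div_mul_cancel₀ _ hs0.ne', sub_smul, one_smul]
      abel
    rw [hsub]
    exact hS hx.2.1 hxs (by rw [sub_nonneg, div_le_one hs0]; exact hs) (by positivity) (by ring)
  let A : Fin n → Set (Space d) := fun k => (fun x => x + ((k : ℝ) * h) • v) ⁻¹' D
  have hAdisj : ∀ j k : Fin n, j < k → Disjoint (A j) (A k) := by
    intro j k hjk
    rw [disjoint_left]
    intro z hzj hzk
    refine hline _ hzk (((k : ℝ) - j) * h) ?_ ?_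
    · have : (1 : ℝ) ≤ (k : ℝ) - j := by
        have : (j : ℝ) + 1 ≤ k := by exact_mod_cast hjk
        linarith
      nlinarith
    · have : z + ((k : ℝ) * h) • v - (((k : ℝ) - j) * h) • v = z + ((j : ℝ) * h) • v := by
        module
      rw [this]
      exact hzj.2.1
  have hsum : volume (⋃ k, A k) = (n : ENNReal) * volume D := by
    rw [measure_iUnion]
    · simp [A, measure_preimage_add_right]
    · intro j k hjk
      rcases lt_or_gt_of_ne hjk with h | h
      · exact hAdisj j k h
      · exact (hAdisj k j h).symm
    · exact fun k => (measurable_id.add_const _) hDm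
  rw [← hsum]
  refine measure_mono (iUnion_subset fun k z hz => ?_)
  have h1 : ‖z + ((k : ℝ) * h) • v‖ < R := by simpa using hz.1
  have h2 : ‖((k : ℝ) * h) • v‖ ≤ 1 := by
    rw [norm_smul, Real.norm_of_nonneg (by positivity)]
    have : (k : ℝ) * h ≤ 1 := by
      rw [hh, mul_one_div, div_le_one hn0]
      exact_mod_cast k.2.le
    exact mul_le_one₀ this (norm_nonneg _) hv
  have h3 : ‖z‖ ≤ ‖z + ((k : ℝ) * h) • v‖ + ‖((k : ℝ) * h) • v‖ := by
    simpa using norm_sub_le (z + ((k : ℝ) * h) • v) (((k : ℝ) * h) • v)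
  simp only [Metric.mem_ball, dist_zero_right]
  linarith

theorem mul_volume_change_le {S : Set (Space d)} (hS : Convex ℝ S) (hSm : MeasurableSet S)
    {v : Space d} (hv : ‖v‖ ≤ 1) (R : ℝ) {n : ℕ} (hn : 0 < n) :
    (n : ℝ) * volume.real {x | x ∈ Metric.ball (0 : Space d) R ∧
        ¬ (x - (1 / n : ℝ) • v ∈ S ↔ x ∈ S)}
      ≤ 2 * volume.real (Metric.ball (0 : Space d) (R + 2)) := by
  have hn0 : (0 : ℝ) < n := by exact_mod_cast hn
  set w : Space d := (1 / n : ℝ) • v with hw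
  have hw1 : ‖w‖ ≤ 1 := by
    rw [hw, norm_smul, Real.norm_of_nonneg (by positivity)]
    refine mul_le_one₀ ?_ (norm_nonneg _) hv
    rw [div_le_one hn0]
    exact_mod_cast hn
  have h1 := mul_volume_exit_le hS hSm hv (R + 1) hn
  have h2 := mul_volume_exit_le hS hSm (v := -v) (by simpa using hv) (R + 1) hn
  rw [smul_neg, ← hw] at h2
  rw [← hw] at h1
  have hsub : {x | x ∈ Metric.ball (0 : Space d) R ∧ ¬ (x - w ∈ S ↔ x ∈ S)} ⊆
      {x | x ∈ Metric.ball (0 : Space d) (R + 1) ∧ x ∈ S ∧ x - w ∉ S} ∪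
      (fun x => x + -w) ⁻¹'
        {x | x ∈ Metric.ball (0 : Space d) (R + 1) ∧ x ∈ S ∧ x - -w ∉ S} := by
    rintro x ⟨hxR, hx⟩
    simp only [Metric.mem_ball, dist_zero_right] at hxR
    by_cases hxS : x ∈ S
    · left
      refine ⟨by simp only [Metric.mem_ball, dist_zero_right]; linarith, hxS, fun h => hx (by tauto)⟩
    · right
      have hx' : x - w ∈ S := by tauto
      refine ⟨?_, by simpa [← sub_eq_add_neg] using hx', by simpa using hxS⟩
      simp only [Metric.mem_ball, dist_zero_right]
      have := norm_add_le x (-w)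
      rw [norm_neg] at this
      linarith
  have h3 : (n : ENNReal) * volume {x | x ∈ Metric.ball (0 : Space d) R ∧ ¬ (x - w ∈ S ↔ x ∈ S)}
      ≤ 2 * volume (Metric.ball (0 : Space d) (R + 2)) := by
    calc _ ≤ (n : ENNReal) * (volume
            {x | x ∈ Metric.ball (0 : Space d) (R + 1) ∧ x ∈ S ∧ x - w ∉ S} +
          volume {x | x ∈ Metric.ball (0 : Space d) (R + 1) ∧ x ∈ S ∧ x - -w ∉ S}) := by
          gcongr
          refine (measure_mono hsub).trans ((measure_union_le _ _).trans_eq ?_)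
          rw [measure_preimage_add_right]
      _ ≤ _ := by
          rw [mul_add, two_mul]
          have : R + 1 + 1 = R + 2 := by ring
          rw [this] at h1 h2
          exact add_le_add h1 h2
  have h4 := ENNReal.toReal_mono
    (ENNReal.mul_ne_top ENNReal.ofNat_ne_top measure_ball_lt_top.ne) h3
  simpa [ENNReal.toReal_mul, Measure.real] using h4

/-- One directional derivative of a bounded test function, integrated over a convex set. -/
theorem abs_setIntegral_fderiv_le {S : Set (Space d)} (hS : Convex ℝ S) (hSm : MeasurableSet S)
    {v : Space d} (hv : ‖v‖ ≤ 1) {R : ℝ} {ψ : Space d → ℝ} (hψ : ContDiff ℝ 1 ψ)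
    (hsupp : tsupport ψ ⊆ Metric.ball 0 R) (hb : ∀ x, ‖ψ x‖ ≤ 1) :
    |∫ x in S, fderiv ℝ ψ x v| ≤ 2 * volume.real (Metric.ball (0 : Space d) (R + 2)) := by
  have hcs : HasCompactSupport ψ :=
    (isCompact_closedBall (0 : Space d) R).of_isClosed_subset (isClosed_tsupport ψ)
      (hsupp.trans Metric.ball_subset_closedBall)
  obtain ⟨C, hC⟩ := hψ.lipschitzWith_of_hasCompactSupport hcs one_ne_zero
  have hψi : Integrable ψ := hψ.continuous.integrable_of_hasCompactSupport hcs
  have hout : ∀ x, R ≤ ‖x‖ → ψ x = 0 := by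
    intro x hx
    refine image_eq_zero_of_notMem_tsupport fun h => ?_
    have := hsupp h
    simp only [Metric.mem_ball, dist_zero_right] at this
    linarith
  let F : ℕ → Space d → ℝ := fun n x => (n : ℝ) • (ψ (x + (n : ℝ)⁻¹ • v) - ψ x)
  have hlim : Tendsto (fun n => ∫ x in S, F n x) atTop (𝓝 (∫ x in S, fderiv ℝ ψ x v)) := by
    refine tendsto_integral_filter_of_dominated_convergence
      ((Metric.ball (0 : Space d) (R + 1)).indicator fun _ => (C : ℝ)) ?_ ?_ ?_ ?_
    · refine Eventually.of_forall fun n => Continuous.aestronglyMeasurable ?_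
      have := hψ.continuous
      fun_prop
    · filter_upwards [eventually_gt_atTop 0] with n hn
      refine Eventually.of_forall fun x => ?_
      have hn0 : (0 : ℝ) < n := by exact_mod_cast hn
      have hvn : ‖(n : ℝ)⁻¹ • v‖ ≤ (n : ℝ)⁻¹ := by
        rw [norm_smul, Real.norm_of_nonneg (by positivity)]
        exact mul_le_of_le_one_right (by positivity) hv
      have hvn1 : ‖(n : ℝ)⁻¹ • v‖ ≤ 1 := by
        refine hvn.trans (inv_le_one_of_one_le₀ ?_)
        exact_mod_cast hn
      by_cases hx : x ∈ Metric.ball (0 : Space d) (R + 1)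
      · rw [indicator_of_mem hx]
        have h1 := hC.norm_sub_le (x + (n : ℝ)⁻¹ • v) x
        rw [add_sub_cancel_left] at h1
        simp only [F, norm_smul, Real.norm_of_nonneg hn0.le]
        calc (n : ℝ) * ‖ψ (x + (n : ℝ)⁻¹ • v) - ψ x‖ ≤ n * (C * (n : ℝ)⁻¹) := by
              gcongr
              exact h1.trans (by gcongr)
          _ = C := by field_simp
      · rw [indicator_of_notMem hx]
        simp only [Metric.mem_ball, dist_zero_right, not_lt] at hx
        have h1 : ‖x‖ ≤ ‖x + (n : ℝ)⁻¹ • v‖ + ‖(n : ℝ)⁻¹ • v‖ := by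
          simpa using norm_sub_le (x + (n : ℝ)⁻¹ • v) ((n : ℝ)⁻¹ • v)
        simp [F, hout x (by linarith), hout (x + (n : ℝ)⁻¹ • v) (by linarith)]
    · refine IntegrableOn.integrable_indicator ?_ Metric.isOpen_ball.measurableSet |>.restrict
      exact integrableOn_const measure_ball_lt_top.ne
    · refine Eventually.of_forall fun x => ?_
      refine ((hψ.differentiable one_ne_zero x).hasFDerivAt).lim v ?_
      simpa using tendsto_natCast_atTop_atTop
  refine le_of_tendsto hlim.abs ?_
  filter_upwards [eventually_gt_atTop 0] with n hn
  have hn0 : (0 : ℝ) < n := by exact_mod_cast hn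
  set D := {x | x ∈ Metric.ball (0 : Space d) R ∧ ¬ (x - (1 / n : ℝ) • v ∈ S ↔ x ∈ S)} with hD
  have hDfin : volume D < ⊤ :=
    (measure_mono fun x hx => hx.1).trans_lt (measure_ball_lt_top (x := (0 : Space d)) (r := R))
  have hψi' : Integrable fun x => ψ (x + (n : ℝ)⁻¹ • v) := hψi.comp_add_right _
  have hF : ∫ x in S, F n x =
      n * ∫ x, (S.indicator 1 (x - (1 / n : ℝ) • v) - S.indicator 1 x) * ψ x := by
    have e1 : ∫ x in S, ψ (x + (n : ℝ)⁻¹ • v) =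
        ∫ x, S.indicator 1 (x - (1 / n : ℝ) • v) * ψ x := by
      rw [← integral_indicator hSm,
        ← integral_add_right_eq_self (fun x => S.indicator 1 (x - (1 / n : ℝ) • v) * ψ x)
          ((1 / n : ℝ) • v)]
      refine integral_congr_ae (Eventually.of_forall fun x => ?_)
      by_cases hx : x ∈ S <;> simp [hx]
    have e2 : ∫ x in S, ψ x = ∫ x, S.indicator 1 x * ψ x := by
      rw [← integral_indicator hSm]
      refine integral_congr_ae (Eventually.of_forall fun x => ?_)
      by_cases hx : x ∈ S <;> simp [hx]
    have i1 : Integrable fun x => S.indicator (1 : Space d → ℝ) x * ψ x := by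
      have := hψi.indicator hSm
      refine this.congr (Eventually.of_forall fun x => ?_)
      by_cases hx : x ∈ S <;> simp [hx]
    have i2 : Integrable fun x => S.indicator (1 : Space d → ℝ) (x - (1 / n : ℝ) • v) * ψ x := by
      have := hψi.indicator ((measurable_id.sub_const ((1 / n : ℝ) • v)) hSm)
      refine this.congr (Eventually.of_forall fun x => ?_)
      by_cases hx : x - (1 / n : ℝ) • v ∈ S <;>
        simp only [indicator, mem_preimage, id, hx] <;> simp
    simp only [F, smul_eq_mul, sub_mul]
    rw [integral_const_mul, integral_sub hψi'.integrableOn hψi.integrableOn, e1, e2,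
      integral_sub i2 i1]
  have hzero : ∀ x ∉ D, (S.indicator 1 (x - (1 / n : ℝ) • v) - S.indicator 1 x) * ψ x = 0 := by
    intro x hx
    by_cases hxR : ‖x‖ < R
    · have : x - (1 / n : ℝ) • v ∈ S ↔ x ∈ S := by
        by_contra h
        exact hx ⟨by simpa using hxR, h⟩
      by_cases hxS : x ∈ S
      · simp only [indicator, this, hxS]
        simp
      · simp only [indicator, this, hxS]
        simp
    · rw [hout x (not_lt.1 hxR), mul_zero]
  have hle : |∫ x, (S.indicator 1 (x - (1 / n : ℝ) • v) - S.indicator 1 x) * ψ x| ≤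
      volume.real D := by
    rw [← setIntegral_eq_integral_of_forall_compl_eq_zero hzero, ← Real.norm_eq_abs]
    have := norm_setIntegral_le_of_norm_le_const (μ := (volume : Measure (Space d))) (s := D)
      (f := fun x => (S.indicator 1 (x - (1 / n : ℝ) • v) - S.indicator 1 x) * ψ x) (C := 1) hDfin
      (fun x _ => ?_)
    · simpa using this
    · rw [norm_mul]
      refine mul_le_one₀ ?_ (norm_nonneg _) (hb x)
      by_cases h1 : x - (1 / n : ℝ) • v ∈ S <;> by_cases h2 : x ∈ S <;>
        simp only [indicator, h1, h2] <;> simp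
  rw [hF, abs_mul, abs_of_pos hn0]
  exact (mul_le_mul_of_nonneg_left hle hn0.le).trans (mul_volume_change_le hS hSm hv R hn)

theorem continuous_divergence {φ : Space d → Space d} (hφ : ContDiff ℝ 1 φ) :
    Continuous (divergence φ) := by
  unfold divergence
  have h := hφ.continuous_fderiv one_ne_zero
  refine continuous_finsetSum _ fun i _ => ?_
  exact (EuclideanSpace.proj (𝕜 := ℝ) i).continuous.comp (h.clm_apply continuous_const)

theorem hasCompactSupport_divergence {φ : Space d → Space d} (hφ : HasCompactSupport φ) :
    HasCompactSupport (divergence φ) := by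
  refine (hφ.fderiv (𝕜 := ℝ)).comp_left
    (g := fun L : Space d →L[ℝ] Space d => ∑ i, (L (basisVec i)) i) ?_
  simp

theorem hasCompactSupport_of_tsupport_subset_ball {F : Type*} [Zero F] {φ : Space d → F} {R : ℝ}
    (h : tsupport φ ⊆ Metric.ball 0 R) : HasCompactSupport φ :=
  (isCompact_closedBall (0 : Space d) R).of_isClosed_subset (isClosed_tsupport φ)
    (h.trans Metric.ball_subset_closedBall)

theorem LocallyBV.add {g₁ g₂ : Space d → ℝ} (h₁ : LocallyBV g₁) (h₂ : LocallyBV g₂) :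
    LocallyBV fun x => g₁ x + g₂ x := by
  refine ⟨h₁.1.add h₂.1, fun R hR => ?_⟩
  obtain ⟨C₁, hC₁⟩ := h₁.2 R hR
  obtain ⟨C₂, hC₂⟩ := h₂.2 R hR
  refine ⟨C₁ + C₂, fun φ hφ hs hb => ?_⟩
  have hc := hasCompactSupport_divergence (hasCompactSupport_of_tsupport_subset_ball hs)
  have i₁ : Integrable fun x => g₁ x * divergence φ x := by
    simpa using h₁.1.integrable_smul_right_of_hasCompactSupport (continuous_divergence hφ) hc
  have i₂ : Integrable fun x => g₂ x * divergence φ x := by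
    simpa using h₂.1.integrable_smul_right_of_hasCompactSupport (continuous_divergence hφ) hc
  simp only [add_mul]
  rw [integral_add i₁ i₂]
  exact (abs_add_le _ _).trans (add_le_add (hC₁ φ hφ hs hb) (hC₂ φ hφ hs hb))

theorem locallyBV_indicator_of_convex {S : Set (Space d)} (hS : Convex ℝ S)
    (hSm : MeasurableSet S) (a : ℝ) : LocallyBV (S.indicator fun _ => a) := by
  refine ⟨(locallyIntegrable_const a).indicator hSm, fun R _ =>
    ⟨|a| * ∑ _i : Fin d, 2 * volume.real (Metric.ball (0 : Space d) (R + 2)),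
      fun φ hφ hs hb => ?_⟩⟩
  have hcomp : ∀ i, ContDiff ℝ 1 fun x => φ x i := fun i =>
    (EuclideanSpace.proj (𝕜 := ℝ) i).contDiff.comp hφ
  have hfd : ∀ i x, fderiv ℝ (fun x => φ x i) x (basisVec i) = (fderiv ℝ φ x (basisVec i)) i := by
    intro i x
    have := ((EuclideanSpace.proj (𝕜 := ℝ) i : Space d →L[ℝ] ℝ).hasFDerivAt.comp x
      (hφ.differentiable one_ne_zero x).hasFDerivAt).fderiv
    have h2 : fderiv ℝ (fun x => φ x i) x = _ := this
    rw [h2]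
    rfl
  have hsi : ∀ i, tsupport (fun x => φ x i) ⊆ Metric.ball 0 R := fun i =>
    (closure_mono fun x (hx : φ x i ≠ 0) =>
      show φ x ≠ 0 from fun h => hx (by simp [h])).trans hs
  have hint : ∀ i, Integrable fun x => fderiv ℝ (fun x => φ x i) x (basisVec i) := fun i => by
    have hc := (hasCompactSupport_of_tsupport_subset_ball (hsi i)).fderiv_apply (𝕜 := ℝ)
      (basisVec i)
    exact (((hcomp i).continuous_fderiv one_ne_zero).clm_apply
      continuous_const).integrable_of_hasCompactSupport hc
  have heq : ∫ x, (S.indicator fun _ => a) x * divergence φ x =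
      a * ∑ i, ∫ x in S, fderiv ℝ (fun x => φ x i) x (basisVec i) := by
    rw [← integral_finsetSum _ fun i _ => (hint i).integrableOn, ← integral_const_mul,
      ← integral_indicator hSm]
    refine integral_congr_ae (Eventually.of_forall fun x => ?_)
    by_cases hx : x ∈ S <;> simp [hx, divergence, hfd]
  rw [heq, abs_mul]
  gcongr
  refine (Finset.abs_sum_le_sum_abs _ _).trans (Finset.sum_le_sum fun i _ => ?_)
  refine abs_setIntegral_fderiv_le hS hSm ?_ (hcomp i) (hsi i) fun x => ?_
  · simp [basisVec]
  · exact (PiLp.norm_apply_le (φ x) i).trans (hb x)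

/-! ### Half-space and ball data -/

/-- The datum equal to `a` on `{x·e < 0}` and to `b` on `{x·e ≥ 0}`. -/
def halfDatum (a b : ℝ) (e : Space d) : Space d → ℝ := fun x =>
  {x : Space d | inner ℝ x e < 0}.indicator (fun _ => a - b) x + b

theorem halfDatum_of_neg {a b : ℝ} {e x : Space d} (h : inner ℝ x e < 0) :
    halfDatum a b e x = a := by
  simp [halfDatum, h]

theorem halfDatum_of_nonneg {a b : ℝ} {e x : Space d} (h : 0 ≤ inner ℝ x e) :
    halfDatum a b e x = b := by
  simp [halfDatum, not_lt.2 h]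

theorem frontDatum_eq (a : ℝ) (e : Space d) : frontDatum a e = halfDatum a 0 e := by
  ext x
  simp [frontDatum, halfDatum]

theorem exclusiveDatum_eq (α : ℝ) (e : Space d) : exclusiveDatum α e = halfDatum 1 α e := by
  ext x
  rcases lt_or_ge (inner ℝ x e) 0 with h | h
  · simp [exclusiveDatum, halfDatum_of_neg h, h]
  · simp [exclusiveDatum, halfDatum_of_nonneg h, h, not_lt.2 h]

theorem admissible_halfDatum_translate {a b : ℝ} (hb : 0 ≤ b) (hba : b ≤ a) (ha : a ≤ 1)
    (e y : Space d) : Admissible fun x => halfDatum a b e (x + y) := by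
  constructor
  · have hS : Convex ℝ {x : Space d | inner ℝ (x + y) e < 0} := by
      have : {x : Space d | inner ℝ (x + y) e < 0} = {x | innerSL ℝ e x < - inner ℝ y e} := by
        ext x
        simp only [mem_ofPred_eq, inner_add_left, innerSL_apply_apply]
        rw [real_inner_comm x e]
        constructor <;> intro h <;> linarith
      rw [this]
      exact convex_halfSpace_lt (innerSL ℝ e).isLinear _
    have hSm : MeasurableSet {x : Space d | inner ℝ (x + y) e < 0} :=
      (isOpen_lt (by fun_prop) continuous_const).measurableSet
    have h1 := locallyBV_indicator_of_convex hS hSm (a - b)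
    have h2 := locallyBV_indicator_of_convex (d := d) convex_univ MeasurableSet.univ b
    have h3 := h1.add h2
    simp only [indicator_univ] at h3
    exact h3
  · intro x
    beta_reduce
    rcases lt_or_ge (inner ℝ (x + y) e) 0 with h | h
    · rw [halfDatum_of_neg h]; exact ⟨hb.trans hba, ha⟩
    · rw [halfDatum_of_nonneg h]; exact ⟨hb, hba.trans ha⟩

theorem admissible_halfDatum {a b : ℝ} (hb : 0 ≤ b) (hba : b ≤ a) (ha : a ≤ 1) (e : Space d) :
    Admissible (halfDatum a b e) := by
  simpa using admissible_halfDatum_translate hb hba ha e 0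

theorem admissible_ballDatum_translate {θ : ℝ} (h0 : 0 ≤ θ) (h1 : θ ≤ 1) (R : ℝ) (y : Space d) :
    Admissible fun x => ballDatum θ R (x + y) := by
  have heq : (fun x : Space d => ballDatum θ R (x + y)) =
      (Metric.ball (-y) R).indicator fun _ => θ := by
    ext x
    simp only [ballDatum, indicator, Metric.mem_ball, dist_eq_norm, sub_neg_eq_add, sub_zero]
  rw [heq]
  refine ⟨locallyBV_indicator_of_convex (convex_ball _ _) Metric.isOpen_ball.measurableSet θ,
    fun x => ?_⟩
  by_cases hx : x ∈ Metric.ball (-y) R <;> simp [hx, h0, h1]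

theorem admissible_const {a : ℝ} (h0 : 0 ≤ a) (h1 : a ≤ 1) :
    Admissible fun _ : Space d => a := by
  refine ⟨?_, fun _ => ⟨h0, h1⟩⟩
  have := locallyBV_indicator_of_convex (d := d) convex_univ MeasurableSet.univ a
  simpa only [indicator_univ] using this

end

section

variable {d : ℕ}

/-! ### Translation invariance of the notions of solution -/

theorem hessian_translate (v : Space d → ℝ) (x y : Space d) :
    hessian (fun z => v (z + y)) x = hessian v (x + y) := by
  have h : fderiv ℝ (fun z => v (z + y)) = fun z => fderiv ℝ v (z + y) := by
    ext1 z
    exact fderiv_comp_add_right y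
  unfold hessian
  rw [h, fderiv_comp_add_right]

theorem gradient_translate (v : Space d → ℝ) (x y : Space d) :
    gradient (fun z => v (z + y)) x = gradient v (x + y) := by
  unfold gradient
  rw [fderiv_comp_add_right]

theorem divergence_translate (φ : Space d → Space d) (x y : Space d) :
    divergence (fun z => φ (z + y)) x = divergence φ (x + y) := by
  unfold divergence
  rw [fderiv_comp_add_right]

/-- The translation by `y` of the space variable, as a homeomorphism of space-time. -/
def spaceShift (y : Space d) : ℝ × Space d ≃ₜ ℝ × Space d := Homeomorph.addRight (0, y)

@[simp] theorem spaceShift_apply (y : Space d) (z : ℝ × Space d) :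
    spaceShift y z = (z.1, z.2 + y) := by
  simp [spaceShift, Prod.add_def]

theorem measurePreserving_spaceShift (y : Space d) :
    MeasurePreserving (spaceShift y) (volume : Measure (ℝ × Space d)) volume := by
  have h : ⇑(spaceShift y) = Prod.map id fun x => x + y := by
    ext1 z
    exact spaceShift_apply y z
  rw [h]
  exact (MeasurePreserving.id volume).prod (measurePreserving_add_right volume y)

theorem integrableAtFilter_comp {X F : Type*} [TopologicalSpace X] [MeasurableSpace X]
    [BorelSpace X] [NormedAddCommGroup F] {μ : Measure X} {h : X ≃ₜ X}
    (hμ : MeasurePreserving h μ μ) {f : X → F} {l l' : Filter X} (hl : Tendsto h l l')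
    (hf : IntegrableAtFilter f l' μ) : IntegrableAtFilter (fun x => f (h x)) l μ := by
  obtain ⟨U, hU, hfU⟩ := hf
  exact ⟨h ⁻¹' U, hl hU, (hμ.integrableOn_comp_preimage h.measurableEmbedding).2 hfU⟩

theorem mapsTo_spaceShift (y : Space d) :
    MapsTo (spaceShift y) (Ioi (0 : ℝ) ×ˢ (univ : Set (Space d))) (Ioi 0 ×ˢ univ) := by
  rintro z ⟨hz, -⟩
  exact ⟨by simpa using hz, mem_univ _⟩

theorem locallyIntegrableOn_translate {F : Type*} [NormedAddCommGroup F] {f : ℝ × Space d → F}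
    (hf : LocallyIntegrableOn f (Ioi 0 ×ˢ univ)) (y : Space d) :
    LocallyIntegrableOn (fun z => f (z.1, z.2 + y)) (Ioi 0 ×ˢ univ) := by
  intro z hz
  have := integrableAtFilter_comp (measurePreserving_spaceShift y)
    ((spaceShift y).continuous.continuousWithinAt.tendsto_nhdsWithin (mapsTo_spaceShift y))
    (hf _ (mapsTo_spaceShift y hz))
  simpa using this

theorem locallyIntegrable_translate {f : Space d → ℝ} (hf : LocallyIntegrable f) (y : Space d) :
    LocallyIntegrable fun x => f (x + y) := fun _ =>
  integrableAtFilter_comp (h := Homeomorph.addRight y) (measurePreserving_add_right volume y)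
    (Homeomorph.addRight y).continuous.continuousAt (hf _)

theorem IsClassicalSolution.translate {G : Rhs d} {u : ℝ → Space d → ℝ}
    (hu : IsClassicalSolution G u) (y : Space d) :
    IsClassicalSolution (fun X p s x => G X p s (x + y)) fun t x => u t (x + y) := by
  have hc : ContinuousOn (fun z : ℝ × Space d => (z.1, z.2 + y)) (Ioi 0 ×ˢ univ) := by fun_prop
  have hmaps : MapsTo (fun z : ℝ × Space d => (z.1, z.2 + y)) (Ioi 0 ×ˢ univ)
      (Ioi (0 : ℝ) ×ˢ univ) := fun _ hz => ⟨hz.1, mem_univ _⟩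
  refine ⟨fun t ht x => hu.time_diff t ht (x + y), fun t ht => ?_, ?_, ?_, ?_, fun t ht x => ?_⟩
  · exact (hu.space_smooth t ht).comp (contDiff_id.add contDiff_const)
  · exact hu.cont_time.comp hc hmaps
  · simp only [gradient_translate]
    exact hu.cont_grad.comp hc hmaps
  · simp only [hessian_translate]
    exact hu.cont_hess.comp hc hmaps
  · rw [hessian_translate, gradient_translate]
    exact hu.equation t ht (x + y)

theorem upperEnvelope_translate (u : ℝ → Space d → ℝ) (y : Space d) (z : ℝ × Space d) :
    upperEnvelope (fun t x => u t (x + y)) z = upperEnvelope u (z.1, z.2 + y) := by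
  have h := (spaceShift y).map_nhds_eq z
  rw [spaceShift_apply] at h
  unfold upperEnvelope
  rw [← h, limsup, limsup, map_map]
  congr 2
  ext q
  simp

theorem lowerEnvelope_translate (u : ℝ → Space d → ℝ) (y : Space d) (z : ℝ × Space d) :
    lowerEnvelope (fun t x => u t (x + y)) z = lowerEnvelope u (z.1, z.2 + y) := by
  have h := (spaceShift y).map_nhds_eq z
  rw [spaceShift_apply] at h
  unfold lowerEnvelope
  rw [← h, liminf, liminf, map_map]
  congr 2
  ext q
  simp

theorem IsViscositySolution.translate {G : Rhs d} {u : ℝ → Space d → ℝ}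
    (hu : IsViscositySolution G u) (y : Space d) :
    IsViscositySolution (fun X p s x => G X p s (x + y)) fun t x => u t (x + y) := by
  have hcont : ∀ (t : ℝ) (x : Space d),
      ContinuousAt (fun z : ℝ × Space d => (z.1, z.2 - y)) (t, x + y) := fun t x => by fun_prop
  have hsmooth : ∀ φ : ℝ × Space d → ℝ, ContDiff ℝ 2 φ →
      ContDiff ℝ 2 fun z : ℝ × Space d => φ (z.1, z.2 - y) := fun φ hφ =>
    hφ.comp (contDiff_fst.prodMk (contDiff_snd.sub contDiff_const))
  have hhess : ∀ (φ : ℝ × Space d → ℝ) t x,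
      hessian (fun z => φ (t, z - y)) (x + y) = hessian (fun z => φ (t, z)) x := by
    intro φ t x
    simpa using (hessian_translate (fun z => φ (t, z - y)) x y).symm
  have hgrad : ∀ (φ : ℝ × Space d → ℝ) t x,
      gradient (fun z => φ (t, z - y)) (x + y) = gradient (fun z => φ (t, z)) x := by
    intro φ t x
    simpa using (gradient_translate (fun z => φ (t, z - y)) x y).symm
  refine ⟨fun z hz => ?_, fun φ hφ t ht x hmax => ?_, fun φ hφ t ht x hmin => ?_⟩
  · obtain ⟨C, hC⟩ := hu.locally_bounded (z.1, z.2 + y) hz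
    have h := (spaceShift y).continuous.tendsto z
    rw [spaceShift_apply] at h
    exact ⟨C, (h.eventually hC).mono fun q hq => by simpa using hq⟩
  · have h := hu.subsolution _ (hsmooth φ hφ) t ht (x + y) ?_
    · simp only [hhess, hgrad, add_sub_cancel_right] at h
      rwa [upperEnvelope_translate]
    · have h1 := IsLocalMax.comp_continuous (b := (t, x + y))
        (g := fun z : ℝ × Space d => (z.1, z.2 - y)) (by simpa using hmax) (hcont t x)
      refine h1.congr (Eventually.of_forall fun z => ?_)
      simp [upperEnvelope_translate]
  · have h := hu.supersolution _ (hsmooth φ hφ) t ht (x + y) ?_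
    · simp only [hhess, hgrad, add_sub_cancel_right] at h
      rwa [lowerEnvelope_translate]
    · have h1 := IsLocalMin.comp_continuous (b := (t, x + y))
        (g := fun z : ℝ × Space d => (z.1, z.2 - y)) (by simpa using hmin) (hcont t x)
      refine h1.congr (Eventually.of_forall fun z => ?_)
      simp [lowerEnvelope_translate]

theorem HasDivergenceForm.translate {G : Rhs d} {a : Space d → ℝ → Matrix (Fin d) (Fin d) ℝ}
    {b : Space d → ℝ → Space d} {c : Space d → ℝ → ℝ} (h : HasDivergenceForm G a b c)
    (y : Space d) :
    HasDivergenceForm (fun X p s x => G X p s (x + y)) (fun x => a (x + y)) (fun x => b (x + y))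
      fun x => c (x + y) := by
  have hsm : ∀ v : Space d → ℝ, ContDiff ℝ (⊤ : ℕ∞) v →
      ContDiff ℝ (⊤ : ℕ∞) fun x => v (x - y) := fun v hv =>
    hv.comp (contDiff_id.sub contDiff_const)
  have hadd : ∀ n : WithTop ℕ∞, ContDiff ℝ n fun x : Space d => x + y := fun n =>
    contDiff_id.add contDiff_const
  refine ⟨fun x => h.cont_a _, fun x => h.cont_b _, fun x => h.cont_c _,
    fun v hv hv01 i j => ?_, fun v hv hv01 => ?_, fun v hv hv01 x => ?_⟩
  · simpa [Function.comp_def] using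
      (h.smooth_a _ (hsm v hv) (fun x => hv01 _) i j).comp (hadd 2)
  · simpa [Function.comp_def] using (h.smooth_b _ (hsm v hv) (fun x => hv01 _)).comp (hadd 1)
  · have h1 := h.identity _ (hsm v hv) (fun x => hv01 _) (x + y)
    simp only [← hessian_translate _ x y, ← gradient_translate _ x y,
      ← divergence_translate _ x y, add_sub_cancel_right] at h1
    exact h1

theorem IsDistributionalSolution.translate {G : Rhs d} {u : ℝ → Space d → ℝ}
    (hu : IsDistributionalSolution G u) (y : Space d) :
    IsDistributionalSolution (fun X p s x => G X p s (x + y)) fun t x => u t (x + y) := by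
  obtain ⟨h01, a, b, c, hG, iu, ia, ib, ic, heq⟩ := hu
  refine ⟨fun t ht x => h01 t ht _, _, _, _, hG.translate y, locallyIntegrableOn_translate iu y,
    fun i j => locallyIntegrableOn_translate (ia i j) y, locallyIntegrableOn_translate ib y,
    locallyIntegrableOn_translate ic y, fun φ hφ hφc hφs => ?_⟩
  have hψ : (fun z : ℝ × Space d => φ (z.1, z.2 - y)) = φ ∘ (spaceShift (-y)) := by
    ext z
    simp [sub_eq_add_neg]
  have h := heq (fun z => φ (z.1, z.2 - y))
    (hφ.comp (contDiff_fst.prodMk (contDiff_snd.sub contDiff_const))) ?_ ?_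
  · rw [← (measurePreserving_spaceShift y).setIntegral_preimage_emb
      (spaceShift y).measurableEmbedding] at h
    have hpre : spaceShift y ⁻¹' (Ioi (0 : ℝ) ×ˢ (univ : Set (Space d))) = Ioi 0 ×ˢ univ := by
      ext z
      simp
    rw [hpre] at h
    simpa only [spaceShift_apply, ← hessian_translate _ _ y, ← gradient_translate _ _ y,
      add_sub_cancel_right] using h
  · rw [hψ]
    exact hφc.comp_homeomorph _
  · rw [hψ, tsupport_comp_eq_preimage]
    exact fun z hz => by simpa using hφs hz

theorem SolutionSense.Solves.translate {S : SolutionSense} {G : Rhs d} {u : ℝ → Space d → ℝ}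
    (hu : S.Solves G u) (y : Space d) :
    S.Solves (fun X p s x => G X p s (x + y)) fun t x => u t (x + y) := by
  cases S with
  | classical => exact IsClassicalSolution.translate hu y
  | viscosity => exact IsViscositySolution.translate hu y
  | distributional => exact IsDistributionalSolution.translate hu y

theorem HasInitialValue.translate {u : ℝ → Space d → ℝ} {u₀ : Space d → ℝ}
    (hu : HasInitialValue u u₀) (y : Space d) :
    HasInitialValue (fun t x => u t (x + y)) fun x => u₀ (x + y) := by
  refine ⟨locallyIntegrable_translate hu.1 y, fun t ht => locallyIntegrable_translate (hu.2.1 t ht) y,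
    fun K hK => ?_⟩
  have h := hu.2.2 _ (hK.image (Homeomorph.addRight y).continuous)
  refine h.congr fun t => ?_
  rw [← (measurePreserving_add_right volume y).setIntegral_preimage_emb
    (Homeomorph.addRight y).measurableEmbedding]
  congr 1
  rw [show (fun x => x + y) = Homeomorph.addRight y from rfl,
    (Homeomorph.addRight y).injective.preimage_image]

end

section

variable {d : ℕ} {Ω : Type*} [MeasurableSpace Ω] {P : Measure Ω} {E : RandomPDE d Ω}
  {mBar cBar θ₀ R₀ : ℝ}

/-! ### Consequences of well-posedness and stationarity -/

namespace HypothesisH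

theorem isPreservingAction (hH : HypothesisH P E mBar cBar θ₀ R₀) :
    IsPreservingAction P E.shift :=
  ⟨hH.shift_zero, hH.shift_add, hH.shift_measurable, hH.shift_preserving⟩

theorem isSolution_sol (hH : HypothesisH P E mBar cBar θ₀ R₀) (ω : Ω) {u₀ : Space d → ℝ}
    (hu₀ : Admissible u₀) : E.IsSolution ω u₀ (E.sol ω u₀) :=
  Classical.epsilon_spec (hH.exists_solution ω u₀ hu₀)

theorem isSolution_translate (hH : HypothesisH P E mBar cBar θ₀ R₀) {ω : Ω} {u₀ : Space d → ℝ}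
    {u : ℝ → Space d → ℝ} (hu : E.IsSolution ω u₀ u) (y : Space d) :
    E.IsSolution (E.shift y ω) (fun x => u₀ (x + y)) fun t x => u t (x + y) := by
  refine ⟨hH.cls_translate u hu.1 y, ?_, hu.2.2.translate y⟩
  have h := hu.2.1.translate y
  simpa only [hH.stationary] using h

/-- The solution started in the environment seen from `y`, moved back to the original
environment. -/
theorem isSolution_shift (hH : HypothesisH P E mBar cBar θ₀ R₀) (ω : Ω) {u₀ : Space d → ℝ}
    (hu₀ : Admissible u₀) (y : Space d) :
    E.IsSolution ω (fun x => u₀ (x - y)) fun t x => E.sol (E.shift y ω) u₀ t (x - y) := by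
  have h := hH.isSolution_translate (hH.isSolution_sol (E.shift y ω) hu₀) (-y)
  rw [← hH.shift_add, neg_add_cancel, hH.shift_zero] at h
  simpa only [← sub_eq_add_neg] using h

theorem isSolution_shift_time (hH : HypothesisH P E mBar cBar θ₀ R₀) (ω : Ω) {u₀ : Space d → ℝ}
    (hu₀ : Admissible u₀) (y : Space d) {s : ℝ} (hs : 0 < s) :
    E.IsSolution ω (fun x => E.sol (E.shift y ω) u₀ s (x - y))
      fun t x => E.sol (E.shift y ω) u₀ (t + s) (x - y) :=
  hH.time_shift ω _ _ (hH.isSolution_shift ω hu₀ y) s hs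

theorem sol_mem_Icc (hH : HypothesisH P E mBar cBar θ₀ R₀) (ω : Ω) {u₀ : Space d → ℝ}
    (hu₀ : Admissible u₀) {t : ℝ} (ht : 0 < t) (x : Space d) :
    E.sol ω u₀ t x ∈ Icc (0 : ℝ) 1 := by
  have h := hH.isSolution_sol ω hu₀
  obtain ⟨z, hz⟩ := hH.exists_solution ω _ (admissible_const (d := d) le_rfl zero_le_one)
  obtain ⟨o, ho⟩ := hH.exists_solution ω _ (admissible_const (d := d) zero_le_one le_rfl)
  constructor
  · rw [← hH.sol_zero ω z hz t ht x]
    exact hH.comparison ω _ _ _ _ hz h (fun x => (hu₀.2 x).1) t ht x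
  · rw [← hH.sol_one ω o ho t ht x]
    exact hH.comparison ω _ _ _ _ h ho (fun x => (hu₀.2 x).2) t ht x

theorem sol_shift_le_sol_shift (hH : HypothesisH P E mBar cBar θ₀ R₀) (ω : Ω)
    {u₀ v₀ : Space d → ℝ} (hu₀ : Admissible u₀) (hv₀ : Admissible v₀) {y y' : Space d}
    (h : ∀ z, u₀ (z - y) ≤ v₀ (z - y')) {t : ℝ} (ht : 0 < t) (X : Space d) :
    E.sol (E.shift y ω) u₀ t (X - y) ≤ E.sol (E.shift y' ω) v₀ t (X - y') :=
  hH.comparison ω _ _ _ _ (hH.isSolution_shift ω hu₀ y) (hH.isSolution_shift ω hv₀ y') h t ht X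

theorem sol_le_sol (hH : HypothesisH P E mBar cBar θ₀ R₀) (ω : Ω) {u₀ v₀ : Space d → ℝ}
    (hu₀ : Admissible u₀) (hv₀ : Admissible v₀) (h : ∀ z, u₀ z ≤ v₀ z) {t : ℝ} (ht : 0 < t)
    (x : Space d) : E.sol ω u₀ t x ≤ E.sol ω v₀ t x :=
  hH.comparison ω _ _ _ _ (hH.isSolution_sol ω hu₀) (hH.isSolution_sol ω hv₀) h t ht x

theorem sol_shift_le_of_ball (hH : HypothesisH P E mBar cBar θ₀ R₀) (ω : Ω)
    {u₀ v₀ : Space d → ℝ} (hu₀ : Admissible u₀) (hv₀ : Admissible v₀) {y y' X : Space d} {r : ℝ}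
    (hr : 0 < r) (h : ∀ z ∈ Metric.ball X r, u₀ (z - y) ≤ v₀ (z - y')) {t : ℝ} (ht : 0 < t) :
    E.sol (E.shift y ω) u₀ t (X - y) ≤
      E.sol (E.shift y' ω) v₀ t (X - y') + cBar * Real.exp (-mBar * (r - cBar * t)) :=
  hH.localization ω _ _ _ _ (hH.isSolution_shift ω hu₀ y) (hH.isSolution_shift ω hv₀ y')
    (fun _ ht _ => hH.sol_mem_Icc _ hu₀ ht _) (fun _ ht _ => hH.sol_mem_Icc _ hv₀ ht _) r hr X h
    t ht

/-- The error in the localization principle on balls of radius `(cBar + 1) t` is negligible. -/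
theorem eventually_error_le (hH : HypothesisH P E mBar cBar θ₀ R₀) {ε : ℝ} (hε : 0 < ε) :
    ∀ᶠ t : ℝ in atTop, cBar * Real.exp (-mBar * ((cBar + 1) * t - cBar * t)) ≤ ε := by
  have h1 : Tendsto (fun t : ℝ => -mBar * ((cBar + 1) * t - cBar * t)) atTop atBot := by
    have : (fun t : ℝ => -mBar * ((cBar + 1) * t - cBar * t)) = fun t => -mBar * t := by
      ext t
      ring
    rw [this]
    exact tendsto_id.const_mul_atTop_of_neg (neg_lt_zero.2 hH.mBar_pos)
  have h2 := (Real.tendsto_exp_atBot.comp h1).const_mul cBar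
  rw [mul_zero] at h2
  exact h2.eventually_le_const hε

/-- A property of solutions that holds for a.e. environment at all large times holds, for a.e.
environment, in a dense set of translated environments at every scale. -/
theorem ae_visits [IsProbabilityMeasure P] (hH : HypothesisH P E mBar cBar θ₀ R₀)
    {u₀ : Space d → ℝ} (hu₀ : Admissible u₀) {W : Set ((ℝ × Space d) × ℝ)}
    (hW : MeasurableSet W)
    (h : ∀ᵐ ω ∂P, ∀ᶠ t : ℝ in atTop, ∀ x, ((t, x), E.sol ω u₀ t x) ∈ W) :
    ∀ᵐ ω ∂P, ∀ Λ δ : ℝ, 0 < δ → ∃ n : ℕ, ∀ᶠ t : ℝ in atTop, ∀ y : Space d, ‖y‖ ≤ Λ * t →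
      ∃ y' : Space d, ‖y' - y‖ ≤ δ * t ∧ ∀ t' : ℝ, 0 < t' → (n : ℝ) ≤ t' → ∀ x,
        ((t', x), E.sol (E.shift y' ω) u₀ t' x) ∈ W := by
  refine ae_exists_visits hH.isPreservingAction
    (A := fun n : ℕ => {ω | ∀ t' : ℝ, 0 < t' → (n : ℝ) ≤ t' → ∀ x,
      ((t', x), E.sol ω u₀ t' x) ∈ W}) (fun n => ?_) (fun n m hnm ω hω t' ht' hm => ?_) ?_
  · have hS : MeasurableSet {q : Ω × Ioi (0 : ℝ) × Space d | (n : ℝ) ≤ q.2.1 ∧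
        (((q.2.1 : ℝ), q.2.2), E.sol q.1 u₀ q.2.1 q.2.2) ∈ Wᶜ} := by
      have hm := hH.sol_measurable u₀ hu₀
      have ht : Measurable fun q : Ω × Ioi (0 : ℝ) × Space d => (q.2.1 : ℝ) :=
        measurable_subtype_coe.comp (measurable_fst.comp measurable_snd)
      refine MeasurableSet.inter (measurableSet_le measurable_const ht) ?_
      exact ((ht.prodMk (measurable_snd.comp measurable_snd)).prodMk hm) hW.compl
    have : StandardBorelSpace (Ioi (0 : ℝ)) := measurableSet_Ioi.standardBorel
    convert (nullMeasurableSet_image_fst P hS).compl using 1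
    ext ω
    simp only [mem_ofPred_eq, mem_compl_iff, mem_image, Prod.exists, Subtype.exists, mem_Ioi,
      exists_and_right, exists_eq_right]
    constructor
    · rintro hω ⟨t, ht, x, h1, h2⟩
      exact h2 (hω t ht h1 x)
    · intro hω t ht hn x
      by_contra hc
      exact hω ⟨t, ht, x, hn, hc⟩
  · exact hω t' ht' (le_trans (by exact_mod_cast hnm) hm)
  · filter_upwards [h] with ω hω
    obtain ⟨T, hT⟩ := eventually_atTop.1 hω
    obtain ⟨n, hn⟩ := exists_nat_ge T
    exact ⟨n, fun t _ ht => hT t (hn.trans ht)⟩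

end HypothesisH

end

section

variable {d : ℕ} {Ω : Type*} [MeasurableSpace Ω] {P : Measure Ω} {E : RandomPDE d Ω}
  {mBar cBar θ₀ R₀ : ℝ}

/-! ### Bounds on fronts that are uniform over translations of size `O(t)` -/

/-- Fronts in direction `e` from the datum `a` on `{x·e < 0}`, `b` on `{x·e ≥ 0}` are
asymptotically at most `v` in the region `x·e ≥ g t`, `‖x‖ ≤ Λ t`, uniformly over translations of
the environment of size `O(t)`. -/
def UpperBound (E : RandomPDE d Ω) (ω : Ω) (e : Space d) (a b g Λ v : ℝ) : Prop :=
  ∀ Λ₀ ε : ℝ, 0 < ε → ∀ᶠ t : ℝ in atTop, ∀ y x : Space d, ‖y‖ ≤ Λ₀ * t → ‖x‖ ≤ Λ * t →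
    g * t ≤ inner ℝ x e → E.sol (E.shift y ω) (halfDatum a b e) t x ≤ v + ε

/-- Fronts in direction `e` from the datum `a` on `{x·e < 0}`, `b` on `{x·e ≥ 0}` converge to `1`
in the region `x·e ≤ g t`, `‖x‖ ≤ Λ t`, uniformly over translations of the environment of size
`O(t)`. -/
def LowerBound (E : RandomPDE d Ω) (ω : Ω) (e : Space d) (a b g Λ : ℝ) : Prop :=
  ∀ Λ₀ ε : ℝ, 0 < ε → ∀ᶠ t : ℝ in atTop, ∀ y x : Space d, ‖y‖ ≤ Λ₀ * t → ‖x‖ ≤ Λ * t →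
    inner ℝ x e ≤ g * t → 1 - ε ≤ E.sol (E.shift y ω) (halfDatum a b e) t x

omit [MeasurableSpace Ω] in
theorem UpperBound.mono {ω : Ω} {e : Space d} {a b g g' Λ Λ' v v' : ℝ}
    (h : UpperBound E ω e a b g Λ v) (hg : g ≤ g') (hΛ : Λ' ≤ Λ) (hv : v ≤ v') :
    UpperBound E ω e a b g' Λ' v' := by
  intro Λ₀ ε hε
  filter_upwards [h Λ₀ ε hε, eventually_gt_atTop 0] with t ht ht0 y x hy hx hxe
  have h1 : Λ' * t ≤ Λ * t := by gcongr
  have h2 : g * t ≤ g' * t := by gcongr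
  exact (ht y x hy (hx.trans h1) (h2.trans hxe)).trans (by gcongr)

omit [MeasurableSpace Ω] in
theorem LowerBound.mono {ω : Ω} {e : Space d} {a b g g' Λ Λ' : ℝ}
    (h : LowerBound E ω e a b g Λ) (hg : g' ≤ g) (hΛ : Λ' ≤ Λ) : LowerBound E ω e a b g' Λ' := by
  intro Λ₀ ε hε
  filter_upwards [h Λ₀ ε hε, eventually_gt_atTop 0] with t ht ht0 y x hy hx hxe
  have h1 : Λ' * t ≤ Λ * t := by gcongr
  have h2 : g' * t ≤ g * t := by gcongr
  exact ht y x hy (hx.trans h1) (hxe.trans h2)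

theorem halfDatum_le_halfDatum {a b : ℝ} (hba : b ≤ a) {e e' x x' : Space d}
    (h : inner ℝ x e < 0 → inner ℝ x' e' < 0) : halfDatum a b e x ≤ halfDatum a b e' x' := by
  rcases lt_or_ge (inner ℝ x e) 0 with h1 | h1
  · rw [halfDatum_of_neg h1, halfDatum_of_neg (h h1)]
  · rw [halfDatum_of_nonneg h1]
    rcases lt_or_ge (inner ℝ x' e') 0 with h2 | h2
    · rwa [halfDatum_of_neg h2]
    · rw [halfDatum_of_nonneg h2]

theorem halfDatum_mono_right {a b b' : ℝ} (h : b ≤ b') (e x : Space d) :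
    halfDatum a b e x ≤ halfDatum a b' e x := by
  rcases lt_or_ge (inner ℝ x e) 0 with h1 | h1
  · rw [halfDatum_of_neg h1, halfDatum_of_neg h1]
  · rwa [halfDatum_of_nonneg h1, halfDatum_of_nonneg h1]

theorem inner_le_norm_of_unit {e : Space d} (he : ‖e‖ = 1) (x : Space d) :
    |inner ℝ x e| ≤ ‖x‖ := by
  simpa [he] using abs_real_inner_le_norm x e

theorem inner_self_of_unit {e : Space d} (he : ‖e‖ = 1) : inner ℝ e e = 1 := by
  rw [real_inner_self_eq_norm_sq, he, one_pow]

/-- The solution from a half-space datum increases when the half-space is moved forward. -/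
theorem HypothesisH.sol_halfDatum_shift_mono (hH : HypothesisH P E mBar cBar θ₀ R₀) (ω : Ω)
    {a b : ℝ} (hb : 0 ≤ b) (hba : b ≤ a) (ha : a ≤ 1) {e y y' : Space d}
    (h : 0 ≤ inner ℝ (y' - y) e) {t : ℝ} (ht : 0 < t) (X : Space d) :
    E.sol (E.shift y ω) (halfDatum a b e) t (X - y) ≤
      E.sol (E.shift y' ω) (halfDatum a b e) t (X - y') := by
  refine hH.sol_shift_le_sol_shift ω (admissible_halfDatum hb hba ha e)
    (admissible_halfDatum hb hba ha e) (fun z => halfDatum_le_halfDatum hba fun hz => ?_) ht X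
  have : z - y' = (z - y) - (y' - y) := by abel
  rw [this, inner_sub_left]
  linarith

/-- An upper bound on fronts that holds in a.e. environment is, for a.e. environment, uniform over
translations of size `O(t)`: each translate is compared with one that belongs to a large event and whose
half-space lies slightly further ahead. -/
theorem HypothesisH.ae_upperBound [IsProbabilityMeasure P]
    (hH : HypothesisH P E mBar cBar θ₀ R₀) {e : Space d} (he : ‖e‖ = 1) {a b : ℝ} (hb : 0 ≤ b)
    (hba : b ≤ a) (ha : a ≤ 1) {g g' Λ Λ' v : ℝ} (hg : g < g') (hΛ : Λ < Λ')
    (h : ∀ᵐ ω ∂P, ∀ ε : ℝ, 0 < ε → ∀ᶠ t : ℝ in atTop, ∀ x : Space d, ‖x‖ ≤ Λ' * t →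
      g * t ≤ inner ℝ x e → E.sol ω (halfDatum a b e) t x ≤ v + ε) :
    ∀ᵐ ω ∂P, UpperBound E ω e a b g' Λ v := by
  have hW : ∀ k : ℕ, MeasurableSet {q : (ℝ × Space d) × ℝ | ‖q.1.2‖ ≤ Λ' * q.1.1 →
      g * q.1.1 ≤ inner ℝ q.1.2 e → q.2 ≤ v + 1 / ((k : ℝ) + 1)} := fun k => by
    refine MeasurableSet.imp ?_ (MeasurableSet.imp ?_ ?_)
    · exact (isClosed_le (by fun_prop) (by fun_prop)).measurableSet
    · exact (isClosed_le (by fun_prop) (by fun_prop)).measurableSet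
    · exact (isClosed_le (by fun_prop) (by fun_prop)).measurableSet
  have hvis := ae_all_iff.2 fun k : ℕ => hH.ae_visits (admissible_halfDatum hb hba ha e) (hW k)
    (h.mono fun ω hω => hω (1 / ((k : ℝ) + 1)) (by positivity))
  filter_upwards [hvis] with ω hω Λ₀ ε hε
  obtain ⟨k, hk⟩ := exists_nat_one_div_lt hε
  set δ := min (g' - g) (Λ' - Λ) / 2 with hδ
  have hδ0 : 0 < δ := by
    have : 0 < min (g' - g) (Λ' - Λ) := lt_min (by linarith) (by linarith)
    positivity
  have hδg : 2 * δ ≤ g' - g := by rw [hδ]; linarith [min_le_left (g' - g) (Λ' - Λ)]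
  have hδΛ : 2 * δ ≤ Λ' - Λ := by rw [hδ]; linarith [min_le_right (g' - g) (Λ' - Λ)]
  obtain ⟨n, hn⟩ := hω k (Λ₀ + δ) δ hδ0
  filter_upwards [hn, eventually_gt_atTop 0, eventually_ge_atTop (n : ℝ)]
    with t ht ht0 htn y x hy hx hxe
  have hδt : ‖(δ * t) • e‖ = δ * t := by
    rw [norm_smul, he, mul_one, Real.norm_of_nonneg]
    positivity
  obtain ⟨y', hy', hgood⟩ := ht (y + (δ * t) • e) (by
    have := norm_add_le y ((δ * t) • e)
    rw [hδt] at this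
    linarith)
  have hinner : inner ℝ (y' - y) e = inner ℝ (y' - (y + (δ * t) • e)) e + δ * t := by
    rw [← sub_sub, inner_sub_left (y' - y), inner_smul_left, inner_self_of_unit he]
    simp
  have hab := abs_le.1 ((inner_le_norm_of_unit he (y' - (y + (δ * t) • e))).trans hy')
  have hyy : ‖y' - y‖ ≤ 2 * (δ * t) := by
    have : y' - y = (y' - (y + (δ * t) • e)) + (δ * t) • e := by abel
    rw [this]
    refine (norm_add_le _ _).trans ?_
    rw [hδt]
    linarith
  have hmono := hH.sol_halfDatum_shift_mono ω hb hba ha (e := e) (y := y) (y' := y')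
    (by rw [hinner]; linarith [hab.1]) ht0 (x + y)
  rw [add_sub_cancel_right] at hmono
  have heq : x + y - y' = x - (y' - y) := by abel
  have h1 := hgood t ht0 htn (x + y - y') ?_ ?_
  · exact (hmono.trans h1).trans (by simpa using hk.le)
  · rw [heq]
    have := norm_sub_le x (y' - y)
    nlinarith
  · rw [heq, inner_sub_left, hinner]
    nlinarith [hab.2]

/-- The counterpart of `HypothesisH.ae_upperBound` for lower bounds. -/
theorem HypothesisH.ae_lowerBound [IsProbabilityMeasure P]
    (hH : HypothesisH P E mBar cBar θ₀ R₀) {e : Space d} (he : ‖e‖ = 1) {a b : ℝ} (hb : 0 ≤ b)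
    (hba : b ≤ a) (ha : a ≤ 1) {g g' Λ Λ' : ℝ} (hg : g' < g) (hΛ : Λ < Λ')
    (h : ∀ᵐ ω ∂P, ∀ ε : ℝ, 0 < ε → ∀ᶠ t : ℝ in atTop, ∀ x : Space d, ‖x‖ ≤ Λ' * t →
      inner ℝ x e ≤ g * t → 1 - ε ≤ E.sol ω (halfDatum a b e) t x) :
    ∀ᵐ ω ∂P, LowerBound E ω e a b g' Λ := by
  have hW : ∀ k : ℕ, MeasurableSet {q : (ℝ × Space d) × ℝ | ‖q.1.2‖ ≤ Λ' * q.1.1 →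
      inner ℝ q.1.2 e ≤ g * q.1.1 → 1 - 1 / ((k : ℝ) + 1) ≤ q.2} := fun k => by
    refine MeasurableSet.imp ?_ (MeasurableSet.imp ?_ ?_)
    · exact (isClosed_le (by fun_prop) (by fun_prop)).measurableSet
    · exact (isClosed_le (by fun_prop) (by fun_prop)).measurableSet
    · exact (isClosed_le (by fun_prop) (by fun_prop)).measurableSet
  have hvis := ae_all_iff.2 fun k : ℕ => hH.ae_visits (admissible_halfDatum hb hba ha e) (hW k)
    (h.mono fun ω hω => hω (1 / ((k : ℝ) + 1)) (by positivity))
  filter_upwards [hvis] with ω hω Λ₀ ε hε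
  obtain ⟨k, hk⟩ := exists_nat_one_div_lt hε
  set δ := min (g - g') (Λ' - Λ) / 2 with hδ
  have hδ0 : 0 < δ := by
    have : 0 < min (g - g') (Λ' - Λ) := lt_min (by linarith) (by linarith)
    positivity
  have hδg : 2 * δ ≤ g - g' := by rw [hδ]; linarith [min_le_left (g - g') (Λ' - Λ)]
  have hδΛ : 2 * δ ≤ Λ' - Λ := by rw [hδ]; linarith [min_le_right (g - g') (Λ' - Λ)]
  obtain ⟨n, hn⟩ := hω k (Λ₀ + δ) δ hδ0
  filter_upwards [hn, eventually_gt_atTop 0, eventually_ge_atTop (n : ℝ)]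
    with t ht ht0 htn y x hy hx hxe
  have hδt : ‖(δ * t) • e‖ = δ * t := by
    rw [norm_smul, he, mul_one, Real.norm_of_nonneg]
    positivity
  obtain ⟨y', hy', hgood⟩ := ht (y - (δ * t) • e) (by
    have := norm_sub_le y ((δ * t) • e)
    rw [hδt] at this
    linarith)
  have hinner : inner ℝ (y - y') e = δ * t - inner ℝ (y' - (y - (δ * t) • e)) e := by
    have : y - y' = (δ * t) • e - (y' - (y - (δ * t) • e)) := by abel
    rw [this, inner_sub_left, inner_smul_left, inner_self_of_unit he]
    simp
  have hab := abs_le.1 ((inner_le_norm_of_unit he (y' - (y - (δ * t) • e))).trans hy')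
  have hyy : ‖y - y'‖ ≤ 2 * (δ * t) := by
    have : y - y' = (δ * t) • e - (y' - (y - (δ * t) • e)) := by abel
    rw [this]
    refine (norm_sub_le _ _).trans ?_
    rw [hδt]
    linarith
  have hmono := hH.sol_halfDatum_shift_mono ω hb hba ha (e := e) (y := y') (y' := y)
    (by rw [hinner]; linarith [hab.2]) ht0 (x + y)
  rw [add_sub_cancel_right] at hmono
  have heq : x + y - y' = x + (y - y') := by abel
  have h1 := hgood t ht0 htn (x + y - y') ?_ ?_
  · exact le_trans (le_trans (by linarith) h1) hmono
  · rw [heq]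
    have := norm_add_le x (y - y')
    nlinarith
  · rw [heq, inner_add_left, hinner]
    nlinarith [hab.1]

/-- Solutions from half-space data for nearby directions, with the half-spaces moved so that one
contains the other within the distance that matters up to time `t`. -/
theorem HypothesisH.sol_halfDatum_le (hH : HypothesisH P E mBar cBar θ₀ R₀) (ω : Ω)
    {a b : ℝ} (hb : 0 ≤ b) (hba : b ≤ a) (ha : a ≤ 1) {e₁ e₂ y₁ y₂ X : Space d} {t : ℝ}
    (ht : 0 < t)
    (h : ∀ z, ‖z - X‖ < (cBar + 1) * t → inner ℝ (z - y₁) e₁ < 0 → inner ℝ (z - y₂) e₂ < 0) :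
    E.sol (E.shift y₁ ω) (halfDatum a b e₁) t (X - y₁) ≤
      E.sol (E.shift y₂ ω) (halfDatum a b e₂) t (X - y₂)
        + cBar * Real.exp (-mBar * ((cBar + 1) * t - cBar * t)) := by
  have hc := hH.cBar_pos
  refine hH.sol_shift_le_of_ball ω (admissible_halfDatum hb hba ha e₁)
    (admissible_halfDatum hb hba ha e₂) (by positivity) (fun z hz => ?_) ht
  exact halfDatum_le_halfDatum hba (h z (by simpa [dist_eq_norm] using hz))

/-- Upper bounds on fronts in direction `e` carry over to all directions within distance `η`, with
a loss of order `η` in the speed: within distance `(Λ + cBar + 1) t`, which is all that matters up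
to time `t`, one half-space contains the other after a translation by `(Λ + cBar + 1) η t`. -/
theorem HypothesisH.upperBound_change_direction (hH : HypothesisH P E mBar cBar θ₀ R₀) {ω : Ω}
    {a b : ℝ} (hb : 0 ≤ b) (hba : b ≤ a) (ha : a ≤ 1) {e : Space d} (he : ‖e‖ = 1)
    {g g' Λ Λ' v η : ℝ} (hη : 0 ≤ η) (hΛ0 : 0 ≤ Λ) (hub : UpperBound E ω e a b g Λ' v)
    (hg : g + 2 * ((Λ + cBar + 1) * η) ≤ g') (hΛ : Λ + (Λ + cBar + 1) * η ≤ Λ') (Λ₀ : ℝ)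
    {ε : ℝ} (hε : 0 < ε) :
    ∀ᶠ t : ℝ in atTop, ∀ e' : Space d, ‖e' - e‖ ≤ η → ∀ y x : Space d, ‖y‖ ≤ Λ₀ * t →
      ‖x‖ ≤ Λ * t → g' * t ≤ inner ℝ x e' →
        E.sol (E.shift y ω) (halfDatum a b e') t x ≤ v + ε := by
  filter_upwards [hub (Λ₀ + (Λ + cBar + 1) * η) (ε / 2) (half_pos hε),
    hH.eventually_error_le (half_pos hε), eventually_gt_atTop 0] with t ht herr ht0 e' he' y x hy hx hxe
  have hc := hH.cBar_pos
  set s := (Λ + cBar + 1) * η with hs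
  have hs0 : 0 ≤ s := by positivity
  have hst : ‖(s * t) • e‖ = s * t := by
    rw [norm_smul, he, mul_one, Real.norm_of_nonneg]
    positivity
  have hdiff : ∀ z : Space d, |inner ℝ z e' - inner ℝ z e| ≤ ‖z‖ * η := fun z => by
    rw [← inner_sub_right]
    exact (abs_real_inner_le_norm _ _).trans (by gcongr)
  have hcmp := hH.sol_halfDatum_le ω hb hba ha (e₁ := e') (e₂ := e) (y₁ := y)
    (y₂ := y + (s * t) • e) (X := x + y) ht0 ?_
  · rw [add_sub_cancel_right] at hcmp
    have heq : x + y - (y + (s * t) • e) = x - (s * t) • e := by abel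
    rw [heq] at hcmp
    have h1 := ht (y + (s * t) • e) (x - (s * t) • e) ?_ ?_ ?_
    · linarith
    · have := norm_add_le y ((s * t) • e)
      rw [hst] at this
      nlinarith
    · have := norm_sub_le x ((s * t) • e)
      rw [hst] at this
      nlinarith
    · rw [inner_sub_left, inner_smul_left, inner_self_of_unit he]
      simp only [conj_trivial, mul_one]
      have h2 := (abs_le.1 (hdiff x)).2
      have h3 : ‖x‖ * η ≤ s * t := by
        calc ‖x‖ * η ≤ (Λ * t) * η := by gcongr
          _ ≤ ((Λ + cBar + 1) * t) * η := by gcongr; linarith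
          _ = s * t := by rw [hs]; ring
      nlinarith
  · intro z hz hz'
    rw [← sub_sub, inner_sub_left, inner_smul_left, inner_self_of_unit he]
    simp only [conj_trivial, mul_one]
    have h2 := (abs_le.1 (hdiff (z - y))).1
    have h3 : ‖z - y‖ ≤ (Λ + cBar + 1) * t := by
      have : z - y = (z - (x + y)) + x := by abel
      rw [this]
      refine (norm_add_le _ _).trans ?_
      nlinarith
    have h4 : ‖z - y‖ * η ≤ s * t := by
      calc ‖z - y‖ * η ≤ ((Λ + cBar + 1) * t) * η := by gcongr
        _ = s * t := by rw [hs]; ring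
    linarith

/-- The counterpart of `HypothesisH.upperBound_change_direction` for lower bounds. -/
theorem HypothesisH.lowerBound_change_direction (hH : HypothesisH P E mBar cBar θ₀ R₀) {ω : Ω}
    {a b : ℝ} (hb : 0 ≤ b) (hba : b ≤ a) (ha : a ≤ 1) {e : Space d} (he : ‖e‖ = 1)
    {g g' Λ Λ' η : ℝ} (hη : 0 ≤ η) (hΛ0 : 0 ≤ Λ) (hlb : LowerBound E ω e a b g Λ')
    (hg : g' + 2 * ((Λ + cBar + 1) * η) ≤ g) (hΛ : Λ + (Λ + cBar + 1) * η ≤ Λ') (Λ₀ : ℝ)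
    {ε : ℝ} (hε : 0 < ε) :
    ∀ᶠ t : ℝ in atTop, ∀ e' : Space d, ‖e' - e‖ ≤ η → ∀ y x : Space d, ‖y‖ ≤ Λ₀ * t →
      ‖x‖ ≤ Λ * t → inner ℝ x e' ≤ g' * t →
        1 - ε ≤ E.sol (E.shift y ω) (halfDatum a b e') t x := by
  filter_upwards [hlb (Λ₀ + (Λ + cBar + 1) * η) (ε / 2) (half_pos hε),
    hH.eventually_error_le (half_pos hε), eventually_gt_atTop 0] with t ht herr ht0 e' he' y x hy hx hxe
  have hc := hH.cBar_pos
  set s := (Λ + cBar + 1) * η with hs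
  have hs0 : 0 ≤ s := by positivity
  have hst : ‖(s * t) • e‖ = s * t := by
    rw [norm_smul, he, mul_one, Real.norm_of_nonneg]
    positivity
  have hdiff : ∀ z : Space d, |inner ℝ z e' - inner ℝ z e| ≤ ‖z‖ * η := fun z => by
    rw [← inner_sub_right]
    exact (abs_real_inner_le_norm _ _).trans (by gcongr)
  have hcmp := hH.sol_halfDatum_le ω hb hba ha (e₁ := e) (e₂ := e') (y₁ := y - (s * t) • e)
    (y₂ := y) (X := x + y) ht0 ?_
  · rw [add_sub_cancel_right] at hcmp
    have heq : x + y - (y - (s * t) • e) = x + (s * t) • e := by abel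
    rw [heq] at hcmp
    have h1 := ht (y - (s * t) • e) (x + (s * t) • e) ?_ ?_ ?_
    · linarith
    · have := norm_sub_le y ((s * t) • e)
      rw [hst] at this
      nlinarith
    · have := norm_add_le x ((s * t) • e)
      rw [hst] at this
      nlinarith
    · rw [inner_add_left, inner_smul_left, inner_self_of_unit he]
      simp only [conj_trivial, mul_one]
      have h2 := (abs_le.1 (hdiff x)).1
      have h3 : ‖x‖ * η ≤ s * t := by
        calc ‖x‖ * η ≤ (Λ * t) * η := by gcongr
          _ ≤ ((Λ + cBar + 1) * t) * η := by gcongr; linarith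
          _ = s * t := by rw [hs]; ring
      nlinarith
  · intro z hz hz'
    have heq : z - (y - (s * t) • e) = (z - y) + (s * t) • e := by abel
    rw [heq, inner_add_left, inner_smul_left, inner_self_of_unit he] at hz'
    simp only [conj_trivial, mul_one] at hz'
    have h2 := (abs_le.1 (hdiff (z - y))).2
    have h3 : ‖z - y‖ ≤ (Λ + cBar + 1) * t := by
      have : z - y = (z - (x + y)) + x := by abel
      rw [this]
      refine (norm_add_le _ _).trans ?_
      nlinarith
    have h4 : ‖z - y‖ * η ≤ s * t := by
      calc ‖z - y‖ * η ≤ ((Λ + cBar + 1) * t) * η := by gcongr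
        _ = s * t := by rw [hs]; ring
    linarith

end

section

variable {d : ℕ} {Ω : Type*} [MeasurableSpace Ω] {P : Measure Ω} {E : RandomPDE d Ω}
  {mBar cBar θ₀ R₀ : ℝ}

/-! ### Front speeds in a single direction -/

/-- The compact sets `{κ ≤ x·e, ‖x‖ ≤ M}` exhaust the open half-space `{x·e > 0}`. -/
def halfBall (e : Space d) (κ M : ℝ) : Set (Space d) := {x | κ ≤ inner ℝ x e ∧ ‖x‖ ≤ M}

theorem isCompact_halfBall (e : Space d) (κ M : ℝ) : IsCompact (halfBall e κ M) := by
  refine (isCompact_closedBall (0 : Space d) M).of_isClosed_subset ?_ fun x hx => ?_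
  · have h₁ : IsClosed {x : Space d | κ ≤ inner ℝ x e} := isClosed_le (by fun_prop) (by fun_prop)
    have h₂ : IsClosed {x : Space d | ‖x‖ ≤ M} := isClosed_le (by fun_prop) (by fun_prop)
    exact h₁.inter h₂
  · simpa using hx.2

theorem halfBall_subset (e : Space d) {κ : ℝ} (hκ : 0 < κ) (M : ℝ) :
    halfBall e κ M ⊆ {x | 0 < inner ℝ x e} := fun _ hx => hκ.trans_le hx.1

theorem exists_subset_halfBall {e : Space d} {K : Set (Space d)} (hK : IsCompact K)
    (hKe : K ⊆ {x | 0 < inner ℝ x e}) : ∃ κ M : ℝ, 0 < κ ∧ 0 < M ∧ K ⊆ halfBall e κ M := by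
  obtain ⟨M, hM0, hM⟩ := hK.isBounded.exists_pos_norm_le
  rcases K.eq_empty_or_nonempty with rfl | hne
  · exact ⟨1, 1, one_pos, one_pos, empty_subset _⟩
  obtain ⟨x₀, hx₀, hmin⟩ := hK.exists_isMinOn hne
    (f := fun x : Space d => inner ℝ x e) (by fun_prop)
  exact ⟨inner ℝ x₀ e, M, hKe hx₀, hM0, fun x hx => ⟨hmin hx, hM x hx⟩⟩

/-- The front from the datum `θ₀ χ_{x·e<0}` has speed `c`, uniformly over translations of the
environment of size `O(t)`. -/
def IsUniformFrontSpeed (E : RandomPDE d Ω) (θ₀ : ℝ) (ω : Ω) (e : Space d) (c : ℝ) : Prop :=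
  ∀ κ Λ : ℝ, 0 < κ → UpperBound E ω e θ₀ 0 (c + κ) Λ 0 ∧ LowerBound E ω e θ₀ 0 (c - κ) Λ

omit [MeasurableSpace Ω] in
/-- The values on the dilated compact sets of the definition of front speeds, in the unscaled
variable. -/
theorem eventually_le_of_halfBall {f : ℝ → Space d → ℝ} {e : Space d} (he : ‖e‖ = 1)
    {c κ Λ v : ℝ}
    (h : ∀ᶠ t : ℝ in atTop, ∀ x ∈ halfBall e κ (Λ + |c|), f t (t • (c • e + x)) ≤ v) :
    ∀ᶠ t : ℝ in atTop, ∀ x : Space d, ‖x‖ ≤ Λ * t → (c + κ) * t ≤ inner ℝ x e → f t x ≤ v := by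
  filter_upwards [h, eventually_gt_atTop 0] with t ht ht0 x hx hxe
  have heq : t • (c • e + (t⁻¹ • x - c • e)) = x := by
    rw [add_sub_cancel, smul_smul, mul_inv_cancel₀ ht0.ne', one_smul]
  rw [← heq]
  refine ht _ ⟨?_, ?_⟩
  · rw [inner_sub_left, inner_smul_left, inner_smul_left, inner_self_of_unit he]
    simp only [conj_trivial, mul_one]
    have : t⁻¹ * ((c + κ) * t) ≤ t⁻¹ * inner ℝ x e := by gcongr
    have h2 : t⁻¹ * ((c + κ) * t) = c + κ := by field_simp
    linarith
  · refine (norm_sub_le _ _).trans ?_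
    rw [norm_smul, norm_smul, he, mul_one, Real.norm_eq_abs, Real.norm_eq_abs,
      abs_of_pos (inv_pos.2 ht0)]
    have : t⁻¹ * ‖x‖ ≤ t⁻¹ * (Λ * t) := by gcongr
    have h2 : t⁻¹ * (Λ * t) = Λ := by field_simp
    linarith

omit [MeasurableSpace Ω] in
theorem eventually_ge_of_halfBall {f : ℝ → Space d → ℝ} {e : Space d} (he : ‖e‖ = 1)
    {c κ Λ v : ℝ}
    (h : ∀ᶠ t : ℝ in atTop, ∀ x ∈ halfBall e κ (Λ + |c|), v ≤ f t (t • (c • e - x))) :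
    ∀ᶠ t : ℝ in atTop, ∀ x : Space d, ‖x‖ ≤ Λ * t → inner ℝ x e ≤ (c - κ) * t → v ≤ f t x := by
  filter_upwards [h, eventually_gt_atTop 0] with t ht ht0 x hx hxe
  have heq : t • (c • e - (c • e - t⁻¹ • x)) = x := by
    rw [sub_sub_cancel, smul_smul, mul_inv_cancel₀ ht0.ne', one_smul]
  rw [← heq]
  refine ht _ ⟨?_, ?_⟩
  · rw [inner_sub_left, inner_smul_left, inner_smul_left, inner_self_of_unit he]
    simp only [conj_trivial, mul_one]
    have : t⁻¹ * inner ℝ x e ≤ t⁻¹ * ((c - κ) * t) := by gcongr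
    have h2 : t⁻¹ * ((c - κ) * t) = c - κ := by field_simp
    linarith
  · refine (norm_sub_le _ _).trans ?_
    rw [norm_smul, norm_smul, he, mul_one, Real.norm_eq_abs, Real.norm_eq_abs,
      abs_of_pos (inv_pos.2 ht0)]
    have : t⁻¹ * ‖x‖ ≤ t⁻¹ * (Λ * t) := by gcongr
    have h2 : t⁻¹ * (Λ * t) = Λ := by field_simp
    linarith

/-- A deterministic front speed is, for a.e. environment, uniform over translations of size
`O(t)`. -/
theorem HypothesisH.ae_isUniformFrontSpeed [IsProbabilityMeasure P]
    (hH : HypothesisH P E mBar cBar θ₀ R₀) {e : Space d} (he : ‖e‖ = 1) {c : ℝ}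
    (hc : E.IsDeterministicFrontSpeed P θ₀ e c) :
    ∀ᵐ ω ∂P, IsUniformFrontSpeed E θ₀ ω e c := by
  have hθ := hH.theta_pos.le
  have hθ1 := hH.theta_lt_one.le
  have hup : ∀ᵐ ω ∂P, ∀ k : ℕ, UpperBound E ω e θ₀ 0 (c + 1 / ((k : ℝ) + 1)) k 0 := by
    refine ae_all_iff.2 fun k => ?_
    have hk : (0 : ℝ) < 1 / ((k : ℝ) + 1) := by positivity
    refine hH.ae_upperBound he le_rfl hθ hθ1 (g := c + 1 / ((k : ℝ) + 1) / 2)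
      (Λ' := k + 1) (by linarith) (by linarith) ?_
    filter_upwards [hc] with ω hω ε hε
    rw [zero_add, ← frontDatum_eq]
    exact eventually_le_of_halfBall he
      ((hω _ (isCompact_halfBall e _ _) (halfBall_subset e (by positivity) _)).2 ε hε)
  have hlo : ∀ᵐ ω ∂P, ∀ k : ℕ, LowerBound E ω e θ₀ 0 (c - 1 / ((k : ℝ) + 1)) k := by
    refine ae_all_iff.2 fun k => ?_
    have hk : (0 : ℝ) < 1 / ((k : ℝ) + 1) := by positivity
    refine hH.ae_lowerBound he le_rfl hθ hθ1 (g := c - 1 / ((k : ℝ) + 1) / 2)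
      (Λ' := k + 1) (by linarith) (by linarith) ?_
    filter_upwards [hc] with ω hω ε hε
    rw [← frontDatum_eq]
    exact eventually_ge_of_halfBall he
      ((hω _ (isCompact_halfBall e _ _) (halfBall_subset e (by positivity) _)).1 ε hε)
  filter_upwards [hup, hlo] with ω h1 h2 κ Λ hκ
  obtain ⟨k₁, hk₁⟩ := exists_nat_ge Λ
  obtain ⟨k₂, hk₂⟩ := exists_nat_one_div_lt hκ
  have hk1 : Λ ≤ (max k₁ k₂ : ℕ) := hk₁.trans (by exact_mod_cast le_max_left _ _)
  have hk2 : 1 / (((max k₁ k₂ : ℕ) : ℝ) + 1) ≤ κ := by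
    refine le_trans ?_ hk₂.le
    have : (k₂ : ℝ) ≤ (max k₁ k₂ : ℕ) := by exact_mod_cast le_max_right _ _
    gcongr
  exact ⟨(h1 (max k₁ k₂)).mono (by linarith) hk1 le_rfl, (h2 (max k₁ k₂)).mono (by linarith) hk1⟩

/-- Fronts do not propagate faster than `cBar`: ahead of the front, the datum agrees with `0` on a
ball that is large compared with `cBar t`. -/
theorem HypothesisH.frontSpeed_le (hH : HypothesisH P E mBar cBar θ₀ R₀) {ω : Ω} {e : Space d}
    (he : ‖e‖ = 1) {c : ℝ} (hc : E.IsFrontSpeed θ₀ ω e c) : c ≤ cBar := by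
  by_contra! hlt
  have hθ := hH.theta_pos.le
  have hcB := hH.cBar_pos
  set κ := (c - cBar) / 2 with hκ
  have hκ0 : 0 < κ := by rw [hκ]; linarith
  have h1 := (hc {κ • e} isCompact_singleton (by
    simpa [inner_smul_left, he] using hκ0)).1 (1 / 4) (by norm_num)
  have herr : Tendsto (fun t : ℝ => cBar * Real.exp (-(mBar * κ) * t)) atTop (𝓝 0) := by
    have := (Real.tendsto_exp_atBot.comp (tendsto_id.const_mul_atTop_of_neg
      (r := -(mBar * κ)) (by simpa using mul_pos hH.mBar_pos hκ0))).const_mul cBar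
    simpa using this
  obtain ⟨t, ht1, ht2, ht0⟩ := (h1.and ((herr.eventually_le_const
    (show (0 : ℝ) < 1 / 4 by norm_num)).and (eventually_gt_atTop 0))).exists
  have h2 := ht1 _ rfl
  rw [frontDatum_eq, ← sub_smul, smul_smul] at h2
  set X := (t * (c - κ)) • e with hX
  obtain ⟨z, hz⟩ := hH.exists_solution ω _ (admissible_const (d := d) le_rfl zero_le_one)
  have hz0 := hH.sol_zero ω z hz
  have hadm := admissible_halfDatum (a := θ₀) le_rfl hθ hH.theta_lt_one.le e
  have h3 := hH.localization ω _ _ _ _ (hH.isSolution_sol ω hadm) hz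
    (fun t ht x => hH.sol_mem_Icc ω hadm ht x) (fun t ht x => by rw [hz0 t ht x]; simp)
    (t * (c - κ)) (mul_pos ht0 (by rw [hκ]; linarith)) X (fun x hx => ?_) t ht0
  · rw [hz0 t ht0 X] at h3
    have heq : -mBar * (t * (c - κ) - cBar * t) = -(mBar * κ) * t := by
      have : c - κ - cBar = κ := by rw [hκ]; ring
      linear_combination (-mBar * t) * this
    rw [heq] at h3
    linarith
  · refine (halfDatum_of_nonneg ?_).le
    rw [mem_ball_iff_norm] at hx
    have h4 := abs_le.1 (inner_le_norm_of_unit he (x - X))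
    rw [inner_sub_left, hX, inner_smul_left, inner_self_of_unit he] at h4
    simp only [conj_trivial, mul_one] at h4
    rw [← hX] at h4
    linarith [h4.1]

/-- In a fixed time `τ`, every front advances by at least a unit distance at the level `θ₀`, since
each point of the strip is at bounded distance from a ball of radius `R₀` in the half-space. -/
theorem HypothesisH.exists_advance_time (hH : HypothesisH P E mBar cBar θ₀ R₀) :
    ∃ τ : ℝ, 0 < τ ∧ ∀ ω, ∀ e : Space d, ‖e‖ = 1 → ∀ x : Space d, inner ℝ x e < 1 →
      θ₀ ≤ E.sol ω (halfDatum θ₀ 0 e) τ x := by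
  have hθ := hH.theta_pos.le
  have hθ1 := hH.theta_lt_one
  have hR := hH.radius_pos
  have h := hH.spreading _ (isCompact_closedBall 0 (R₀ + 1)) (1 - θ₀) (by linarith)
  obtain ⟨τ, hτ, hτ0⟩ := (h.and (eventually_gt_atTop 0)).exists
  refine ⟨τ, hτ0, fun ω e he x hx => ?_⟩
  have hn : ‖(R₀ + 1) • e‖ = R₀ + 1 := by
    rw [norm_smul, he, mul_one, Real.norm_of_nonneg]
    positivity
  have h1 := hτ (E.shift (x - (R₀ + 1) • e) ω) ((R₀ + 1) • e) (by simp [hn])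
  have hball : Admissible (ballDatum θ₀ R₀ : Space d → ℝ) := by
    simpa using admissible_ballDatum_translate hθ hθ1.le R₀ (0 : Space d)
  have h2 := hH.sol_shift_le_sol_shift ω hball (admissible_halfDatum le_rfl hθ hθ1.le e)
    (y := x - (R₀ + 1) • e) (y' := 0) (fun z => ?_) hτ0 x
  · rw [sub_sub_cancel, hH.shift_zero, sub_zero] at h2
    linarith
  · rw [sub_zero]
    by_cases hz : z - (x - (R₀ + 1) • e) ∈ Metric.ball (0 : Space d) R₀
    · rw [halfDatum_of_neg]
      · exact (indicator_of_mem hz _).le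
      · have h3 := (abs_le.1 (inner_le_norm_of_unit he (z - (x - (R₀ + 1) • e)))).2
        rw [mem_ball_zero_iff] at hz
        rw [inner_sub_left, inner_sub_left, inner_smul_left, inner_self_of_unit he] at h3
        simp only [conj_trivial, mul_one] at h3
        linarith
    · rw [ballDatum, indicator_of_notMem hz]
      rcases lt_or_ge (inner ℝ z e) 0 with h4 | h4
      · rwa [halfDatum_of_neg h4]
      · rw [halfDatum_of_nonneg h4]

theorem HypothesisH.advance_iterate (hH : HypothesisH P E mBar cBar θ₀ R₀) {τ : ℝ} (hτ0 : 0 < τ)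
    {e : Space d} (he : ‖e‖ = 1)
    (hτ : ∀ ω, ∀ x : Space d, inner ℝ x e < 1 → θ₀ ≤ E.sol ω (halfDatum θ₀ 0 e) τ x) (n : ℕ) :
    ∀ ω, ∀ x : Space d, inner ℝ x e < n + 1 →
      θ₀ ≤ E.sol ω (halfDatum θ₀ 0 e) ((n + 1) * τ) x := by
  have hadm := admissible_halfDatum le_rfl hH.theta_pos.le hH.theta_lt_one.le e
  induction n with
  | zero => simpa using hτ
  | succ n ih =>
    intro ω x hx
    have h1 := hH.isSolution_shift ω hadm e
    have h2 := hH.isSolution_shift_time ω hadm 0 hτ0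
    simp only [hH.shift_zero, sub_zero] at h2
    have h3 := hH.comparison ω _ _ _ _ h1 h2 (fun z => ?_) ((n + 1) * τ) (by positivity) x
    · have h4 := ih (E.shift e ω) (x - e) (by
        rw [inner_sub_left, inner_self_of_unit he]
        push_cast at hx
        linarith)
      have heq : ((n : ℝ) + 1) * τ + τ = ((n + 1 : ℕ) + 1) * τ := by push_cast; ring
      rw [heq] at h3
      exact h4.trans h3
    · rcases lt_or_ge (inner ℝ (z - e) e) 0 with hz | hz
      · rw [halfDatum_of_neg hz]
        refine hτ ω z ?_
        rw [inner_sub_left, inner_self_of_unit he] at hz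
        linarith
      · rw [halfDatum_of_nonneg hz]
        exact (hH.sol_mem_Icc ω hadm hτ0 z).1

/-- Front speeds are positive, since a front advances by `n` in time `n τ`. -/
theorem HypothesisH.frontSpeed_pos (hH : HypothesisH P E mBar cBar θ₀ R₀) {ω : Ω} {e : Space d}
    (he : ‖e‖ = 1) {c : ℝ} (hc : E.IsFrontSpeed θ₀ ω e c) : 0 < c := by
  by_contra! hle
  obtain ⟨τ, hτ0, hτ⟩ := hH.exists_advance_time
  set s := 1 / (2 * τ) with hs
  have hs0 : 0 < s := by positivity
  have h1 := (hc {(s - c) • e} isCompact_singleton (by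
    simp only [singleton_subset_iff, mem_ofPred_eq, inner_smul_left, inner_self_of_unit he,
      conj_trivial, mul_one]
    linarith)).2 (θ₀ / 2) (half_pos hH.theta_pos)
  have hlim : Tendsto (fun n : ℕ => ((n : ℝ) + 1) * τ) atTop atTop :=
    (tendsto_atTop_add_const_right _ _ tendsto_natCast_atTop_atTop).atTop_mul_const hτ0
  obtain ⟨n, hn⟩ := (hlim.eventually h1).exists
  have h2 := hn _ rfl
  rw [← add_smul, add_sub_cancel, smul_smul, frontDatum_eq] at h2
  have h3 := hH.advance_iterate hτ0 he (fun ω x hx => hτ ω e he x hx) n ω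
    ((((n : ℝ) + 1) * τ * s) • e) (by
      rw [inner_smul_left, inner_self_of_unit he]
      simp only [conj_trivial, mul_one]
      have : ((n : ℝ) + 1) * τ * s = (n + 1) / 2 := by
        rw [hs]
        field_simp
      rw [this]
      linarith [(Nat.cast_nonneg n : (0 : ℝ) ≤ n)])
  linarith [hH.theta_pos]

/-- The quantitative comparison of front speeds in two directions for one environment. -/
theorem HypothesisH.frontSpeed_le_add (hH : HypothesisH P E mBar cBar θ₀ R₀) {ω : Ω}
    {e e' : Space d} (he : ‖e‖ = 1) (he' : ‖e'‖ = 1) {c c' : ℝ} (hc0 : 0 ≤ c)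
    (hc : IsUniformFrontSpeed E θ₀ ω e c) (hc' : E.IsFrontSpeed θ₀ ω e' c') :
    c' ≤ c + 2 * (2 * cBar + 1) * ‖e' - e‖ := by
  by_contra! hlt
  have hcB := hH.cBar_pos
  have hcle := hH.frontSpeed_le he' hc'
  set η := ‖e' - e‖ with hη
  have hη0 : 0 ≤ η := norm_nonneg _
  set κ := (c' - (c + 2 * (2 * cBar + 1) * η)) / 3 with hκ
  have hκ0 : 0 < κ := by rw [hκ]; linarith
  have hc'eq : c' = c + 2 * (2 * cBar + 1) * η + 3 * κ := by rw [hκ]; ring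
  have hη1 : 0 ≤ 2 * (2 * cBar + 1) * η := by positivity
  have h1 := hH.upperBound_change_direction le_rfl hH.theta_pos.le hH.theta_lt_one.le he hη0
    hcB.le ((hc κ (cBar + (cBar + cBar + 1) * η) hκ0).1)
    (g' := c' - κ) (by rw [hc'eq]; linarith) le_rfl 0 (ε := 1 / 4) (by norm_num)
  have h2 := (hc' {κ • e'} isCompact_singleton (by
    simpa [inner_smul_left, he'] using hκ0)).1 (1 / 4) (by norm_num)
  obtain ⟨t, ht1, ht2, ht0⟩ := (h1.and (h2.and (eventually_gt_atTop 0))).exists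
  have h3 := ht2 _ rfl
  rw [frontDatum_eq, ← sub_smul, smul_smul] at h3
  have h4 := ht1 e' le_rfl 0 ((t * (c' - κ)) • e') (by simp) ?_ ?_
  · rw [hH.shift_zero] at h4
    linarith
  · rw [norm_smul, he', mul_one, Real.norm_of_nonneg (mul_nonneg ht0.le (by linarith)), mul_comm]
    gcongr
    linarith
  · rw [inner_smul_left, inner_self_of_unit he']
    simp [mul_comm]

omit [MeasurableSpace Ω] in
theorem frontSpeed_le_frontSpeed {ω : Ω} {e : Space d} (he : ‖e‖ = 1) {c c' : ℝ}
    (hc : E.IsFrontSpeed θ₀ ω e c) (hc' : E.IsFrontSpeed θ₀ ω e c') : c ≤ c' := by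
  by_contra! hlt
  set κ := (c - c') / 2 with hκ
  have hκ0 : 0 < κ := by rw [hκ]; linarith
  have hmem : ({κ • e} : Set (Space d)) ⊆ {x | 0 < inner ℝ x e} := by
    simpa [inner_smul_left, he] using hκ0
  obtain ⟨t, h1, h2⟩ := (((hc _ isCompact_singleton hmem).1 (1 / 4) (by norm_num)).and
    ((hc' _ isCompact_singleton hmem).2 (1 / 4) (by norm_num))).exists
  have h3 := h1 _ rfl
  have h4 := h2 _ rfl
  rw [← sub_smul] at h3
  rw [← add_smul, show c' + κ = c - κ by rw [hκ]; ring] at h4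
  linarith

omit [MeasurableSpace Ω] in
theorem frontSpeed_unique {ω : Ω} {e : Space d} (he : ‖e‖ = 1) {c c' : ℝ}
    (hc : E.IsFrontSpeed θ₀ ω e c) (hc' : E.IsFrontSpeed θ₀ ω e c') : c = c' :=
  le_antisymm (frontSpeed_le_frontSpeed he hc hc') (frontSpeed_le_frontSpeed he hc' hc)

end

section

variable {d : ℕ} {Ω : Type*} [MeasurableSpace Ω] {P : Measure Ω} {E : RandomPDE d Ω}
  {mBar cBar θ₀ R₀ : ℝ}

/-! ### Uniformity over directions -/

theorem exists_finset_net {T : Set (Space d)} (hT : ∀ e ∈ T, ‖e‖ = 1) {η : ℝ} (hη : 0 < η) :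
    ∃ F : Finset (Space d), ↑F ⊆ T ∧ ∀ e ∈ closure T, ∃ e₀ ∈ F, ‖e - e₀‖ ≤ η := by
  have hb : TotallyBounded T :=
    (isCompact_sphere (0 : Space d) 1).totallyBounded.subset fun e he => by simpa using hT e he
  obtain ⟨s, hsT, hsf, hcov⟩ := Metric.finite_approx_of_totallyBounded hb η hη
  have hcl : IsClosed (⋃ e₀ ∈ s, Metric.closedBall e₀ η) :=
    hsf.isClosed_biUnion fun _ _ => Metric.isClosed_closedBall
  have hsub : closure T ⊆ ⋃ e₀ ∈ s, Metric.closedBall e₀ η :=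
    closure_minimal (hcov.trans (iUnion₂_mono fun _ _ => Metric.ball_subset_closedBall)) hcl
  refine ⟨hsf.toFinset, by simpa using hsT, fun e he => ?_⟩
  obtain ⟨e₀, he₀, hd⟩ := mem_iUnion₂.1 (hsub he)
  exact ⟨e₀, by simpa using he₀, by simpa [dist_eq_norm] using hd⟩

/-- The mesh of a net of directions on which it suffices to control fronts. -/
def meshSize (L cBar κ Λ : ℝ) : ℝ := min (κ / 2) 1 / (L + 2 * (Λ + cBar + 1))

theorem meshSize_spec {L cBar κ Λ : ℝ} (hL : 0 ≤ L) (hc : 0 < cBar) (hκ : 0 < κ) (hΛ : 0 ≤ Λ) :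
    0 < meshSize L cBar κ Λ ∧
      L * meshSize L cBar κ Λ + 2 * ((Λ + cBar + 1) * meshSize L cBar κ Λ) ≤ κ / 2 ∧
      (Λ + cBar + 1) * meshSize L cBar κ Λ ≤ 1 := by
  have hden : 0 < L + 2 * (Λ + cBar + 1) := by positivity
  have hmin : 0 < min (κ / 2) 1 := lt_min (by positivity) one_pos
  have hpos : 0 < meshSize L cBar κ Λ := div_pos hmin hden
  have heq : (L + 2 * (Λ + cBar + 1)) * meshSize L cBar κ Λ = min (κ / 2) 1 :=
    mul_div_cancel₀ _ hden.ne'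
  refine ⟨hpos, ?_, ?_⟩
  · linarith [min_le_left (κ / 2) 1]
  · have h1 : 0 ≤ L * meshSize L cBar κ Λ := by positivity
    have h2 : 0 ≤ (Λ + cBar + 1) * meshSize L cBar κ Λ := by positivity
    linarith [min_le_right (κ / 2) 1]

/-- Upper bounds in the directions of a finite net, with speeds that are Lipschitz in the direction,
entail bounds that are uniform over all directions close to the net. -/
theorem HypothesisH.upperBound_of_net (hH : HypothesisH P E mBar cBar θ₀ R₀) {ω : Ω}
    {a b : ℝ} (hb : 0 ≤ b) (hba : b ≤ a) (ha : a ≤ 1) {c : Space d → ℝ} {L : NNReal}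
    (hL : LipschitzWith L c) {κ Λ v : ℝ} (hκ : 0 < κ) (hΛ : 0 ≤ Λ) {F : Finset (Space d)}
    (hF : ∀ e ∈ F, ‖e‖ = 1)
    (h : ∀ e ∈ F, UpperBound E ω e a b (c e + κ / 2) (Λ + 1) v) (Λ₀ : ℝ) {ε : ℝ} (hε : 0 < ε) :
    ∀ᶠ t : ℝ in atTop, ∀ e : Space d, (∃ e₀ ∈ F, ‖e - e₀‖ ≤ meshSize L cBar κ Λ) →
      ∀ y x : Space d, ‖y‖ ≤ Λ₀ * t → ‖x‖ ≤ Λ * t → (c e + κ) * t ≤ inner ℝ x e →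
        E.sol (E.shift y ω) (halfDatum a b e) t x ≤ v + ε := by
  obtain ⟨hη, h1, h2⟩ := meshSize_spec L.coe_nonneg hH.cBar_pos hκ hΛ
  set η := meshSize L cBar κ Λ
  have hall := (eventually_all_finset F).2 fun e₀ he₀ =>
    hH.upperBound_change_direction hb hba ha (hF e₀ he₀) hη.le hΛ (h e₀ he₀)
      (g' := c e₀ + κ - L * η) (by linarith) (by linarith) Λ₀ hε
  filter_upwards [hall, eventually_gt_atTop 0] with t ht ht0 e ⟨e₀, he₀, hd⟩ y x hy hx hxe
  refine ht e₀ he₀ e hd y x hy hx (le_trans ?_ hxe)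
  have h3 : |c e - c e₀| ≤ L * η := (hL.norm_sub_le e e₀).trans (by gcongr)
  gcongr
  linarith [(abs_le.1 h3).1]

/-- The counterpart of `HypothesisH.upperBound_of_net` for lower bounds. -/
theorem HypothesisH.lowerBound_of_net (hH : HypothesisH P E mBar cBar θ₀ R₀) {ω : Ω}
    {a b : ℝ} (hb : 0 ≤ b) (hba : b ≤ a) (ha : a ≤ 1) {c : Space d → ℝ} {L : NNReal}
    (hL : LipschitzWith L c) {κ Λ : ℝ} (hκ : 0 < κ) (hΛ : 0 ≤ Λ) {F : Finset (Space d)}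
    (hF : ∀ e ∈ F, ‖e‖ = 1)
    (h : ∀ e ∈ F, LowerBound E ω e a b (c e - κ / 2) (Λ + 1)) (Λ₀ : ℝ) {ε : ℝ} (hε : 0 < ε) :
    ∀ᶠ t : ℝ in atTop, ∀ e : Space d, (∃ e₀ ∈ F, ‖e - e₀‖ ≤ meshSize L cBar κ Λ) →
      ∀ y x : Space d, ‖y‖ ≤ Λ₀ * t → ‖x‖ ≤ Λ * t → inner ℝ x e ≤ (c e - κ) * t →
        1 - ε ≤ E.sol (E.shift y ω) (halfDatum a b e) t x := by
  obtain ⟨hη, h1, h2⟩ := meshSize_spec L.coe_nonneg hH.cBar_pos hκ hΛ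
  set η := meshSize L cBar κ Λ
  have hall := (eventually_all_finset F).2 fun e₀ he₀ =>
    hH.lowerBound_change_direction hb hba ha (hF e₀ he₀) hη.le hΛ (h e₀ he₀)
      (g' := c e₀ - κ + L * η) (by linarith) (by linarith) Λ₀ hε
  filter_upwards [hall, eventually_gt_atTop 0] with t ht ht0 e ⟨e₀, he₀, hd⟩ y x hy hx hxe
  refine ht e₀ he₀ e hd y x hy hx (hxe.trans ?_)
  have h3 : |c e - c e₀| ≤ L * η := (hL.norm_sub_le e e₀).trans (by gcongr)
  gcongr
  linarith [(abs_le.1 h3).2]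

/-- Fronts from the data `a`, `b` satisfy an upper bound with the speeds `c e`, uniformly over the
directions `e ∈ C` and over translations of size `O(t)`. -/
def UniformUpperBound (E : RandomPDE d Ω) (ω : Ω) (C : Set (Space d)) (c : Space d → ℝ)
    (a b κ Λ v : ℝ) : Prop :=
  ∀ Λ₀ ε : ℝ, 0 < ε → ∀ᶠ t : ℝ in atTop, ∀ e ∈ C, ∀ y x : Space d, ‖y‖ ≤ Λ₀ * t →
    ‖x‖ ≤ Λ * t → (c e + κ) * t ≤ inner ℝ x e →
      E.sol (E.shift y ω) (halfDatum a b e) t x ≤ v + ε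

/-- Fronts from the data `a`, `b` satisfy a lower bound with the speeds `c e`, uniformly over the
directions `e ∈ C` and over translations of size `O(t)`. -/
def UniformLowerBound (E : RandomPDE d Ω) (ω : Ω) (C : Set (Space d)) (c : Space d → ℝ)
    (a b κ Λ : ℝ) : Prop :=
  ∀ Λ₀ ε : ℝ, 0 < ε → ∀ᶠ t : ℝ in atTop, ∀ e ∈ C, ∀ y x : Space d, ‖y‖ ≤ Λ₀ * t →
    ‖x‖ ≤ Λ * t → inner ℝ x e ≤ (c e - κ) * t →
      1 - ε ≤ E.sol (E.shift y ω) (halfDatum a b e) t x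

/-- A.e. environment has uniform front speeds in all directions of the closure of a set of
directions with deterministic front speeds. -/
theorem HypothesisH.ae_uniform_front [IsProbabilityMeasure P]
    (hH : HypothesisH P E mBar cBar θ₀ R₀) {T : Set (Space d)} (hT : ∀ e ∈ T, ‖e‖ = 1)
    {c : Space d → ℝ} {L : NNReal} (hL : LipschitzWith L c)
    (h : ∀ e ∈ T, E.IsDeterministicFrontSpeed P θ₀ e (c e)) :
    ∀ᵐ ω ∂P, ∀ κ Λ : ℝ, 0 < κ → 0 ≤ Λ →
      UniformUpperBound E ω (closure T) c θ₀ 0 κ Λ 0 ∧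
      UniformLowerBound E ω (closure T) c θ₀ 0 κ Λ := by
  have hθ := hH.theta_pos.le
  have hθ1 := hH.theta_lt_one.le
  choose F hFT hF using fun k : ℕ =>
    exists_finset_net hT (η := 1 / ((k : ℝ) + 1)) (by positivity)
  have hae : ∀ᵐ ω ∂P, ∀ k, ∀ e ∈ F k, IsUniformFrontSpeed E θ₀ ω e (c e) :=
    ae_all_iff.2 fun k => (Finset.eventually_all (F k)).2 fun e he =>
      hH.ae_isUniformFrontSpeed (hT e (hFT k he)) (h e (hFT k he))
  filter_upwards [hae] with ω hω κ Λ hκ hΛ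
  obtain ⟨k, hk⟩ := exists_nat_one_div_lt (meshSize_spec L.coe_nonneg hH.cBar_pos hκ hΛ).1
  have hnet : ∀ e ∈ closure T, ∃ e₀ ∈ F k, ‖e - e₀‖ ≤ meshSize L cBar κ Λ := fun e he => by
    obtain ⟨e₀, he₀, hd⟩ := hF k e he
    exact ⟨e₀, he₀, hd.trans hk.le⟩
  have hunit : ∀ e ∈ F k, ‖e‖ = 1 := fun e he => hT e (hFT k he)
  constructor
  · intro Λ₀ ε hε
    filter_upwards [hH.upperBound_of_net le_rfl hθ hθ1 hL hκ hΛ hunit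
      (fun e he => (hω k e he _ _ (half_pos hκ)).1) Λ₀ hε] with t ht e he
    exact ht e (hnet e he)
  · intro Λ₀ ε hε
    filter_upwards [hH.lowerBound_of_net le_rfl hθ hθ1 hL hκ hΛ hunit
      (fun e he => (hω k e he _ _ (half_pos hκ)).2) Λ₀ hε] with t ht e he
    exact ht e (hnet e he)

/-! ### Bounds for exclusive fronts -/

theorem HypothesisH.upperBound_mono_datum (hH : HypothesisH P E mBar cBar θ₀ R₀) {ω : Ω}
    {e : Space d} {α α' g Λ v : ℝ} (h0 : 0 ≤ α) (hα : α ≤ α') (h1 : α' ≤ 1)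
    (h : UpperBound E ω e 1 α' g Λ v) : UpperBound E ω e 1 α g Λ v := by
  intro Λ₀ ε hε
  filter_upwards [h Λ₀ ε hε, eventually_gt_atTop 0] with t ht ht0 y x hy hx hxe
  exact (hH.sol_le_sol _ (admissible_halfDatum h0 (hα.trans h1) le_rfl e)
    (admissible_halfDatum (h0.trans hα) h1 le_rfl e)
    (fun z => halfDatum_mono_right hα e z) ht0 x).trans (ht y x hy hx hxe)

/-- Rounding the argument up to the reciprocal of an integer turns a modulus into a modulus. -/
theorem IsModulus.round {b : ℝ → ℝ} (hb : IsModulus b) :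
    IsModulus fun α => b (1 / (⌊1 / α⌋₊ : ℝ)) := by
  have hfloor : ∀ α ∈ Ioc (0 : ℝ) 1, 1 ≤ ⌊1 / α⌋₊ := fun α hα => by
    rw [Nat.one_le_floor_iff, le_div_iff₀ hα.1]
    linarith [hα.2]
  constructor
  · intro α hα
    have h1 : (1 : ℝ) ≤ ⌊1 / α⌋₊ := by exact_mod_cast hfloor α hα
    exact hb.1 _ ⟨by positivity, by rw [div_le_one (by linarith)]; exact h1⟩
  · refine hb.2.comp ?_
    have h1 : Tendsto (fun α : ℝ => (⌊1 / α⌋₊ : ℝ)) (𝓝[>] 0) atTop := by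
      simp only [one_div]
      exact tendsto_natCast_atTop_atTop.comp
        (tendsto_nat_floor_atTop.comp tendsto_inv_nhdsGT_zero)
    have h2 := tendsto_inv_atTop_nhdsGT_zero.comp h1
    simpa [Function.comp_def] using h2

theorem le_one_div_floor {α : ℝ} (hα : α ∈ Ioc (0 : ℝ) 1) :
    α ≤ 1 / (⌊1 / α⌋₊ : ℝ) ∧ 1 / (⌊1 / α⌋₊ : ℝ) ≤ 1 := by
  have h1 : (1 : ℝ) ≤ ⌊1 / α⌋₊ := by
    have : 1 ≤ ⌊1 / α⌋₊ := by
      rw [Nat.one_le_floor_iff, le_div_iff₀ hα.1]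
      linarith [hα.2]
    exact_mod_cast this
  have h2 : (⌊1 / α⌋₊ : ℝ) ≤ 1 / α := Nat.floor_le (one_div_nonneg.2 hα.1.le)
  exact ⟨(le_one_div hα.1 (by linarith)).2 h2, (div_le_one (by linarith)).2 h1⟩

/-- Bounds on exclusive fronts in one direction, uniform over translations of size `O(t)`, for all
`α` outside a single null set: the modulus is rounded up to the reciprocals of integers, so that
only countably many `α` have to be considered. -/
theorem HypothesisH.exists_modulus_upperBound [IsProbabilityMeasure P]
    (hH : HypothesisH P E mBar cBar θ₀ R₀) {e : Space d} (he : ‖e‖ = 1) {c : ℝ}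
    (hc : E.IsDeterministicExclusiveFrontSpeed P θ₀ e c) {κ : ℝ} (hκ : 0 < κ) (Λ : ℝ) :
    ∃ b, IsModulus b ∧
      ∀ᵐ ω ∂P, ∀ α ∈ Ioc (0 : ℝ) 1, UpperBound E ω e 1 α (c + κ) Λ (b α) := by
  obtain ⟨β, hβ⟩ := hc
  set K := halfBall e (κ / 2) (Λ + 1 + |c|) with hK
  have hKc : IsCompact K := isCompact_halfBall _ _ _
  have hKe : K ⊆ {x | 0 < inner ℝ x e} := halfBall_subset e (by positivity) _
  obtain ⟨ω₀, hω₀⟩ := hβ.exists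
  refine ⟨_, (hω₀.2.1 K hKc hKe).round, ?_⟩
  have hae : ∀ᵐ ω ∂P, ∀ n : ℕ, 1 ≤ n →
      UpperBound E ω e 1 (1 / (n : ℝ)) (c + κ) Λ (β K (1 / (n : ℝ))) := by
    refine ae_all_iff.2 fun n => ?_
    by_cases hn : 1 ≤ n
    · have hn1 : (1 : ℝ) ≤ n := by exact_mod_cast hn
      have hn0 : 0 < 1 / (n : ℝ) := by positivity
      have hnle : 1 / (n : ℝ) ≤ 1 := (div_le_one (by linarith)).2 hn1
      refine (hH.ae_upperBound he hn0.le hnle le_rfl (g := c + κ / 2) (Λ' := Λ + 1)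
        (by linarith) (by linarith) ?_).mono fun ω h _ => h
      filter_upwards [hβ] with ω hω ε hε
      rw [← exclusiveDatum_eq]
      exact eventually_le_of_halfBall he (hω.2.2 K hKc hKe _ ⟨hn0, hnle⟩ ε hε)
    · exact Eventually.of_forall fun ω h => absurd h hn
  filter_upwards [hae] with ω hω α hα
  obtain ⟨h1, h2⟩ := le_one_div_floor hα
  refine hH.upperBound_mono_datum hα.1.le h1 h2 (hω _ ?_)
  rw [Nat.one_le_floor_iff, le_div_iff₀ hα.1]
  linarith [hα.2]

theorem exists_common_modulus {ι : Type*} (F : Finset ι) {b : ι → ℝ → ℝ}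
    (hb : ∀ i ∈ F, IsModulus (b i)) :
    ∃ B, IsModulus B ∧ ∀ i ∈ F, ∀ α ∈ Ioc (0 : ℝ) 1, b i α ≤ B α := by
  classical
  induction F using Finset.induction_on with
  | empty =>
    exact ⟨id, ⟨fun α hα => hα, tendsto_id.mono_left nhdsWithin_le_nhds⟩, by simp⟩
  | insert i F hi ih =>
    obtain ⟨B, hB, hle⟩ := ih fun j hj => hb j (Finset.mem_insert_of_mem hj)
    have hbi := hb i (Finset.mem_insert_self _ _)
    refine ⟨fun α => max (b i α) (B α), ⟨fun α hα => ?_, ?_⟩, fun j hj α hα => ?_⟩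
    · exact ⟨(hbi.1 α hα).1.trans_le (le_max_left _ _), max_le (hbi.1 α hα).2 (hB.1 α hα).2⟩
    · simpa using hbi.2.max hB.2
    · rcases Finset.mem_insert.1 hj with rfl | hj
      · exact le_max_left _ _
      · exact (hle j hj α hα).trans (le_max_right _ _)

/-- Exclusive fronts admit bounds that are uniform over the closure of a set of directions with
deterministic exclusive front speeds: finitely many directions determine them up to a small error
in the speed. -/
theorem HypothesisH.exists_uniform_exclusive [IsProbabilityMeasure P]
    (hH : HypothesisH P E mBar cBar θ₀ R₀) {T : Set (Space d)} (hT : ∀ e ∈ T, ‖e‖ = 1)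
    {c : Space d → ℝ} {L : NNReal} (hL : LipschitzWith L c)
    (h : ∀ e ∈ T, E.IsDeterministicExclusiveFrontSpeed P θ₀ e (c e)) {κ Λ : ℝ} (hκ : 0 < κ)
    (hΛ : 0 ≤ Λ) :
    ∃ B, IsModulus B ∧ ∀ᵐ ω ∂P, ∀ α ∈ Ioc (0 : ℝ) 1,
      UniformUpperBound E ω (closure T) c 1 α κ Λ (B α) := by
  obtain ⟨F, hFT, hF⟩ := exists_finset_net hT (meshSize_spec L.coe_nonneg hH.cBar_pos hκ hΛ).1
  choose! b hb hae using fun e (he : e ∈ F) =>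
    hH.exists_modulus_upperBound (hT e (hFT he)) (h e (hFT he)) (half_pos hκ) (Λ + 1)
  obtain ⟨B, hB, hle⟩ := exists_common_modulus F hb
  refine ⟨B, hB, ?_⟩
  filter_upwards [(Finset.eventually_all F).2 hae] with ω hω α hα Λ₀ ε hε
  filter_upwards [hH.upperBound_of_net hα.1.le hα.2 le_rfl hL hκ hΛ (fun e he => hT e (hFT he))
    (fun e he => (hω e he α hα).mono le_rfl le_rfl (hle e he α hα)) Λ₀ hε] with t ht e he
  exact ht e (hF e he)

end

section

variable {d : ℕ} {Ω : Type*} [MeasurableSpace Ω] {P : Measure Ω} {E : RandomPDE d Ω}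
  {mBar cBar θ₀ R₀ : ℝ}

/-! ### Closedness, Lipschitz continuity and uniformity of front speeds -/

omit [MeasurableSpace Ω] in
theorem UniformUpperBound.subset {ω : Ω} {C C' : Set (Space d)} {c : Space d → ℝ}
    {a b κ Λ v : ℝ} (h : UniformUpperBound E ω C c a b κ Λ v) (hC : C' ⊆ C) :
    UniformUpperBound E ω C' c a b κ Λ v := fun Λ₀ ε hε =>
  (h Λ₀ ε hε).mono fun _ ht e he => ht e (hC he)

omit [MeasurableSpace Ω] in
theorem UniformLowerBound.subset {ω : Ω} {C C' : Set (Space d)} {c : Space d → ℝ}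
    {a b κ Λ : ℝ} (h : UniformLowerBound E ω C c a b κ Λ) (hC : C' ⊆ C) :
    UniformLowerBound E ω C' c a b κ Λ := fun Λ₀ ε hε =>
  (h Λ₀ ε hε).mono fun _ ht e he => ht e (hC he)

theorem add_mem_dilated {e : Space d} (he : ‖e‖ = 1) {c κ M M' t : ℝ} (hc : |c| ≤ M')
    {x : Space d} (hx : x ∈ halfBall e κ M) (ht : 0 ≤ t) :
    ‖t • (c • e + x)‖ ≤ (M' + M) * t ∧ (c + κ) * t ≤ inner ℝ (t • (c • e + x)) e := by
  constructor
  · rw [norm_smul, Real.norm_of_nonneg ht, mul_comm]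
    gcongr
    refine (norm_add_le _ _).trans (add_le_add ?_ hx.2)
    rwa [norm_smul, he, mul_one, Real.norm_eq_abs]
  · rw [inner_smul_left, inner_add_left, inner_smul_left, inner_self_of_unit he, mul_comm]
    simp only [conj_trivial, mul_one]
    gcongr
    exact hx.1

theorem sub_mem_dilated {e : Space d} (he : ‖e‖ = 1) {c κ M M' t : ℝ} (hc : |c| ≤ M')
    {x : Space d} (hx : x ∈ halfBall e κ M) (ht : 0 ≤ t) :
    ‖t • (c • e - x)‖ ≤ (M' + M) * t ∧ inner ℝ (t • (c • e - x)) e ≤ (c - κ) * t := by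
  constructor
  · rw [norm_smul, Real.norm_of_nonneg ht, mul_comm]
    gcongr
    refine (norm_sub_le _ _).trans (add_le_add ?_ hx.2)
    rwa [norm_smul, he, mul_one, Real.norm_eq_abs]
  · rw [inner_smul_left, inner_sub_left, inner_smul_left, inner_self_of_unit he, mul_comm]
    simp only [conj_trivial, mul_one]
    gcongr
    exact hx.1

omit [MeasurableSpace Ω] in
/-- Uniform upper bounds, in the dilated variables of the definition of front speeds. -/
theorem UniformUpperBound.dilated {ω : Ω} {C : Set (Space d)} {c : Space d → ℝ}
    {a b κ M M' v : ℝ} (h : UniformUpperBound E ω C c a b κ (M' + M) v)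
    (hC : ∀ e ∈ C, ‖e‖ = 1) (hc : ∀ e ∈ C, |c e| ≤ M') (Λ₀ : ℝ) {ε : ℝ} (hε : 0 < ε) :
    ∀ᶠ t : ℝ in atTop, ∀ e ∈ C, ∀ y : Space d, ‖y‖ ≤ Λ₀ * t → ∀ x ∈ halfBall e κ M,
      E.sol (E.shift y ω) (halfDatum a b e) t (t • (c e • e + x)) ≤ v + ε := by
  filter_upwards [h Λ₀ ε hε, eventually_gt_atTop 0] with t ht ht0 e he y hy x hx
  obtain ⟨h1, h2⟩ := add_mem_dilated (hC e he) (hc e he) hx ht0.le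
  exact ht e he y _ hy h1 h2

omit [MeasurableSpace Ω] in
theorem UniformLowerBound.dilated {ω : Ω} {C : Set (Space d)} {c : Space d → ℝ}
    {a b κ M M' : ℝ} (h : UniformLowerBound E ω C c a b κ (M' + M))
    (hC : ∀ e ∈ C, ‖e‖ = 1) (hc : ∀ e ∈ C, |c e| ≤ M') (Λ₀ : ℝ) {ε : ℝ} (hε : 0 < ε) :
    ∀ᶠ t : ℝ in atTop, ∀ e ∈ C, ∀ y : Space d, ‖y‖ ≤ Λ₀ * t → ∀ x ∈ halfBall e κ M,
      1 - ε ≤ E.sol (E.shift y ω) (halfDatum a b e) t (t • (c e • e - x)) := by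
  filter_upwards [h Λ₀ ε hε, eventually_gt_atTop 0] with t ht ht0 e he y hy x hx
  obtain ⟨h1, h2⟩ := sub_mem_dilated (hC e he) (hc e he) hx ht0.le
  exact ht e he y _ hy h1 h2

theorem HypothesisH.isFrontSpeed_of_uniform (hH : HypothesisH P E mBar cBar θ₀ R₀) {ω : Ω}
    {C : Set (Space d)} {c : Space d → ℝ}
    (h : ∀ κ Λ : ℝ, 0 < κ → 0 ≤ Λ →
      UniformUpperBound E ω C c θ₀ 0 κ Λ 0 ∧ UniformLowerBound E ω C c θ₀ 0 κ Λ)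
    {e : Space d} (he : ‖e‖ = 1) (heC : e ∈ C) : E.IsFrontSpeed θ₀ ω e (c e) := by
  intro K hK hKe
  obtain ⟨κ, M, hκ, hM, hsub⟩ := exists_subset_halfBall hK hKe
  obtain ⟨h1, h2⟩ := h κ (|c e| + M) hκ (by positivity)
  have hC : ∀ e' ∈ ({e} : Set (Space d)), ‖e'‖ = 1 := by simpa using he
  have hc : ∀ e' ∈ ({e} : Set (Space d)), |c e'| ≤ |c e| := by simp
  have hs : ({e} : Set (Space d)) ⊆ C := by simpa using heC
  rw [frontDatum_eq]
  constructor
  · intro ε hε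
    filter_upwards [(h2.subset hs).dilated hC hc 0 hε] with t ht x hx
    simpa [hH.shift_zero] using ht e rfl 0 (by simp) x (hsub hx)
  · intro ε hε
    filter_upwards [(h1.subset hs).dilated hC hc 0 hε] with t ht x hx
    simpa [hH.shift_zero] using ht e rfl 0 (by simp) x (hsub hx)

theorem HypothesisH.lipschitzOnWith_frontSpeed [IsProbabilityMeasure P]
    (hH : HypothesisH P E mBar cBar θ₀ R₀) {T : Set (Space d)} (hT : ∀ e ∈ T, ‖e‖ = 1)
    {c : Space d → ℝ} (h : ∀ e ∈ T, E.IsDeterministicFrontSpeed P θ₀ e (c e)) :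
    LipschitzOnWith (2 * (2 * cBar + 1)).toNNReal c T := by
  have hcB := hH.cBar_pos
  have key : ∀ e ∈ T, ∀ e' ∈ T, c e' ≤ c e + 2 * (2 * cBar + 1) * ‖e' - e‖ := by
    intro e he e' he'
    obtain ⟨ω, h1, h2, h3⟩ := ((h e he).and ((h e' he').and
      (hH.ae_isUniformFrontSpeed (hT e he) (h e he)))).exists
    exact hH.frontSpeed_le_add (hT e he) (hT e' he') (hH.frontSpeed_pos (hT e he) h1).le h3 h2
  refine LipschitzOnWith.of_dist_le_mul fun e he e' he' => ?_
  rw [Real.coe_toNNReal _ (by positivity), Real.dist_eq, dist_eq_norm, abs_le]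
  have h1 := key e he e' he'
  have h2 := key e' he' e he
  rw [norm_sub_rev] at h1
  constructor <;> linarith

/-- The index of a set in the exhaustion of the half-space `{x·e > 0}` by half-balls. It does not
change under a simultaneous rotation of the set and the direction, so that bounds that depend on
the set through its index are consistent under rotations. -/
def halfBallIndex (e : Space d) (K : Set (Space d)) : ℕ :=
  sInf {j : ℕ | K ⊆ halfBall e (1 / ((j : ℝ) + 1)) j}

theorem subset_halfBall_index {e : Space d} {K : Set (Space d)} (hK : IsCompact K)
    (hKe : K ⊆ {x | 0 < inner ℝ x e}) :
    K ⊆ halfBall e (1 / ((halfBallIndex e K : ℝ) + 1)) (halfBallIndex e K) := by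
  obtain ⟨κ, M, hκ, hM, hsub⟩ := exists_subset_halfBall hK hKe
  obtain ⟨k₁, hk₁⟩ := exists_nat_ge M
  obtain ⟨k₂, hk₂⟩ := exists_nat_one_div_lt hκ
  have hne : {j : ℕ | K ⊆ halfBall e (1 / ((j : ℝ) + 1)) j}.Nonempty := by
    refine ⟨max k₁ k₂, fun x hx => ⟨?_, ?_⟩⟩
    · refine le_trans ?_ (hk₂.le.trans (hsub hx).1)
      have : (k₂ : ℝ) ≤ (max k₁ k₂ : ℕ) := by exact_mod_cast le_max_right _ _
      gcongr
    · exact ((hsub hx).2.trans hk₁).trans (by exact_mod_cast le_max_left _ _)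
  exact Nat.sInf_mem hne

theorem image_subset_halfBall_iff (R : Space d ≃ₗᵢ[ℝ] Space d) (e : Space d) (K : Set (Space d))
    (κ M : ℝ) : R '' K ⊆ halfBall (R e) κ M ↔ K ⊆ halfBall e κ M := by
  rw [image_subset_iff]
  have : R ⁻¹' halfBall (R e) κ M = halfBall e κ M := by
    ext x
    simp [halfBall]
  rw [this]

theorem halfBallIndex_image (R : Space d ≃ₗᵢ[ℝ] Space d) (e : Space d) (K : Set (Space d)) :
    halfBallIndex (R e) (R '' K) = halfBallIndex e K := by
  simp only [halfBallIndex, image_subset_halfBall_iff]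

section FrontDirections

variable [IsProbabilityMeasure P] {cstar : Space d → ℝ}

omit [IsProbabilityMeasure P] in
theorem RandomPDE.IsDeterministicExclusiveFrontSpeed.isDeterministicFrontSpeed {e : Space d} {c : ℝ}
    (h : E.IsDeterministicExclusiveFrontSpeed P θ₀ e c) :
    E.IsDeterministicFrontSpeed P θ₀ e c := by
  obtain ⟨β, hβ⟩ := h
  exact hβ.mono fun ω hω => hω.1

omit [IsProbabilityMeasure P] in
theorem exclusiveDirections_subset :
    E.exclusiveDirections P θ₀ ⊆ E.frontDirections P θ₀ := fun _ he =>
  ⟨he.1, he.2.imp fun _ hc =>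
    RandomPDE.IsDeterministicExclusiveFrontSpeed.isDeterministicFrontSpeed hc⟩

theorem isDeterministicExclusive_cstar
    (hcstar : ∀ e ∈ E.frontDirections P θ₀, E.IsDeterministicFrontSpeed P θ₀ e (cstar e))
    {e : Space d} (he : e ∈ E.exclusiveDirections P θ₀) :
    E.IsDeterministicExclusiveFrontSpeed P θ₀ e (cstar e) := by
  obtain ⟨he1, c, hc⟩ := he
  have h2 := hcstar e (exclusiveDirections_subset ⟨he1, c, hc⟩)
  obtain ⟨ω, h3, h4⟩ := ((RandomPDE.IsDeterministicExclusiveFrontSpeed.isDeterministicFrontSpeed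
    hc).and h2).exists
  rwa [frontSpeed_unique he1 h4 h3]

theorem HypothesisH.frontSpeed_mem_Ioc (hH : HypothesisH P E mBar cBar θ₀ R₀)
    (hcstar : ∀ e ∈ E.frontDirections P θ₀, E.IsDeterministicFrontSpeed P θ₀ e (cstar e))
    {e : Space d} (he : e ∈ E.frontDirections P θ₀) : 0 < cstar e ∧ cstar e ≤ cBar := by
  obtain ⟨ω, hω⟩ := (hcstar e he).exists
  exact ⟨hH.frontSpeed_pos he.1 hω, hH.frontSpeed_le he.1 hω⟩

/-- The set of directions with deterministic front speeds is closed, and a.e. environment has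
uniform front speeds in all these directions at once. -/
theorem HypothesisH.isClosed_frontDirections (hH : HypothesisH P E mBar cBar θ₀ R₀)
    (hcstar : ∀ e ∈ E.frontDirections P θ₀, E.IsDeterministicFrontSpeed P θ₀ e (cstar e)) :
    IsClosed (E.frontDirections P θ₀) ∧ ∀ᵐ ω ∂P, ∀ κ Λ : ℝ, 0 < κ → 0 ≤ Λ →
      UniformUpperBound E ω (E.frontDirections P θ₀) cstar θ₀ 0 κ Λ 0 ∧
      UniformLowerBound E ω (E.frontDirections P θ₀) cstar θ₀ 0 κ Λ := by
  set T := E.frontDirections P θ₀ with hTdef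
  have hT : ∀ e ∈ T, ‖e‖ = 1 := fun e he => he.1
  obtain ⟨g, hg, heq⟩ := (hH.lipschitzOnWith_frontSpeed hT hcstar).extend_real
  have hae := hH.ae_uniform_front hT hg fun e he => heq he ▸ hcstar e he
  constructor
  · refine isClosed_of_closure_subset fun e he => ?_
    have he1 : ‖e‖ = 1 := by
      have : closure T ⊆ {e | ‖e‖ = 1} :=
        closure_minimal hT (isClosed_eq continuous_norm continuous_const)
      exact this he
    exact ⟨he1, g e, hae.mono fun ω hω => hH.isFrontSpeed_of_uniform hω he1 he⟩
  · filter_upwards [hae] with ω hω κ Λ hκ hΛ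
    obtain ⟨h1, h2⟩ := hω κ Λ hκ hΛ
    constructor
    · intro Λ₀ ε hε
      filter_upwards [h1 Λ₀ ε hε] with t ht e he y x hy hx hxe
      exact ht e (subset_closure he) y x hy hx (heq he ▸ hxe)
    · intro Λ₀ ε hε
      filter_upwards [h2 Λ₀ ε hε] with t ht e he y x hy hx hxe
      exact ht e (subset_closure he) y x hy hx (heq he ▸ hxe)

/-- The set of directions with deterministic exclusive front speeds is closed, and exclusive fronts
in all these directions obey common bounds. -/
theorem HypothesisH.isClosed_exclusiveDirections (hH : HypothesisH P E mBar cBar θ₀ R₀)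
    (hcstar : ∀ e ∈ E.frontDirections P θ₀, E.IsDeterministicFrontSpeed P θ₀ e (cstar e)) :
    IsClosed (E.exclusiveDirections P θ₀) ∧ ∃ B : ℕ → ℝ → ℝ, (∀ j, IsModulus (B j)) ∧
      ∀ᵐ ω ∂P, (∀ j : ℕ, ∀ α ∈ Ioc (0 : ℝ) 1,
        UniformUpperBound E ω (E.exclusiveDirections P θ₀) cstar 1 α (1 / ((j : ℝ) + 1))
          (cBar + j) (B j α)) ∧
        ∀ e ∈ E.exclusiveDirections P θ₀, E.IsExclusiveFrontSpeedWith θ₀ ω e (cstar e)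
          fun K => B (halfBallIndex e K) := by
  set T := E.frontDirections P θ₀ with hTdef
  set T' := E.exclusiveDirections P θ₀ with hT'def
  obtain ⟨hTcl, hae⟩ := hH.isClosed_frontDirections hcstar
  have hsub : closure T' ⊆ T := closure_minimal exclusiveDirections_subset hTcl
  have hT' : ∀ e ∈ T', ‖e‖ = 1 := fun e he => he.1
  obtain ⟨g, hg, heq⟩ := (hH.lipschitzOnWith_frontSpeed (fun e he => he.1) hcstar).extend_real
  choose B hB hBae using fun j : ℕ => hH.exists_uniform_exclusive hT' hg
    (fun e he => heq (exclusiveDirections_subset he) ▸ isDeterministicExclusive_cstar hcstar he)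
    (κ := 1 / ((j : ℝ) + 1)) (Λ := cBar + j) (by positivity)
    (add_nonneg hH.cBar_pos.le (Nat.cast_nonneg j))
  have huni : ∀ᵐ ω ∂P, ∀ j : ℕ, ∀ α ∈ Ioc (0 : ℝ) 1,
      UniformUpperBound E ω (closure T') cstar 1 α (1 / ((j : ℝ) + 1)) (cBar + j) (B j α) := by
    filter_upwards [ae_all_iff.2 hBae] with ω hω j α hα Λ₀ ε hε
    filter_upwards [hω j α hα Λ₀ ε hε] with t ht e he y x hy hx hxe
    exact ht e he y x hy hx (heq (hsub he) ▸ hxe)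
  have hex : ∀ᵐ ω ∂P, ∀ e ∈ closure T', E.IsExclusiveFrontSpeedWith θ₀ ω e (cstar e)
      fun K => B (halfBallIndex e K) := by
    filter_upwards [hae, huni] with ω h1 h2 e he
    have he1 : ‖e‖ = 1 := (hsub he).1
    refine ⟨hH.isFrontSpeed_of_uniform h1 he1 (hsub he), fun K _ _ => hB _, ?_⟩
    intro K hK hKe α hα ε hε
    have hdil := (h2 (halfBallIndex e K) α hα).dilated (fun e he => (hsub he).1)
      (fun e he => ?_) 0 hε
    · filter_upwards [hdil] with t ht x hx
      rw [exclusiveDatum_eq]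
      simpa [hH.shift_zero] using ht e he 0 (by simp) x (subset_halfBall_index hK hKe hx)
    · obtain ⟨h3, h4⟩ := hH.frontSpeed_mem_Ioc hcstar (hsub he)
      rwa [abs_of_pos h3]
  refine ⟨isClosed_of_closure_subset fun e he => ⟨(hsub he).1, cstar e, _,
    hex.mono fun ω hω => hω e he⟩, B, hB, ?_⟩
  filter_upwards [huni, hex] with ω h1 h2
  exact ⟨fun j α hα => (h1 j α hα).subset subset_closure, fun e he => h2 e (subset_closure he)⟩

end FrontDirections

/-- An almost sure property holds on a measurable event of full probability. -/
theorem exists_measurableSet_prob_eq_one {Ω : Type*} [MeasurableSpace Ω] {P : Measure Ω}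
    [IsProbabilityMeasure P] {p : Ω → Prop} (h : ∀ᵐ ω ∂P, p ω) :
    ∃ Ω₀ : Set Ω, MeasurableSet Ω₀ ∧ P Ω₀ = 1 ∧ ∀ ω ∈ Ω₀, p ω := by
  obtain ⟨N, hN, hNm, hN0⟩ := exists_measurable_superset_of_null (ae_iff.1 h)
  refine ⟨Nᶜ, hNm.compl, (prob_compl_eq_one_iff hNm).2 hN0, fun ω hω => ?_⟩
  by_contra hp
  exact hω (hN hp)

end

section

variable {d : ℕ} {Ω : Type*} [MeasurableSpace Ω] {P : Measure Ω} {E : RandomPDE d Ω}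
  {mBar cBar θ₀ R₀ : ℝ}

/-! ### The shape set of a radial function -/

section WulffSet

variable {w : Space d → ℝ}

theorem mem_wulffSet_iff {x : Space d} (hx : x ≠ 0) :
    x ∈ wulffSet w ↔ ‖x‖ < w (‖x‖⁻¹ • x) := by
  have hx0 : 0 < ‖x‖ := norm_pos_iff.2 hx
  constructor
  · rintro ⟨e, he, s, hs0, hs, rfl⟩
    have hn : ‖s • e‖ = s := by rw [norm_smul, he, mul_one, Real.norm_of_nonneg hs0]
    rw [hn] at hx0 ⊢
    rwa [smul_smul, inv_mul_cancel₀ hx0.ne', one_smul]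
  · intro h
    refine ⟨‖x‖⁻¹ • x, ?_, ‖x‖, hx0.le, h, ?_⟩
    · rw [norm_smul, norm_inv, norm_norm, inv_mul_cancel₀ hx0.ne']
    · rw [smul_smul, mul_inv_cancel₀ hx0.ne', one_smul]

theorem continuousAt_radial (hw : ContinuousOn w (Metric.sphere 0 1)) {x : Space d} (hx : x ≠ 0) :
    ContinuousAt (fun z => w (‖z‖⁻¹ • z) - ‖z‖) x := by
  have hmaps : MapsTo (fun z : Space d => ‖z‖⁻¹ • z) {0}ᶜ (Metric.sphere 0 1) := by
    intro z hz
    have : ‖z‖ ≠ 0 := norm_ne_zero_iff.2 hz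
    simp [norm_smul, inv_mul_cancel₀ this]
  have hc : ContinuousOn (fun z : Space d => ‖z‖⁻¹ • z) {0}ᶜ := by
    refine ContinuousOn.smul (ContinuousOn.inv₀ continuous_norm.continuousOn fun z hz => ?_)
      continuousOn_id
    exact norm_ne_zero_iff.2 hz
  exact ((hw.comp hc hmaps).continuousAt (isOpen_compl_singleton.mem_nhds hx)).sub
    continuous_norm.continuousAt

theorem exists_ball_subset_wulffSet [NeZero d] (hw : ContinuousOn w (Metric.sphere 0 1))
    (hpos : ∀ e ∈ Metric.sphere (0 : Space d) 1, 0 < w e) :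
    ∃ r : ℝ, 0 < r ∧ Metric.ball 0 r ⊆ wulffSet w := by
  have hb : basisVec (0 : Fin d) ∈ Metric.sphere (0 : Space d) 1 := by simp [basisVec]
  obtain ⟨e₀, he₀, hmin⟩ := (isCompact_sphere (0 : Space d) 1).exists_isMinOn ⟨_, hb⟩ hw
  refine ⟨w e₀, hpos e₀ he₀, fun x hx => ?_⟩
  rw [mem_ball_zero_iff] at hx
  by_cases hx0 : x = 0
  · exact ⟨basisVec 0, by simpa using hb, 0, le_rfl, hpos _ hb, by simp [hx0]⟩
  · rw [mem_wulffSet_iff hx0]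
    refine hx.trans_le (hmin ?_)
    have : ‖x‖ ≠ 0 := norm_ne_zero_iff.2 hx0
    simp [norm_smul, inv_mul_cancel₀ this]

theorem isOpen_wulffSet [NeZero d] (hw : ContinuousOn w (Metric.sphere 0 1))
    (hpos : ∀ e ∈ Metric.sphere (0 : Space d) 1, 0 < w e) : IsOpen (wulffSet w) := by
  obtain ⟨r, hr, hball⟩ := exists_ball_subset_wulffSet hw hpos
  rw [isOpen_iff_mem_nhds]
  intro x hx
  by_cases hx0 : x = 0
  · subst hx0
    exact mem_of_superset (Metric.ball_mem_nhds _ hr) hball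
  · have h1 := (mem_wulffSet_iff hx0).1 hx
    filter_upwards [(continuousAt_radial hw hx0).eventually_const_lt (sub_pos.2 h1),
      isOpen_compl_singleton.mem_nhds hx0] with z hz hz0
    exact (mem_wulffSet_iff hz0).2 (sub_pos.1 hz)

theorem zero_mem_wulffSet [NeZero d] (hpos : ∀ e ∈ Metric.sphere (0 : Space d) 1, 0 < w e) :
    (0 : Space d) ∈ wulffSet w := by
  have hb : basisVec (0 : Fin d) ∈ Metric.sphere (0 : Space d) 1 := by simp [basisVec]
  exact ⟨basisVec 0, by simpa using hb, 0, le_rfl, hpos _ hb, by simp⟩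

/-- Dilating a point outside the shape set moves it away from the closure. -/
theorem smul_notMem_closure_wulffSet [NeZero d] (hw : ContinuousOn w (Metric.sphere 0 1))
    (hpos : ∀ e ∈ Metric.sphere (0 : Space d) 1, 0 < w e) {x : Space d} (hx : x ∉ wulffSet w)
    {m : ℝ} (hm : 1 < m) : m • x ∉ closure (wulffSet w) := by
  have hx0 : x ≠ 0 := fun h => hx (h ▸ zero_mem_wulffSet hpos)
  have hm0 : 0 < m := by linarith
  have hmx : m • x ≠ 0 := smul_ne_zero hm0.ne' hx0
  have hn0 : 0 < ‖x‖ := norm_pos_iff.2 hx0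
  have hdir : ‖m • x‖⁻¹ • m • x = ‖x‖⁻¹ • x := by
    rw [norm_smul, Real.norm_of_nonneg hm0.le, smul_smul]
    congr 1
    field_simp
  have hneg : w (‖m • x‖⁻¹ • m • x) - ‖m • x‖ < 0 := by
    rw [hdir, norm_smul, Real.norm_of_nonneg hm0.le]
    have := not_lt.1 fun h => hx ((mem_wulffSet_iff hx0).2 h)
    nlinarith
  intro hcl
  obtain ⟨z, ⟨hz1, hz2⟩, hz3⟩ := mem_closure_iff_nhds.1 hcl _
    (((continuousAt_radial hw hmx).eventually_lt_const hneg).and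
      (isOpen_compl_singleton.mem_nhds hmx))
  have := (mem_wulffSet_iff hz2).1 hz3
  linarith

theorem smul_mem_wulffSet {e : Space d} (he : ‖e‖ = 1) {s : ℝ} (hs0 : 0 ≤ s) (hs : s < w e) :
    s • e ∈ wulffSet w := ⟨e, he, s, hs0, hs, rfl⟩

theorem smul_notMem_wulffSet {e : Space d} (he : ‖e‖ = 1) (hwe : 0 < w e) :
    w e • e ∉ wulffSet w := by
  have hn : ‖w e • e‖ = w e := by rw [norm_smul, he, mul_one, Real.norm_of_nonneg hwe.le]
  rw [mem_wulffSet_iff (norm_pos_iff.1 (by rwa [hn])), hn, smul_smul,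
    inv_mul_cancel₀ hwe.ne', one_smul]
  exact lt_irrefl _

end WulffSet

/-- Given a point `p` outside an open convex set and a point `q` inside it, the largest ball in the
set with centre `q` touches the boundary, and a supporting half-space at a point of contact is
tangent to the ball. -/
theorem exists_interior_ball_support {S : Set (Space d)} (hS : IsOpen S) (hconv : Convex ℝ S)
    {p q : Space d} (hp : p ∉ S) (hq : q ∈ S) :
    ∃ (ρ : ℝ) (e : Space d), 0 < ρ ∧ ρ ≤ dist q p ∧ ‖e‖ = 1 ∧ Metric.ball q ρ ⊆ S ∧
      ∀ x ∈ S, inner ℝ x e < inner ℝ q e + ρ := by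
  obtain ⟨p', hp', hd⟩ := hS.isClosed_compl.exists_infDist_eq_dist ⟨p, hp⟩ q
  obtain ⟨f, hf⟩ := geometric_hahn_banach_open_point hconv hS hp'
  set v := (InnerProductSpace.toDual ℝ (Space d)).symm f with hv
  have hfv : ∀ x, f x = inner ℝ x v := fun x => by
    rw [real_inner_comm, hv, InnerProductSpace.toDual_symm_apply]
  have hv0 : v ≠ 0 := by
    intro h
    have := hf q hq
    simp [hfv, h] at this
  have hvn : 0 < ‖v‖ := norm_pos_iff.2 hv0
  have hen : ‖‖v‖⁻¹ • v‖ = 1 := by rw [norm_smul, norm_inv, norm_norm, inv_mul_cancel₀ hvn.ne']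
  have hρ : 0 < dist q p' := dist_pos.2 fun h => hp' (h ▸ hq)
  refine ⟨dist q p', ‖v‖⁻¹ • v, hρ, ?_, hen, ?_, fun x hx => ?_⟩
  · rw [← hd]
    exact Metric.infDist_le_dist_of_mem hp
  · intro x hx
    by_contra hxS
    have := Metric.infDist_le_dist_of_mem (x := q) (s := Sᶜ) hxS
    rw [Metric.mem_ball, dist_comm] at hx
    linarith
  · have h1 := hf x hx
    rw [hfv, hfv] at h1
    have h2 : inner ℝ x (‖v‖⁻¹ • v) < inner ℝ p' (‖v‖⁻¹ • v) := by
      rw [inner_smul_right, inner_smul_right]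
      gcongr
    have h3 := (abs_le.1 (inner_le_norm_of_unit hen (p' - q))).2
    rw [inner_sub_left] at h3
    rw [dist_comm, dist_eq_norm]
    linarith

/-! ### Wulff shapes: convexity -/

/-- At time `t` the function `f` is close to the indicator function of `t S`, up to the factors
`1 ± δ`. -/
def IsShapedLike (S : Set (Space d)) (δ ε t : ℝ) (f : Space d → ℝ) : Prop :=
  ∀ z, ((((1 - δ) * t)⁻¹ • z ∈ S → 1 - ε ≤ f z) ∧ (((1 + δ) * t)⁻¹ • z ∉ S → f z ≤ ε))

/-- At every scale, translates of the environment along a relatively dense set have spreading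
solutions with asymptotic shape `S`. -/
def HasShapeVisits (E : RandomPDE d Ω) (θ₀ R₀ : ℝ) (S : Set (Space d)) (δ ε : ℝ) (ω : Ω) : Prop :=
  ∀ Λ η : ℝ, 0 < η → ∃ n : ℕ, ∀ᶠ t : ℝ in atTop, ∀ y : Space d, ‖y‖ ≤ Λ * t →
    ∃ y' : Space d, ‖y' - y‖ ≤ η * t ∧ ∀ t' : ℝ, 0 < t' → (n : ℝ) ≤ t' →
      IsShapedLike S δ ε t' (E.sol (E.shift y' ω) (ballDatum θ₀ R₀) t')

omit [MeasurableSpace Ω] in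
theorem RandomPDE.IsWulffShape.eventually_isShapedLike {ω : Ω} {w : Space d → ℝ}
    (h : E.IsWulffShape θ₀ R₀ ω w) {δ ε : ℝ} (hδ : 0 < δ) (hδ1 : δ < 1) (hε : 0 < ε) :
    ∀ᶠ t in atTop, IsShapedLike (wulffSet w) δ ε t (E.sol ω (ballDatum θ₀ R₀) t) := by
  filter_upwards [h.1 δ hδ hδ1 ε hε, h.2 δ hδ ε hε, eventually_gt_atTop 0] with t h1 h2 ht z
  have e1 : (1 - δ) * t ≠ 0 := (mul_pos (by linarith) ht).ne'
  have e2 : (1 + δ) * t ≠ 0 := (mul_pos (by linarith) ht).ne'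
  constructor
  · intro hz
    have := h1 _ hz
    rwa [smul_smul, mul_inv_cancel₀ e1, one_smul] at this
  · intro hz
    have := h2 _ hz
    rwa [smul_smul, mul_inv_cancel₀ e2, one_smul] at this

theorem HypothesisH.admissible_ballDatum (hH : HypothesisH P E mBar cBar θ₀ R₀) :
    Admissible (ballDatum θ₀ R₀ : Space d → ℝ) := by
  simpa using admissible_ballDatum_translate hH.theta_pos.le hH.theta_lt_one.le R₀ (0 : Space d)

theorem HypothesisH.ae_hasShapeVisits [IsProbabilityMeasure P] [NeZero d]
    (hH : HypothesisH P E mBar cBar θ₀ R₀) {w : Space d → ℝ}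
    (hw : E.IsDeterministicWulffShape P θ₀ R₀ w) {δ ε : ℝ} (hδ : 0 < δ) (hδ1 : δ < 1)
    (hε : 0 < ε) : ∀ᵐ ω ∂P, HasShapeVisits E θ₀ R₀ (wulffSet w) δ ε ω := by
  have hS : MeasurableSet (wulffSet w) := (isOpen_wulffSet hw.1 hw.2.1).measurableSet
  have hW : MeasurableSet {q : (ℝ × Space d) × ℝ |
      ((((1 - δ) * q.1.1)⁻¹ • q.1.2 ∈ wulffSet w → 1 - ε ≤ q.2) ∧
        (((1 + δ) * q.1.1)⁻¹ • q.1.2 ∉ wulffSet w → q.2 ≤ ε))} := by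
    have hm : ∀ a : ℝ, Measurable fun q : (ℝ × Space d) × ℝ => (a * q.1.1)⁻¹ • q.1.2 := fun a => by
      fun_prop
    refine MeasurableSet.inter (MeasurableSet.imp (hm _ hS) ?_)
      (MeasurableSet.imp (hm _ hS).compl ?_)
    · exact measurableSet_le measurable_const measurable_snd
    · exact measurableSet_le measurable_snd measurable_const
  exact hH.ae_visits hH.admissible_ballDatum hW
    (hw.2.2.mono fun ω hω => hω.eventually_isShapedLike hδ hδ1 hε)

theorem ballDatum_le {θ R : ℝ} {x : Space d} {v : ℝ} (hv : 0 ≤ v) (h : ‖x‖ < R → θ ≤ v) :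
    ballDatum θ R x ≤ v := by
  by_cases hx : x ∈ Metric.ball (0 : Space d) R
  · rw [ballDatum, indicator_of_mem hx]
    exact h (by simpa using hx)
  · rwa [ballDatum, indicator_of_notMem hx]

/-- A Wulff shape is convex: a solution that has spread for the time `a t` to the vicinity of
`a t p₁` spreads from there for the time `b t` to the vicinity of `t (a p₁ + b p₂)`. -/
theorem HypothesisH.convex_wulffSet [IsProbabilityMeasure P] [NeZero d]
    (hH : HypothesisH P E mBar cBar θ₀ R₀) {w : Space d → ℝ}
    (hw : E.IsDeterministicWulffShape P θ₀ R₀ w) : Convex ℝ (wulffSet w) := by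
  have hopen := isOpen_wulffSet hw.1 hw.2.1
  have hadm := hH.admissible_ballDatum
  rw [convex_iff_forall_pos]
  intro p₁ hp₁ p₂ hp₂ a b ha hb hab
  by_contra hq
  have hscale : ∀ p ∈ wulffSet w, ∀ᶠ m : ℝ in 𝓝[>] 1, m • p ∈ wulffSet w := by
    intro p hp
    have hc : ContinuousAt (fun m : ℝ => m • p) 1 := by fun_prop
    exact (hc.eventually (hopen.mem_nhds (by simpa using hp))).filter_mono nhdsWithin_le_nhds
  obtain ⟨m, hm1, hm2, hm⟩ := ((hscale p₁ hp₁).and ((hscale p₂ hp₂).and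
    self_mem_nhdsWithin)).exists
  set δ := (m - 1) / (2 * (m + 1)) with hδ
  have hδ0 : 0 < δ := div_pos (by linarith) (by linarith)
  have hδeq : 2 * (m + 1) * δ = m - 1 := mul_div_cancel₀ _ (by linarith)
  have hδ1 : δ < 1 := by nlinarith
  -- `δ` is so small that the dilation by `m` outweighs the relative errors `1 ± δ`.
  set m₂ := (1 - δ) * m / (1 + δ) with hm₂
  have hm₂1 : 1 < m₂ := by
    rw [hm₂, lt_div_iff₀ (by linarith)]
    nlinarith
  obtain ⟨ρ, hρ, hρS⟩ := Metric.isOpen_iff.1 isClosed_closure.isOpen_compl _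
    (smul_notMem_closure_wulffSet hw.1 hw.2.1 hq hm₂1)
  obtain ⟨ρ₁, hρ₁, hρ₁S⟩ := Metric.isOpen_iff.1 hopen _ hm1
  set ε := min (1 - θ₀) (1 / 4) with hε
  have hε0 : 0 < ε := lt_min (by linarith [hH.theta_lt_one]) (by norm_num)
  have hεθ : ε ≤ 1 - θ₀ := min_le_left _ _
  have hε4 : ε ≤ 1 / 4 := min_le_right _ _
  set η := min (ρ₁ * ((1 - δ) * a) / 2) ρ with hη
  have hη0 : 0 < η := lt_min (by have : 0 < 1 - δ := by linarith
                                 positivity) hρ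
  have hη1 : 2 * η ≤ ρ₁ * ((1 - δ) * a) := by
    linarith [min_le_left (ρ₁ * ((1 - δ) * a) / 2) ρ]
  have hη2 : η ≤ ρ := min_le_right _ _
  obtain ⟨ω, hω1, hω2⟩ := ((hH.ae_hasShapeVisits hw hδ0 hδ1 hε0).and hw.2.2).exists
  have hshape := hω2.eventually_isShapedLike hδ0 hδ1 hε0
  obtain ⟨n, hn⟩ := hω1 ((1 - δ) * a * ‖m • p₁‖) η hη0
  have hat : Tendsto (fun t : ℝ => a * t) atTop atTop := tendsto_id.const_mul_atTop ha
  have hbt : Tendsto (fun t : ℝ => b * t) atTop atTop := tendsto_id.const_mul_atTop hb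
  have hηt : Tendsto (fun t : ℝ => η * t) atTop atTop := tendsto_id.const_mul_atTop hη0
  obtain ⟨t, ht, hs1, hs2, hbn, hR, ht0⟩ := (hn.and (hshape.and ((hat.eventually hshape).and
    ((hbt.eventually_ge_atTop (n : ℝ)).and ((hηt.eventually_ge_atTop R₀).and
      (eventually_gt_atTop 0)))))).exists
  have hδ' : 0 < 1 - δ := by linarith
  set y₀ := ((1 - δ) * (a * t)) • (m • p₁) with hy₀
  obtain ⟨y', hy', hgood⟩ := ht y₀ (by
    rw [hy₀, norm_smul, Real.norm_of_nonneg (by positivity)]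
    apply le_of_eq
    ring)
  set X := y' + ((1 - δ) * (b * t)) • (m • p₂) with hX
  -- The solution at time `a t` dominates the ball datum centred at `y'`.
  have hcmp := hH.comparison ω _ _ _ _ (hH.isSolution_shift ω hadm y')
    (hH.isSolution_shift_time ω hadm 0 (mul_pos ha ht0)) (fun z => ?_) (b * t) (by positivity) X
  · rw [hH.shift_zero, sub_zero, ← add_mul, add_comm b a, hab, one_mul] at hcmp
    have hlow := (hgood (b * t) (by positivity) hbn (X - y')).1 (by
      rw [hX, add_sub_cancel_left, smul_smul, inv_mul_cancel₀ (by positivity), one_smul]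
      exact hm2)
    have hup := (hs1 X).2 (fun hmem => by
      refine hρS ?_ (subset_closure hmem)
      rw [mem_ball_iff_norm]
      have heq : ((1 + δ) * t)⁻¹ • X - m₂ • (a • p₁ + b • p₂) = ((1 + δ) * t)⁻¹ • (y' - y₀) := by
        have hden : (1 + δ) ≠ 0 := by linarith
        have h1 : m₂ • (a • p₁ + b • p₂) =
            ((1 + δ) * t)⁻¹ • (y₀ + ((1 - δ) * (b * t)) • (m • p₂)) := by
          rw [hy₀, smul_add, smul_add, smul_smul, smul_smul, smul_smul, smul_smul, smul_smul,
            smul_smul, hm₂]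
          congr 2 <;> field_simp
        rw [h1, hX, ← smul_sub, add_sub_add_right_eq_sub]
      rw [heq, norm_smul, Real.norm_of_nonneg (by positivity), inv_mul_lt_iff₀ (by positivity)]
      calc ‖y' - y₀‖ ≤ η * t := hy'
        _ ≤ ρ * t := by gcongr
        _ < (1 + δ) * t * ρ := by nlinarith [mul_pos (mul_pos hδ0 ht0) hρ])
    linarith
  · rw [hH.shift_zero, sub_zero]
    refine ballDatum_le (hH.sol_mem_Icc ω hadm (mul_pos ha ht0) z).1 fun hz => ?_
    refine le_trans (by linarith) ((hs2 z).1 (hρ₁S ?_))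
    rw [mem_ball_iff_norm]
    have hc0 : 0 < (1 - δ) * (a * t) := by positivity
    have heq : ((1 - δ) * (a * t))⁻¹ • z - m • p₁ = ((1 - δ) * (a * t))⁻¹ • (z - y₀) := by
      rw [smul_sub, hy₀, smul_smul _ _ (m • p₁), inv_mul_cancel₀ hc0.ne', one_smul]
    rw [heq, norm_smul, Real.norm_of_nonneg (by positivity), inv_mul_lt_iff₀ hc0]
    have h1 : ‖z - y₀‖ ≤ ‖z - y'‖ + ‖y' - y₀‖ := by
      simpa using norm_add_le (z - y') (y' - y₀)
    nlinarith

end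

section

variable {d : ℕ} {Ω : Type*} [MeasurableSpace Ω] {P : Measure Ω} {E : RandomPDE d Ω}
  {mBar cBar θ₀ R₀ : ℝ}

/-! ### Wulff shapes: normals at points with an interior ball are front directions -/

theorem exists_one_div_add_two_le {c : ℝ} (hc : 0 < c) : ∃ k : ℕ, 1 / ((k : ℝ) + 2) ≤ c := by
  obtain ⟨k, hk⟩ := exists_nat_one_div_lt hc
  refine ⟨k, le_trans ?_ hk.le⟩
  gcongr
  norm_num

/-- A front is not slower than spreading solutions that start slightly behind it: by the time `t`,
a ball datum at a suitable point reaches the given point through the interior ball. -/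
theorem HypothesisH.eventually_ge_of_visits (hH : HypothesisH P E mBar cBar θ₀ R₀) {ω : Ω}
    {S : Set (Space d)}
    (hvis : ∀ k : ℕ, HasShapeVisits E θ₀ R₀ S (1 / ((k : ℝ) + 2)) (1 / ((k : ℝ) + 2)) ω)
    {q e : Space d} {ρ : ℝ} (hρ : 0 < ρ) (hball : Metric.ball q ρ ⊆ S) (he : ‖e‖ = 1)
    (hh : 0 < inner ℝ q e + ρ) {κ : ℝ} (hκ : 0 < κ) (Λ : ℝ) {ε : ℝ} (hε : 0 < ε) :
    ∀ᶠ t : ℝ in atTop, ∀ x : Space d, ‖x‖ ≤ Λ * t → inner ℝ x e ≤ (inner ℝ q e + ρ - κ) * t →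
      1 - ε ≤ E.sol ω (halfDatum θ₀ 0 e) t x := by
  set h := inner ℝ q e + ρ with hhdef
  -- A smaller ball in `S`, tangent to the same hyperplane, is almost as far ahead at its centre.
  set ρ₁ := min (ρ / 2) (κ / 4) with hρ₁
  have hρ₁0 : 0 < ρ₁ := by positivity
  have hρ₁ρ : ρ₁ ≤ ρ / 2 := min_le_left _ _
  have hρ₁κ : ρ₁ ≤ κ / 4 := min_le_right _ _
  set p := q + (ρ - ρ₁) • e with hp
  have hpe : inner ℝ p e = h - ρ₁ := by
    rw [hp, inner_add_left, inner_smul_left, inner_self_of_unit he, hhdef]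
    simp only [conj_trivial]
    ring
  obtain ⟨k, hk⟩ := exists_one_div_add_two_le (c := min (κ / (4 * h)) ε) (by positivity)
  have hv := hvis k
  have hδ0 : 0 < 1 / ((k : ℝ) + 2) := by positivity
  have hδ2 : 1 / ((k : ℝ) + 2) ≤ 1 / 2 := by
    gcongr
    linarith [(Nat.cast_nonneg k : (0 : ℝ) ≤ k)]
  set δ := 1 / ((k : ℝ) + 2) with hδ
  have hδh : δ * h ≤ κ / 4 := by
    have := hk.trans (min_le_left _ _)
    rw [le_div_iff₀ (by positivity)] at this
    linarith
  have hδε : δ ≤ ε := hk.trans (min_le_right _ _)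
  set η := min (κ / 8) (ρ₁ / 4) with hη
  have hη0 : 0 < η := by positivity
  have hηκ : η ≤ κ / 8 := min_le_left _ _
  have hηρ : η ≤ ρ₁ / 4 := min_le_right _ _
  obtain ⟨n, hn⟩ := hv (Λ + ‖p‖) η hη0
  have hκt : Tendsto (fun t : ℝ => κ / 4 * t) atTop atTop :=
    tendsto_id.const_mul_atTop (by positivity)
  filter_upwards [hn, eventually_ge_atTop (n : ℝ), eventually_gt_atTop 0,
    hκt.eventually_ge_atTop R₀] with t ht htn ht0 htR x hx hxe
  have hδ' : 0 < 1 - δ := by linarith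
  have hc0 : 0 < (1 - δ) * t := by positivity
  set y₀ := x - ((1 - δ) * t) • p with hy₀
  obtain ⟨y', hy', hgood⟩ := ht y₀ (by
    refine (norm_sub_le _ _).trans ?_
    rw [norm_smul, Real.norm_of_nonneg hc0.le]
    nlinarith [mul_nonneg (mul_nonneg hδ0.le ht0.le) (norm_nonneg p)])
  have hy₀e : inner ℝ y₀ e ≤ -(κ / 2) * t := by
    rw [hy₀, inner_sub_left, inner_smul_left, hpe]
    simp only [conj_trivial]
    nlinarith [mul_nonneg (mul_nonneg hδ0.le ht0.le) hρ₁0.le]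
  have hy'e : inner ℝ y' e ≤ -(κ / 4) * t := by
    have h1 := (abs_le.1 ((inner_le_norm_of_unit he (y' - y₀)).trans hy')).2
    rw [inner_sub_left] at h1
    nlinarith
  have hcmp := hH.sol_shift_le_sol_shift ω hH.admissible_ballDatum
    (admissible_halfDatum le_rfl hH.theta_pos.le hH.theta_lt_one.le e) (y := y') (y' := 0)
    (fun z => ?_) ht0 x
  · rw [hH.shift_zero, sub_zero] at hcmp
    have h1 := (hgood t ht0 htn (x - y')).1 (hball ?_)
    · linarith
    · rw [mem_ball_iff_norm]
      have heq : ((1 - δ) * t)⁻¹ • (x - y') - q =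
          (ρ - ρ₁) • e - ((1 - δ) * t)⁻¹ • (y' - y₀) := by
        have h2 : x - y' = ((1 - δ) * t) • p - (y' - y₀) := by rw [hy₀]; abel
        rw [h2, smul_sub, smul_smul, inv_mul_cancel₀ hc0.ne', one_smul, hp]
        abel
      rw [heq]
      have h3 : ‖((1 - δ) * t)⁻¹ • (y' - y₀)‖ < ρ₁ := by
        rw [norm_smul, Real.norm_of_nonneg (by positivity), inv_mul_lt_iff₀ hc0]
        nlinarith [mul_pos ht0 hρ₁0]
      refine (norm_sub_le _ _).trans_lt ?_
      rw [norm_smul, he, mul_one, Real.norm_of_nonneg (by linarith)]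
      linarith
  · rw [sub_zero]
    refine ballDatum_le ((admissible_halfDatum le_rfl hH.theta_pos.le hH.theta_lt_one.le e).2 z).1
      fun hz => ?_
    rw [halfDatum_of_neg]
    have h1 := (abs_le.1 (inner_le_norm_of_unit he (z - y'))).2
    rw [inner_sub_left] at h1
    linarith

/-- A bounded part of a half-space lies in a large ball touching the half-space from outside, once
the ball has been moved slightly inwards. -/
theorem norm_add_smul_lt_of_inner_nonpos {e z : Space d} (he : ‖e‖ = 1) (hze : inner ℝ z e ≤ 0)
    {C a r t : ℝ} (hz : ‖z‖ ≤ C * t) (ha : 0 < a) (ht : 0 < t)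
    (h : (C ^ 2 + a ^ 2) * t < a * r) (h' : a * t ≤ r) :
    ‖z + (r - a * t) • e‖ < r - a * t / 2 := by
  have hat : 0 < a * t := mul_pos ha ht
  have hsq : ‖z + (r - a * t) • e‖ ^ 2 < (r - a * t / 2) ^ 2 := by
    rw [norm_add_sq_real, inner_smul_right, norm_smul, he, mul_one, Real.norm_eq_abs, sq_abs]
    have h2 : ‖z‖ ^ 2 ≤ (C * t) ^ 2 := by gcongr
    have h3 : (r - a * t) * inner ℝ z e ≤ 0 :=
      mul_nonpos_of_nonneg_of_nonpos (by linarith) hze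
    have h4 : (C ^ 2 + a ^ 2) * t * t < a * r * t := by gcongr
    have h5 : 0 < (a * t) ^ 2 := by positivity
    linarith
  exact lt_of_pow_lt_pow_left₀ 2 (by linarith) hsq

/-- Up to distance `O(t)`, a half-space is contained in the dilate of a shape with an interior ball
of radius `ρ`, after the time `N t`, once `N ρ` is large. Hence a front does not overtake the
corresponding spreading solution. -/
theorem HypothesisH.eventually_le_of_visits (hH : HypothesisH P E mBar cBar θ₀ R₀) {ω : Ω}
    {S : Set (Space d)}
    (hvis : ∀ k : ℕ, HasShapeVisits E θ₀ R₀ S (1 / ((k : ℝ) + 2)) (1 / ((k : ℝ) + 2)) ω)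
    {q e : Space d} {ρ : ℝ} (hρ : 0 < ρ) (hball : Metric.ball q ρ ⊆ S) (he : ‖e‖ = 1)
    (hh : 0 < inner ℝ q e + ρ) (hS : ∀ x ∈ S, inner ℝ x e < inner ℝ q e + ρ)
    {κ : ℝ} (hκ : 0 < κ) (Λ : ℝ) {ε : ℝ} (hε : 0 < ε) :
    ∀ᶠ t : ℝ in atTop, ∀ x : Space d, ‖x‖ ≤ Λ * t → (inner ℝ q e + ρ + κ) * t ≤ inner ℝ x e →
      E.sol ω (halfDatum θ₀ 0 e) t x ≤ ε := by
  set h := inner ℝ q e + ρ with hhdef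
  set a := κ / 3 with ha
  have ha0 : 0 < a := by positivity
  set C := Λ + cBar + 1 with hC
  -- At time `N t`, the boundary of the dilated ball deviates from its tangent hyperplane by less
  -- than `a t` over distances up to `C t`.
  obtain ⟨N, hN⟩ := exists_gt (2 * (C ^ 2 / a + a) / ρ)
  have hN0 : 0 < N := lt_of_le_of_lt (by positivity) hN
  have hNρ : C ^ 2 + a ^ 2 < a * (N * ρ / 2) := by
    rw [div_lt_iff₀ hρ] at hN
    have h1 : a * (C ^ 2 / a + a) = C ^ 2 + a ^ 2 := by
      rw [mul_add, mul_div_cancel₀ _ ha0.ne', sq a]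
    have h2 : a * (C ^ 2 / a + a) < a * (N * ρ / 2) := by
      gcongr
      linarith
    linarith
  have hθ1 := hH.theta_lt_one
  obtain ⟨k, hk⟩ := exists_one_div_add_two_le
    (c := min (κ / (2 * ((2 * N + 1) * h))) (min (1 - θ₀) (ε / 2)))
    (lt_min (by positivity) (lt_min (by linarith) (by positivity)))
  have hv := hvis k
  have hδ0 : 0 < 1 / ((k : ℝ) + 2) := by positivity
  have hδ2 : 1 / ((k : ℝ) + 2) ≤ 1 / 2 := by
    gcongr
    linarith [(Nat.cast_nonneg k : (0 : ℝ) ≤ k)]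
  set δ := 1 / ((k : ℝ) + 2) with hδ
  have hδh : δ * ((2 * N + 1) * h) ≤ κ / 2 := by
    have := hk.trans (min_le_left _ _)
    rw [le_div_iff₀ (by positivity)] at this
    linarith
  have hδθ : δ ≤ 1 - θ₀ := hk.trans ((min_le_right _ _).trans (min_le_left _ _))
  have hδε : δ ≤ ε / 2 := hk.trans ((min_le_right _ _).trans (min_le_right _ _))
  have hδ' : 0 < 1 - δ := by linarith
  obtain ⟨n, hn⟩ := hv (a + (1 - δ) * N * ‖q + ρ • e‖) (a / 2) (by positivity)
  have hNt : Tendsto (fun t : ℝ => N * t) atTop atTop := tendsto_id.const_mul_atTop hN0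
  filter_upwards [hn, hNt.eventually_ge_atTop (n : ℝ), eventually_gt_atTop 0,
    hH.eventually_error_le (half_pos hε)] with t ht htn ht0 herr x hx hxe
  set s := N * t with hs
  have hs0 : 0 < s := by positivity
  have hc0 : 0 < (1 - δ) * s := by positivity
  set r := (1 - δ) * s * ρ with hr
  set y₀ := (a * t) • e - ((1 - δ) * s) • (q + ρ • e) with hy₀
  obtain ⟨y', hy', hgood⟩ := ht y₀ (by
    refine (norm_sub_le _ _).trans (le_of_eq ?_)
    rw [norm_smul, norm_smul, Real.norm_of_nonneg hc0.le, Real.norm_of_nonneg (by positivity), he,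
      hs]
    ring)
  have hy₀e : inner ℝ y₀ e = a * t - (1 - δ) * s * h := by
    rw [hy₀, inner_sub_left, inner_smul_left, inner_smul_left, inner_add_left, inner_smul_left,
      inner_self_of_unit he, hhdef]
    simp
  have har : (C ^ 2 + a ^ 2) * t < a * r := by
    have h1 : N * ρ / 2 * t ≤ r := by
      rw [hr, hs]
      nlinarith [mul_pos (mul_pos hN0 ht0) hρ]
    nlinarith
  have har' : a * t ≤ r := by
    have : a * (a * t) ≤ a * r := by nlinarith [mul_nonneg (sq_nonneg C) ht0.le]
    exact le_of_mul_le_mul_left this ha0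
  have hhalf := admissible_halfDatum le_rfl hH.theta_pos.le hH.theta_lt_one.le e
  have hadm := hH.admissible_ballDatum (d := d)
  have hc := hH.cBar_pos
  have hcmp := hH.localization ω _ _ _ _ (hH.isSolution_sol ω hhalf)
    (hH.isSolution_shift_time ω hadm y' hs0) (fun _ ht _ => hH.sol_mem_Icc _ hhalf ht _)
    (fun t ht _ => hH.sol_mem_Icc _ hadm (by positivity) _) ((cBar + 1) * t) (by positivity) x
    (fun z hz => ?_) t ht0
  · have h1 := (hgood (t + s) (by positivity) (by linarith) (x - y')).2 (fun hmem => ?_)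
    · linarith
    · have h2 := hS _ hmem
      have hd : 0 < (1 + δ) * (t + s) := by positivity
      rw [inner_smul_left, conj_trivial, inv_mul_lt_iff₀ hd, inner_sub_left] at h2
      have h3 := (abs_le.1 ((inner_le_norm_of_unit he (y' - y₀)).trans hy')).2
      rw [inner_sub_left, hy₀e] at h3
      have h4 : δ * ((2 * N + 1) * h) * t ≤ κ / 2 * t := by gcongr
      have h5 : a * t = κ * t / 3 := by rw [ha]; ring
      have h6 : (1 + δ) * (t + s) * h = h * t + (1 + δ) * (N * t * h) + δ * h * t := by
        rw [hs]
        ring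
      have h7 : (1 - δ) * s * h = (1 + δ) * (N * t * h) - 2 * (δ * N * h * t) := by
        rw [hs]
        ring
      linarith
  · rcases lt_or_ge (inner ℝ z e) 0 with hze | hze
    · rw [halfDatum_of_neg hze]
      have h1 := (hgood s hs0 htn (z - y')).1 (hball ?_)
      · linarith
      · rw [mem_ball_iff_norm]
        have heq : ((1 - δ) * s)⁻¹ • (z - y') - q =
            ((1 - δ) * s)⁻¹ • ((z + (r - a * t) • e) - (y' - y₀)) := by
          have h2 : z - y' = ((1 - δ) * s) • q + ((z + (r - a * t) • e) - (y' - y₀)) := by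
            rw [hy₀, hr]
            module
          rw [h2, smul_add, smul_smul, inv_mul_cancel₀ hc0.ne', one_smul, add_sub_cancel_left]
        rw [heq, norm_smul, Real.norm_of_nonneg (by positivity), inv_mul_lt_iff₀ hc0]
        have hzn : ‖z‖ ≤ C * t := by
          have h2 : ‖z‖ ≤ ‖z - x‖ + ‖x‖ := by simpa using norm_add_le (z - x) x
          rw [mem_ball_iff_norm] at hz
          rw [hC]
          linarith
        have hlt := norm_add_smul_lt_of_inner_nonpos he hze.le hzn ha0 ht0 har har'
        refine (norm_sub_le _ _).trans_lt ?_
        linarith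
    · rw [halfDatum_of_nonneg hze]
      exact (hH.sol_mem_Icc _ hadm hs0 _).1

/-- The outer normal of a supporting half-space of a Wulff shape that also supports an interior
ball is a front direction, with the distance from the origin to the supporting hyperplane as the
front speed. -/
theorem HypothesisH.isDeterministicFrontSpeed_of_support [IsProbabilityMeasure P] [NeZero d]
    (hH : HypothesisH P E mBar cBar θ₀ R₀) {w : Space d → ℝ}
    (hw : E.IsDeterministicWulffShape P θ₀ R₀ w) {q e : Space d} {ρ : ℝ} (hρ : 0 < ρ)
    (hball : Metric.ball q ρ ⊆ wulffSet w) (he : ‖e‖ = 1)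
    (hS : ∀ x ∈ wulffSet w, inner ℝ x e < inner ℝ q e + ρ) :
    E.IsDeterministicFrontSpeed P θ₀ e (inner ℝ q e + ρ) := by
  have hh : 0 < inner ℝ q e + ρ := by simpa using hS 0 (zero_mem_wulffSet hw.2.1)
  have hvis := ae_all_iff.2 fun k : ℕ => hH.ae_hasShapeVisits hw
    (δ := 1 / ((k : ℝ) + 2)) (ε := 1 / ((k : ℝ) + 2)) (by positivity)
    (by rw [div_lt_one (by positivity)]; linarith [(Nat.cast_nonneg k : (0 : ℝ) ≤ k)])
    (by positivity)
  filter_upwards [hvis] with ω hω K hK hKe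
  obtain ⟨κ, M, hκ, hM, hsub⟩ := exists_subset_halfBall hK hKe
  rw [frontDatum_eq]
  constructor
  · intro ε hε
    filter_upwards [hH.eventually_ge_of_visits hω hρ hball he hh hκ (|inner ℝ q e + ρ| + M) hε,
      eventually_ge_atTop 0] with t ht ht0 x hx
    obtain ⟨h1, h2⟩ := sub_mem_dilated he le_rfl (hsub hx) ht0
    exact ht _ h1 h2
  · intro ε hε
    filter_upwards [hH.eventually_le_of_visits hω hρ hball he hh hS hκ (|inner ℝ q e + ρ| + M) hε,
      eventually_ge_atTop 0] with t ht ht0 x hx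
    obtain ⟨h1, h2⟩ := add_mem_dilated he le_rfl (hsub hx) ht0
    exact ht _ h1 h2

/-! ### Wulff shapes: the formula -/

/-- A Wulff shape lies behind the hyperplane reached by each front at time one: spreading solutions
are dominated by fronts. -/
theorem HypothesisH.mul_inner_le_frontSpeed [IsProbabilityMeasure P]
    (hH : HypothesisH P E mBar cBar θ₀ R₀) {w : Space d → ℝ}
    (hw : E.IsDeterministicWulffShape P θ₀ R₀ w) {e e₁ : Space d} (he : ‖e‖ = 1) (he₁ : ‖e₁‖ = 1)
    {c : ℝ} (hc : E.IsDeterministicFrontSpeed P θ₀ e₁ c) (hi : 0 < inner ℝ e₁ e) :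
    w e * inner ℝ e₁ e ≤ c := by
  by_contra! hlt
  have hwe : 0 < w e := hw.2.1 e (by simpa using he)
  obtain ⟨ω, ⟨hω1, -⟩, hω2, hω3⟩ :=
    (hw.2.2.and ((hH.ae_isUniformFrontSpeed he₁ hc).and hc)).exists
  have hc0 : 0 < c := hH.frontSpeed_pos he₁ hω3
  set D := w e * inner ℝ e₁ e with hD
  set δ := (D - c) / (4 * D) with hδ
  have hD0 : 0 < D := by positivity
  have hδ0 : 0 < δ := div_pos (by linarith) (by positivity)
  have hδD : δ * D = (D - c) / 4 := by rw [hδ]; field_simp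
  have hδ1 : δ < 1 := by
    rw [hδ, div_lt_one (by positivity)]
    linarith
  have hκ : 0 < (D - c) / 8 := by linarith
  have hin : ((1 - δ) * w e) • e ∈ wulffSet w :=
    smul_mem_wulffSet he (mul_nonneg (by linarith) hwe.le) (by nlinarith)
  have hup := (hω2 ((D - c) / 8) (w e + 1) hκ).1 R₀ (1 / 4) (by norm_num)
  have hκt : Tendsto (fun t : ℝ => (D - c) / 8 * t) atTop atTop := tendsto_id.const_mul_atTop hκ
  obtain ⟨t, h1, h2, ht0, htR, ht1, htR'⟩ := ((hω1 δ hδ0 hδ1 (1 / 4) (by norm_num)).and (hup.and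
    ((eventually_gt_atTop 0).and ((hκt.eventually_ge_atTop R₀).and
      ((eventually_ge_atTop 1).and (eventually_ge_atTop R₀)))))).exists
  have h3 := h1 _ hin
  set x := ((1 - δ) * t) • ((1 - δ) * w e) • e with hx
  have hR := hH.radius_pos
  have hRe : ‖R₀ • e₁‖ = R₀ := by rw [norm_smul, he₁, mul_one, Real.norm_of_nonneg hR.le]
  have hxn : ‖x‖ ≤ w e * t := by
    rw [hx, norm_smul, norm_smul, he, mul_one, Real.norm_of_nonneg (by nlinarith),
      Real.norm_of_nonneg (by nlinarith)]
    have : (1 - δ) * (1 - δ) ≤ 1 := by nlinarith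
    calc (1 - δ) * t * ((1 - δ) * w e) = (1 - δ) * (1 - δ) * (w e * t) := by ring
      _ ≤ 1 * (w e * t) := by gcongr
      _ = w e * t := one_mul _
  have hxe : inner ℝ x e₁ = (1 - δ) * (1 - δ) * D * t := by
    rw [hx, inner_smul_left, inner_smul_left, hD, real_inner_comm e₁ e]
    simp only [conj_trivial]
    ring
  have hcmp := hH.sol_shift_le_sol_shift ω hH.admissible_ballDatum
    (admissible_halfDatum le_rfl hH.theta_pos.le hH.theta_lt_one.le e₁) (y := 0) (y' := R₀ • e₁)
    (fun z => ?_) ht0 x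
  · rw [hH.shift_zero, sub_zero] at hcmp
    have h4 := h2 (R₀ • e₁) (x - R₀ • e₁) ?_ ?_ ?_
    · linarith
    · rw [hRe]
      nlinarith
    · have := norm_sub_le x (R₀ • e₁)
      rw [hRe] at this
      linarith
    · rw [inner_sub_left, hxe, inner_smul_left, inner_self_of_unit he₁]
      simp only [conj_trivial, mul_one]
      have h5 : (1 - δ) * (1 - δ) * D = D - 2 * (δ * D) + δ * (δ * D) := by ring
      have h6 : 0 ≤ δ * (δ * D) := by positivity
      have h7 : c + (D - c) / 8 + (D - c) / 8 ≤ (1 - δ) * (1 - δ) * D := by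
        rw [h5]
        linarith
      nlinarith
  · rw [sub_zero]
    refine ballDatum_le ((admissible_halfDatum le_rfl hH.theta_pos.le hH.theta_lt_one.le e₁).2 _).1
      fun hz => ?_
    rw [halfDatum_of_neg]
    rw [inner_sub_left, inner_smul_left, inner_self_of_unit he₁]
    simp only [conj_trivial, mul_one]
    linarith [(abs_le.1 (inner_le_norm_of_unit he₁ z)).2]

/-- The formula for a Wulff shape in terms of the front speeds. -/
theorem HypothesisH.isGLB_wulff [IsProbabilityMeasure P] [NeZero d]
    (hH : HypothesisH P E mBar cBar θ₀ R₀) {cstar : Space d → ℝ}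
    (hcstar : ∀ e ∈ E.frontDirections P θ₀, E.IsDeterministicFrontSpeed P θ₀ e (cstar e))
    {w : Space d → ℝ} (hw : E.IsDeterministicWulffShape P θ₀ R₀ w) {e : Space d} (he : ‖e‖ = 1) :
    IsGLB {q : ℝ | ∃ e₁ ∈ E.frontDirections P θ₀,
      0 < inner ℝ e₁ e ∧ q = cstar e₁ / inner ℝ e₁ e} (w e) := by
  have hwe : 0 < w e := hw.2.1 e (by simpa using he)
  constructor
  · rintro _ ⟨e₁, he₁, hi, rfl⟩
    rw [le_div_iff₀ hi]
    exact hH.mul_inner_le_frontSpeed hw he he₁.1 (hcstar e₁ he₁) hi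
  · intro l hl
    by_contra! hlt
    have hl0 : 0 < l := hwe.trans hlt
    obtain ⟨r₀, hr₀, hrball⟩ := exists_ball_subset_wulffSet hw.1 hw.2.1
    set r := r₀ / 2 with hr
    have hr0 : 0 < r := by positivity
    -- An interior ball centred close to the boundary point `w(e) e` has a normal direction `e'`
    -- for which the infimum is almost attained.
    set η := min (1 / 2) (min (r / (2 * w e)) ((l - w e) * r / (2 * (l * w e)))) with hη
    have hη0 : 0 < η := by
      have : 0 < l - w e := by linarith
      positivity
    have hη2 : η ≤ 1 / 2 := min_le_left _ _
    have hηr : η * w e ≤ r / 2 := by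
      have := (min_le_right _ _ : η ≤ _).trans (min_le_left _ _)
      rw [le_div_iff₀ (by positivity)] at this
      linarith
    have hηl : η * (l * w e) ≤ (l - w e) * r / 2 := by
      have := (min_le_right _ _ : η ≤ _).trans (min_le_right _ _)
      rw [le_div_iff₀ (by positivity)] at this
      linarith
    obtain ⟨ρ, e', hρ, hρd, he', hball, hS⟩ := exists_interior_ball_support
      (isOpen_wulffSet hw.1 hw.2.1) (hH.convex_wulffSet hw) (smul_notMem_wulffSet he hwe)
      (smul_mem_wulffSet he (s := (1 - η) * w e) (by nlinarith) (by nlinarith))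
    have hdist : dist (((1 - η) * w e) • e) (w e • e) = η * w e := by
      rw [dist_eq_norm, ← sub_smul, norm_smul, he, mul_one, Real.norm_eq_abs,
        show (1 - η) * w e - w e = -(η * w e) by ring, abs_neg, abs_of_pos (by positivity)]
    rw [hdist] at hρd
    have hspeed := hH.isDeterministicFrontSpeed_of_support hw hρ hball he' hS
    set i := inner ℝ e' e with hi
    have hq : inner ℝ (((1 - η) * w e) • e) e' = (1 - η) * w e * i := by
      rw [inner_smul_left, real_inner_comm e' e, conj_trivial]
    rw [hq] at hspeed hS
    set h := (1 - η) * w e * i + ρ with hh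
    have hrh : r < h := by
      have := hS (r • e') (hrball (by
        rw [mem_ball_zero_iff, norm_smul, he', mul_one, Real.norm_of_nonneg hr0.le]
        linarith))
      rwa [inner_smul_left, inner_self_of_unit he', conj_trivial, mul_one] at this
    have hw1 : 0 < (1 - η) * w e := mul_pos (by linarith) hwe
    have hi0 : 0 < i := by
      have : 0 < (1 - η) * w e * i := by linarith
      exact (mul_pos_iff_of_pos_left hw1).1 this
    have hmem : e' ∈ E.frontDirections P θ₀ := ⟨he', h, hspeed⟩
    obtain ⟨ω, hω1, hω2⟩ := (hspeed.and (hcstar e' hmem)).exists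
    have hceq : cstar e' = h := frontSpeed_unique he' hω2 hω1
    have hle := hl ⟨e', hmem, hi0, rfl⟩
    rw [hceq, le_div_iff₀ hi0] at hle
    have h1 : l * (h - ρ) ≤ h * ((1 - η) * w e) := by
      have : l * i * ((1 - η) * w e) ≤ h * ((1 - η) * w e) := by gcongr
      have h2 : h - ρ = (1 - η) * w e * i := by rw [hh]; ring
      rw [h2]
      linarith
    have h2 : l * ρ ≤ l * (η * w e) := by gcongr
    have h3 : (l - w e) * r < (l - w e) * h := by
      have : 0 < l - w e := by linarith
      gcongr
    have h4 : 0 < η * w e * h := by positivity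
    nlinarith [mul_pos (sub_pos.2 hlt) hr0]

end

end FrontSpeeds

end

open FrontSpeeds in
theorem theorem1p9 {d : ℕ} [NeZero d] {Ω : Type*} [MeasurableSpace Ω] (P : Measure Ω)
    [IsProbabilityMeasure P] (E : RandomPDE d Ω) (mBar cBar θ₀ R₀ : ℝ)
    (hH : HypothesisH P E mBar cBar θ₀ R₀)
    (cstar : Space d → ℝ)
    (hcstar : ∀ e ∈ E.frontDirections P θ₀, E.IsDeterministicFrontSpeed P θ₀ e (cstar e)) :
    -- (i)
    (IsClosed (E.frontDirections P θ₀) ∧ IsClosed (E.exclusiveDirections P θ₀) ∧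
      (∀ e ∈ E.frontDirections P θ₀, 0 < cstar e ∧ cstar e ≤ cBar) ∧
      (∃ L : NNReal, LipschitzOnWith L cstar (E.frontDirections P θ₀)) ∧
      ∃ Ω₀ : Set Ω, MeasurableSet Ω₀ ∧ P Ω₀ = 1 ∧
        (∀ ω ∈ Ω₀, ∀ e ∈ E.frontDirections P θ₀, E.IsFrontSpeed θ₀ ω e (cstar e)) ∧
        (∀ ω ∈ Ω₀, ∀ e ∈ E.exclusiveDirections P θ₀,
          E.IsExclusiveFrontSpeed θ₀ ω e (cstar e)) ∧
        -- uniformity over directions, rotations, and translations of size `O(t)`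
        (∀ ω ∈ Ω₀, ∀ Λ : ℝ, 0 < Λ → ∀ K : Set (Space d), IsCompact K →
          K ⊆ {x | 0 < inner ℝ x (basisVec 0)} →
          (∀ ε : ℝ, 0 < ε → ∀ᶠ t in atTop, ∀ e ∈ E.frontDirections P θ₀,
            ∀ y : Space d, ‖y‖ ≤ Λ * t → ∀ R : Space d ≃ₗᵢ[ℝ] Space d, R (basisVec 0) = e →
              ∀ x ∈ K, 1 - ε ≤
                E.sol (E.shift y ω) (frontDatum θ₀ e) t (t • (cstar e • e - R x))) ∧
          (∀ ε : ℝ, 0 < ε → ∀ᶠ t in atTop, ∀ e ∈ E.frontDirections P θ₀,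
            ∀ y : Space d, ‖y‖ ≤ Λ * t → ∀ R : Space d ≃ₗᵢ[ℝ] Space d, R (basisVec 0) = e →
              ∀ x ∈ K,
                E.sol (E.shift y ω) (frontDatum θ₀ e) t (t • (cstar e • e + R x)) ≤ ε)) ∧
        -- the bounds for exclusive front speeds can be chosen consistently
        (∃ β : Space d → Set (Space d) → ℝ → ℝ,
          IsModulusFamily (basisVec 0) (β (basisVec 0)) ∧
          (∀ e ∈ E.exclusiveDirections P θ₀, ∀ R : Space d ≃ₗᵢ[ℝ] Space d,
            R (basisVec 0) = e → ∀ K : Set (Space d), IsCompact K →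
              K ⊆ {x | 0 < inner ℝ x (basisVec 0)} → β e (R '' K) = β (basisVec 0) K) ∧
          (∀ ω ∈ Ω₀, ∀ e ∈ E.exclusiveDirections P θ₀,
            E.IsExclusiveFrontSpeedWith θ₀ ω e (cstar e) (β e)) ∧
          (∀ ω ∈ Ω₀, ∀ Λ : ℝ, 0 < Λ → ∀ K : Set (Space d), IsCompact K →
            K ⊆ {x | 0 < inner ℝ x (basisVec 0)} →
            ∀ α ∈ Ioc (0 : ℝ) 1, ∀ ε : ℝ, 0 < ε → ∀ᶠ t in atTop,
              ∀ e ∈ E.exclusiveDirections P θ₀, ∀ y : Space d, ‖y‖ ≤ Λ * t →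
                ∀ R : Space d ≃ₗᵢ[ℝ] Space d, R (basisVec 0) = e → ∀ x ∈ K,
                  E.sol (E.shift y ω) (exclusiveDatum α e) t (t • (cstar e • e + R x))
                    ≤ β (basisVec 0) K α + ε))) ∧
    -- (ii)
    (∀ w : Space d → ℝ, E.IsDeterministicWulffShape P θ₀ R₀ w →
      ∀ e ∈ Metric.sphere (0 : Space d) 1,
        IsGLB {q : ℝ | ∃ e₁ ∈ E.frontDirections P θ₀,
          0 < inner ℝ e₁ e ∧ q = cstar e₁ / inner ℝ e₁ e} (w e)) := by
  have hθ := hH.theta_pos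
  obtain ⟨hTcl, hTae⟩ := hH.isClosed_frontDirections hcstar
  obtain ⟨hT'cl, B, hB, hT'ae⟩ := hH.isClosed_exclusiveDirections hcstar
  have hspeed : ∀ e ∈ E.frontDirections P θ₀, 0 < cstar e ∧ cstar e ≤ cBar := fun e he =>
    hH.frontSpeed_mem_Ioc hcstar he
  have habs : ∀ e ∈ E.frontDirections P θ₀, |cstar e| ≤ cBar := fun e he => by
    rw [abs_of_pos (hspeed e he).1]
    exact (hspeed e he).2
  refine ⟨⟨hTcl, hT'cl, hspeed, ⟨_, hH.lipschitzOnWith_frontSpeed (fun e he => he.1) hcstar⟩, ?_⟩,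
    ?_⟩
  · obtain ⟨Ω₀, hΩ₀, hP, hgood⟩ := exists_measurableSet_prob_eq_one (hTae.and hT'ae)
    have hunit : ∀ e ∈ E.frontDirections P θ₀, ‖e‖ = 1 := fun e he => he.1
    have hball : ∀ {e : Space d} {R : Space d ≃ₗᵢ[ℝ] Space d} {κ M : ℝ} {x : Space d},
        R (basisVec 0) = e → x ∈ halfBall (basisVec 0) κ M → R x ∈ halfBall e κ M := by
      rintro e R κ M x rfl ⟨hx1, hx2⟩
      exact ⟨by simpa using hx1, by simpa using hx2⟩
    refine ⟨Ω₀, hΩ₀, hP, fun ω hω e he => hH.isFrontSpeed_of_uniform (hgood ω hω).1 he.1 he,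
      fun ω hω e he => ⟨_, (hgood ω hω).2.2 e he⟩, ?_,
      fun e K => B (halfBallIndex e K), fun K _ _ => hB _, ?_, fun ω hω => (hgood ω hω).2.2, ?_⟩
    · intro ω hω Λ _ K hK hKe
      obtain ⟨κ, M, hκ, hM, hsub⟩ := exists_subset_halfBall hK hKe
      obtain ⟨h1, h2⟩ := (hgood ω hω).1 κ (cBar + M) hκ (add_nonneg hH.cBar_pos.le hM.le)
      constructor
      · intro ε hε
        filter_upwards [h2.dilated hunit habs Λ hε] with t ht e he y hy R hR x hx
        rw [frontDatum_eq]
        exact ht e he y hy _ (hball hR (hsub hx))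
      · intro ε hε
        filter_upwards [h1.dilated hunit habs Λ hε] with t ht e he y hy R hR x hx
        rw [frontDatum_eq]
        simpa using ht e he y hy _ (hball hR (hsub hx))
    · rintro e _ R rfl K _ _
      simp only [halfBallIndex_image]
    · intro ω hω Λ _ K hK hKe α hα ε hε
      have h1 := ((hgood ω hω).2.1 (halfBallIndex (basisVec 0) K) α hα).dilated
        (fun e he => he.1) (fun e he => habs e (exclusiveDirections_subset he)) Λ hε
      filter_upwards [h1] with t ht e he y hy R hR x hx
      rw [exclusiveDatum_eq]
      exact ht e he y hy _ (hball hR (subset_halfBall_index hK hKe hx))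
  · exact fun w hw e he => hH.isGLB_wulff hcstar hw (by simpa using he)
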